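/- **Setting.** Let $0<p<\hat p\le 1/2$ and let $1=t_0<t_1<t_2<\cdots$ be integers with $\lim_{n\to\infty}t_{n+1}/t_n=+\infty$. Let $\mu$ be the Borel probability measure on $\mathbb R$, carried by $[0,1]$, such that for all $n$ and all $\varepsilon_1,\dots,\varepsilon_n\in\{0,1\}$ the dyadic interval $I_{\varepsilon_1\cdots\varepsilon_n}=\big[\sum_{j\le n}\varepsilon_j2^{-j},\ \sum_{j\le n}\varepsilon_j2^{-j}+2^{-n}\big)$ has mass $\mu(I_{\varepsilon_1\cdots\varepsilon_n})=\prod_{j=1}^n\varpi_j$, where $\varpi_j=p$ if $\varepsilon_j=0$ and $\varpi_j=1-p$ if $\varepsilon_j=1$ when $t_{2k-1}\le j<t_{2k}$ for some $k\geq 1$, and $\varpi_j=\hat p$ if $\varepsilon_j=0$ and $\varpi_j=1-\hat p$ if $\varepsilon_j=1$ when $t_{2k}\le j<t_{2k+1}$ for some $k\ge 0$. Put $\overline\tau(q)=\log_2\big(\hat p^{\,q}+(1-\hat p)^q\big)$ and $\overline\tau'(\pm\infty)=\lim_{q\to\pm\infty}\overline\tau'(q)$. **Multifractal Hewitt–Stromberg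 functions.** Let $B(x,r)$ be the open ball and $K=\operatorname{supp}\mu$. For $q,t\in\mathbb R$ and $E\subseteq K$ let $M^q_{\mu,r}(E)$ be the supremum of $\sum_i\mu(B(x_i,r))^q$ over families of pairwise disjoint balls $B(x_i,r)$ with $x_i\in E$, and let $N^q_{\mu,r}(E)$ be the infimum of $\sum_i\mu(B(x_i,r))^q$ over coverings of $E$ by balls $B(x_i,r)$ with $x_i\in E$. Put $$\overline{\mathsf P}^{q,t}_\mu(E)=\limsup_{r\to0}M^q_{\mu,r}(E)(2r)^t,\qquad \overline{\mathsf H}^{q,t}_\mu(E)=\sup_{F\subseteq E}\liminf_{r\to0}N^q_{\mu,r}(F)(2r)^t,$$ and let $\mathsf P^{q,t}_\mu(E)$, $\mathsf H^{q,t}_\mu(E)$ be the infima of $\sum_i\overline{\mathsf P}^{q,t}_\mu(E_i)$, $\sum_i\overline{\mathsf H}^{q,t}_\mu(E_i)$ over countable covers $E\subseteq\bigcup_iE_i$. Then $\mathsf b_\mu(q)=\sup\{t\in\mathbb R:\mathsf H^{q,t}_\mu(K)=\infty\}$ and $\mathsf B_\mu(q)=\sup\{t\in\mathbb R:\mathsf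 P^{q,t}_\mu(K)=\infty\}$. Replacing $\mu(B(x,r))^q$ by $1$ gives measures $\mathsf H^t,\mathsf P^t$ of arbitrary sets $E\subseteq\mathbb R$, and the lower and upper Hewitt–Stromberg dimensions $\underline{\dim}_{MB}E=\sup\{t\ge0:\mathsf H^t(E)=\infty\}$ and $\overline{\dim}_{MB}E=\sup\{t\ge0:\mathsf P^t(E)=\infty\}$ (with $\sup\emptyset=0$). $\dim_H$ and $\dim_P$ are the Hausdorff and packing dimensions. Let $E_\mu(\alpha)$ be the set of $x\in K$ with $\lim_{r\to0}\log\mu(B(x,r))/\log r=\alpha$, and write $\chi^*(x)=\inf_{y\in\mathbb R}(xy+\chi(y))$ for the Legendre transform. **Theorem 4.4.** The functions $\mathsf b_\mu,\mathsf B_\mu$ are finite on $\mathbb R$ and have right and left derivatives (indices $+$ and $-$) at $0$ and at $1$, and the limits $\overline\tau'(\pm\infty)$ exist and are finite. Let $\alpha\in\big(-\overline\tau'(+\infty),-\overline\tau'(-\infty)\big)$. Here $[a,b]=\{x:a\le x\le b\}$, which is empty if $a>b$. 1. If $\alpha\notin[-\mathsf b_{\mu+}'(0),-\mathsf b_{\mu-}'(0)]\cup[-\mathsf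 b_{\mu+}'(1),-\mathsf b_{\mu-}'(1)]$, then $\dim_HE_\mu(\alpha)=\underline{\dim}_{MB}E_\mu(\alpha)=\mathsf b_\mu^*(\alpha)$. 2. If $\alpha\notin[-\mathsf B_{\mu+}'(0),-\mathsf B_{\mu-}'(0)]\cup[-\mathsf B_{\mu+}'(1),-\mathsf B_{\mu-}'(1)]$, then $\dim_PE_\mu(\alpha)=\overline{\dim}_{MB}E_\mu(\alpha)=\mathsf B_\mu^*(\alpha)$. -/

import Mathlib

open Set Filter Topology MeasureTheory Metric
open scoped ENNReal NNReal

noncomputable section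

namespace HewittStromberg

section Dimensions

variable {X : Type*} [MetricSpace X]

/-- The balls of radius `r` centred at the points of `s` form a centred packing of `E`. -/
def IsCenteredPacking (E : Set X) (r : ℝ) (s : Set X) : Prop :=
  s ⊆ E ∧ s.PairwiseDisjoint (fun x => ball x r)

/-- The balls of radius `r` centred at the points of `s` form a centred covering of `E`. -/
def IsCenteredCover (E : Set X) (r : ℝ) (s : Set X) : Prop :=
  s ⊆ E ∧ E ⊆ ⋃ x ∈ s, ball x r

/-- Supremum of `∑ w(x_i, r)` over centred packings of `E` by balls of radius `r`.
For `w = 1` it is the packing number `M_r(E)`, for `w(x, r) = μ(B(x, r))^q` it is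
`M_{μ,r}^q(E)`. -/
def packingSum (w : X → ℝ → ℝ≥0∞) (r : ℝ) (E : Set X) : ℝ≥0∞ :=
  ⨆ (s : Set X) (_ : IsCenteredPacking E r s), ∑' x : s, w x r

/-- Infimum of `∑ w(x_i, r)` over centred coverings of `E` by balls of radius `r`.
For `w = 1` it is the covering number `N_r(E)`, for `w(x, r) = μ(B(x, r))^q` it is
`N_{μ,r}^q(E)`. -/
def coveringSum (w : X → ℝ → ℝ≥0∞) (r : ℝ) (E : Set X) : ℝ≥0∞ :=
  ⨅ (s : Set X) (_ : IsCenteredCover E r s), ∑' x : s, w x r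

/-- Method I: the infimum of `∑ ν(E_i)` over countable covers of `E`. -/
def methodI (ν : Set X → ℝ≥0∞) (E : Set X) : ℝ≥0∞ :=
  ⨅ (A : ℕ → Set X) (_ : E ⊆ ⋃ i, A i), ∑' i, ν (A i)

/-- The set function `L^t`: the lower limit of `N_r (2r)^t` as `r → 0`. -/
def lowerContent (w : X → ℝ → ℝ≥0∞) (t : ℝ) (E : Set X) : ℝ≥0∞ :=
  liminf (fun r : ℝ => coveringSum w r E * ENNReal.ofReal (2 * r) ^ t) (𝓝[>] 0)

/-- The lower pre-measure: `L^t` made monotone. -/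
def lowerPremeasure (w : X → ℝ → ℝ≥0∞) (t : ℝ) (E : Set X) : ℝ≥0∞ :=
  ⨆ (F : Set X) (_ : F ⊆ E), lowerContent w t F

/-- The upper pre-measure: the upper limit of `M_r (2r)^t` as `r → 0`. -/
def upperPremeasure (w : X → ℝ → ℝ≥0∞) (t : ℝ) (E : Set X) : ℝ≥0∞ :=
  limsup (fun r : ℝ => packingSum w r E * ENNReal.ofReal (2 * r) ^ t) (𝓝[>] 0)

/-- The lower (weighted) Hewitt–Stromberg measure. -/
def lowerMeasure (w : X → ℝ → ℝ≥0∞) (t : ℝ) (E : Set X) : ℝ≥0∞ :=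
  methodI (lowerPremeasure w t) E

/-- The upper (weighted) Hewitt–Stromberg measure. -/
def upperMeasure (w : X → ℝ → ℝ≥0∞) (t : ℝ) (E : Set X) : ℝ≥0∞ :=
  methodI (upperPremeasure w t) E

/-- The lower Hewitt–Stromberg dimension. -/
def lowerDim (E : Set X) : ℝ≥0∞ :=
  ⨆ (t : ℝ≥0) (_ : lowerMeasure (fun _ _ => 1) (t : ℝ) E = ∞), (t : ℝ≥0∞)

/-- The upper Hewitt–Stromberg dimension. -/
def upperDim (E : Set X) : ℝ≥0∞ :=
  ⨆ (t : ℝ≥0) (_ : upperMeasure (fun _ _ => 1) (t : ℝ) E = ∞), (t : ℝ≥0∞)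

/-- The supremum of `∑ (2 r_i)^t` over families of pairwise disjoint open balls `B(x_i, r_i)`
with `x_i ∈ E` and `0 < r_i ≤ δ`. -/
def packingPremeasureAt (δ t : ℝ) (E : Set X) : ℝ≥0∞ :=
  ⨆ (s : Set (X × ℝ)) (_ : (∀ b ∈ s, b.1 ∈ E ∧ 0 < b.2 ∧ b.2 ≤ δ) ∧
    s.PairwiseDisjoint (fun b => ball b.1 b.2)), ∑' b : s, ENNReal.ofReal (2 * b.1.2) ^ t

/-- The packing pre-measure, the limit for `δ → 0`. -/
def packingPremeasure (t : ℝ) (E : Set X) : ℝ≥0∞ :=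
  ⨅ (δ : ℝ) (_ : 0 < δ), packingPremeasureAt δ t E

/-- The packing dimension. -/
def packingDim (E : Set X) : ℝ≥0∞ :=
  ⨆ (t : ℝ≥0) (_ : methodI (packingPremeasure (t : ℝ)) E = ∞), (t : ℝ≥0∞)

end Dimensions

section Multifractal

variable {X : Type*} [MetricSpace X] [MeasurableSpace X]

/-- The weight `μ(B(x, r))^q`. -/
def ballPow (μ : Measure X) (q : ℝ) (x : X) (r : ℝ) : ℝ≥0∞ := μ (ball x r) ^ q

/-- The separator function `b_μ`: the critical exponent of the lower multifractal
Hewitt–Stromberg measures of the support of `μ`. -/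
def bSep (μ : Measure X) (q : ℝ) : EReal :=
  ⨆ (t : ℝ) (_ : lowerMeasure (ballPow μ q) t μ.support = ∞), (t : EReal)

/-- The separator function `B_μ`: the critical exponent of the upper multifractal
Hewitt–Stromberg measures of the support of `μ`. -/
def BSep (μ : Measure X) (q : ℝ) : EReal :=
  ⨆ (t : ℝ) (_ : upperMeasure (ballPow μ q) t μ.support = ∞), (t : EReal)

/-- Lower local dimension of `μ` at `x`. -/
def lowerLocalDim (μ : Measure X) (x : X) : EReal :=
  liminf (fun r : ℝ => ((Real.log (μ.real (ball x r)) / Real.log r : ℝ) : EReal)) (𝓝[>] 0)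

/-- Upper local dimension of `μ` at `x`. -/
def upperLocalDim (μ : Measure X) (x : X) : EReal :=
  limsup (fun r : ℝ => ((Real.log (μ.real (ball x r)) / Real.log r : ℝ) : EReal)) (𝓝[>] 0)

/-- The level set `E_μ(α)` of the local dimension. -/
def levelSet (μ : Measure X) (α : ℝ) : Set X :=
  {x | x ∈ μ.support ∧ (α : EReal) ≤ lowerLocalDim μ x ∧ upperLocalDim μ x ≤ (α : EReal)}

end Multifractal

/-- The Legendre transform `χ^*(x) = inf_y (x y + χ(y))`. -/
def legendre (χ : ℝ → EReal) (x : ℝ) : EReal := ⨅ y : ℝ, ((x * y : ℝ) : EReal) + χ y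

section BlockMeasure

/-- The mass given to the digit `0` in position `j ≥ 1`: it is `p` if
`t_{2k-1} ≤ j < t_{2k}` for some `k ≥ 1`, and `ph` on the other blocks
`t_{2k} ≤ j < t_{2k+1}`. -/
def zeroMass (p ph : ℝ) (t : ℕ → ℕ) (j : ℕ) : ℝ :=
  open Classical in if ∃ k, t (2 * k + 1) ≤ j ∧ j < t (2 * k + 2) then p else ph

/-- The mass `ϖ_j` given to the digit `e` in position `j`. -/
def digitMass (p ph : ℝ) (t : ℕ → ℕ) (j : ℕ) (e : Fin 2) : ℝ :=
  if e = 0 then zeroMass p ph t j else 1 - zeroMass p ph t j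

/-- The law of the `j`-th binary digit. -/
def digitLaw (p ph : ℝ) (t : ℕ → ℕ) (j : ℕ) : Measure (Fin 2) :=
  ENNReal.ofReal (digitMass p ph t j 0) • Measure.dirac 0 +
    ENNReal.ofReal (digitMass p ph t j 1) • Measure.dirac 1

/-- The law of the real number `0.ε₁ε₂ε₃…` (in base `2`) with independent digits `ε_j`,
where `ε_j` has law `digitLaw p ph t j`; the sequence of digits is indexed from `0`. -/
def blockMeasure (p ph : ℝ) (t : ℕ → ℕ) : Measure ℝ :=
  (Measure.infinitePi (fun i : ℕ => digitLaw p ph t (i + 1))).map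
    (Real.ofDigits : (ℕ → Fin 2) → ℝ)

/-- The dyadic interval of generation `n` with the digits `ε₁ … ε_n`. -/
def dyadicInterval {n : ℕ} (e : Fin n → Fin 2) : Set ℝ :=
  Ico (∑ i : Fin n, ((e i : ℕ) : ℝ) * ((2 : ℝ) ^ ((i : ℕ) + 1))⁻¹)
    (∑ i : Fin n, ((e i : ℕ) : ℝ) * ((2 : ℝ) ^ ((i : ℕ) + 1))⁻¹ + ((2 : ℝ) ^ n)⁻¹)

instance isProbabilityMeasure_digitLaw (p ph : ℝ) (t : ℕ → ℕ) (j : ℕ)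
    [hp : Fact (0 ≤ p ∧ p ≤ 1)] [hph : Fact (0 ≤ ph ∧ ph ≤ 1)] :
    IsProbabilityMeasure (digitLaw p ph t j) := by
  have h : 0 ≤ zeroMass p ph t j ∧ zeroMass p ph t j ≤ 1 := by
    unfold zeroMass
    split_ifs
    · exact hp.out
    · exact hph.out
  constructor
  simp only [digitLaw, digitMass, Measure.coe_add, Measure.coe_smul, Pi.add_apply, Pi.smul_apply,
    measure_univ, smul_eq_mul, mul_one]
  rw [← ENNReal.ofReal_add] <;> simp <;> linarith

theorem digitLaw_singleton (p ph : ℝ) (t : ℕ → ℕ) (j : ℕ) (e : Fin 2) :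
    digitLaw p ph t j {e} = ENNReal.ofReal (digitMass p ph t j e) := by
  fin_cases e <;> simp [digitLaw]

theorem ofDigits_shift (d : ℕ → Fin 2) :
    Real.ofDigits d = ((d 0 : ℕ) : ℝ) / 2 + Real.ofDigits (fun i => d (i + 1)) / 2 := by
  rw [Real.ofDigits_eq_sum_add_ofDigits d 1]
  simp [Real.ofDigitsTerm]
  ring

theorem ofDigits_lt_one (n : ℕ) : ∀ d : ℕ → Fin 2, d n = 0 → Real.ofDigits d < 1 := by
  induction n with
  | zero =>
    intro d hd
    rw [ofDigits_shift, hd]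
    have := Real.ofDigits_le_one (fun i => d (i + 1))
    simp
    linarith
  | succ n ih =>
    intro d hd
    rw [ofDigits_shift]
    have h1 := ih (fun i => d (i + 1)) hd
    have h2 : ((d 0 : ℕ) : ℝ) ≤ 1 := by exact_mod_cast Nat.lt_succ_iff.mp (d 0).isLt
    linarith

theorem mem_dyadicInterval_succ {n : ℕ} (e : Fin (n + 1) → Fin 2) (x : ℝ) :
    x ∈ dyadicInterval e ↔ 2 * x - ((e 0 : ℕ) : ℝ) ∈ dyadicInterval (fun i => e i.succ) := by
  have key : ∑ i : Fin (n + 1), ((e i : ℕ) : ℝ) * ((2 : ℝ) ^ ((i : ℕ) + 1))⁻¹ =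
      ((e 0 : ℕ) : ℝ) / 2 +
        (∑ i : Fin n, ((e i.succ : ℕ) : ℝ) * ((2 : ℝ) ^ ((i : ℕ) + 1))⁻¹) / 2 := by
    rw [Fin.sum_univ_succ, Finset.sum_div]
    congr 1
    · simp [div_eq_mul_inv]
    · refine Finset.sum_congr rfl fun i _ => ?_
      rw [Fin.val_succ, pow_succ _ ((i : ℕ) + 1), mul_inv]
      ring
  have hpow : ((2 : ℝ) ^ (n + 1))⁻¹ = ((2 : ℝ) ^ n)⁻¹ / 2 := by
    rw [pow_succ, mul_inv]; ring
  unfold dyadicInterval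
  rw [key, hpow, mem_Ico, mem_Ico]
  constructor <;> rintro ⟨h1, h2⟩ <;> constructor <;> linarith

theorem dyadicInterval_subset {n : ℕ} (e : Fin n → Fin 2) : dyadicInterval e ⊆ Ico 0 1 := by
  induction n with
  | zero => intro x hx; simpa [dyadicInterval] using hx
  | succ n ih =>
    intro x hx
    have h := ih _ ((mem_dyadicInterval_succ e x).1 hx)
    have h2 : ((e 0 : ℕ) : ℝ) ≤ 1 := by exact_mod_cast Nat.lt_succ_iff.mp (e 0).isLt
    have h3 : (0 : ℝ) ≤ ((e 0 : ℕ) : ℝ) := Nat.cast_nonneg _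
    exact ⟨by linarith [h.1], by linarith [h.2]⟩

theorem ofDigits_mem_dyadicInterval {n : ℕ} (e : Fin n → Fin 2) (d : ℕ → Fin 2)
    (hd : ∀ m, ∃ i, m ≤ i ∧ d i = 0) :
    Real.ofDigits d ∈ dyadicInterval e ↔ ∀ i : Fin n, d i = e i := by
  induction n generalizing d with
  | zero =>
    obtain ⟨i, -, hi⟩ := hd 0
    simpa [dyadicInterval] using ⟨Real.ofDigits_nonneg d, ofDigits_lt_one i d hi⟩
  | succ n ih =>
    have hd' : ∀ m, ∃ i, m ≤ i ∧ (fun i => d (i + 1)) i = 0 := by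
      intro m
      obtain ⟨i, hi, h0⟩ := hd (m + 1)
      refine ⟨i - 1, by omega, ?_⟩
      have : i - 1 + 1 = i := by omega
      simpa [this] using h0
    have h0 := Real.ofDigits_nonneg (fun i => d (i + 1))
    have h1 : Real.ofDigits (fun i => d (i + 1)) < 1 := by
      obtain ⟨i, -, hi⟩ := hd' 0
      exact ofDigits_lt_one i _ hi
    have hs : 2 * Real.ofDigits d - ((e 0 : ℕ) : ℝ) =
        ((d 0 : ℕ) : ℝ) - ((e 0 : ℕ) : ℝ) + Real.ofDigits (fun i => d (i + 1)) := by
      rw [ofDigits_shift d]; ring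
    rw [mem_dyadicInterval_succ, hs, Fin.forall_fin_succ]
    by_cases h : d 0 = e 0
    · rw [h, sub_self, zero_add, ih _ _ hd']
      simp [h]
    · have hne : ¬ (d ((0 : Fin (n + 1)) : ℕ) = e 0 ∧
          ∀ i : Fin n, d ((i.succ : Fin (n + 1)) : ℕ) = e i.succ) := fun hh => h hh.1
      refine ⟨fun hm => ?_, fun hm => absurd hm hne⟩
      exfalso
      have hI := dyadicInterval_subset _ hm
      rcases Fin.exists_fin_two.1 ⟨d 0, rfl⟩ with hd0 | hd0 <;>
        rcases Fin.exists_fin_two.1 ⟨e 0, rfl⟩ with he0 | he0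
      · exact h (hd0.trans he0.symm)
      · rw [hd0, he0] at hI
        have := hI.1
        norm_num at this
        linarith
      · rw [hd0, he0] at hI
        have := hI.2
        norm_num at this
        linarith
      · exact h (hd0.trans he0.symm)

/-- The measure of a dyadic interval is the product of the masses of its digits. -/
theorem blockMeasure_dyadicInterval (p ph : ℝ) (hp : 0 < p) (hpph : p < ph) (hph : ph ≤ 1 / 2)
    (t : ℕ → ℕ) {n : ℕ} (e : Fin n → Fin 2) :
    blockMeasure p ph t (dyadicInterval e) =
      ENNReal.ofReal (∏ i : Fin n, digitMass p ph t ((i : ℕ) + 1) (e i)) := by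
  have : Fact (0 ≤ p ∧ p ≤ 1) := ⟨by linarith, by linarith⟩
  have : Fact (0 ≤ ph ∧ ph ≤ 1) := ⟨by linarith, by linarith⟩
  have hz : ∀ j, p ≤ zeroMass p ph t j ∧ zeroMass p ph t j ≤ 1 / 2 := by
    intro j
    unfold zeroMass
    split_ifs <;> constructor <;> linarith
  set P := Measure.infinitePi (fun i : ℕ => digitLaw p ph t (i + 1)) with hP
  have hnull : ∀ m : ℕ, P {d | ∀ i, m ≤ i → d i = 1} = 0 := by
    intro m
    have hle : ∀ k : ℕ, P {d | ∀ i, m ≤ i → d i = 1} ≤ ENNReal.ofReal (1 - p) ^ k := by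
      intro k
      calc P {d | ∀ i, m ≤ i → d i = 1}
          ≤ P (Set.pi (Finset.Ico m (m + k) : Finset ℕ) (fun _ => {1})) := by
            refine measure_mono fun d hd i hi => ?_
            simp only [Finset.coe_Ico, mem_Ico] at hi
            exact hd i hi.1
        _ = ∏ i ∈ Finset.Ico m (m + k), digitLaw p ph t (i + 1) {1} :=
            Measure.infinitePi_pi _ (fun _ _ => MeasurableSet.singleton _)
        _ ≤ ∏ _i ∈ Finset.Ico m (m + k), ENNReal.ofReal (1 - p) := by
            refine Finset.prod_le_prod' fun i _ => ?_
            rw [digitLaw_singleton]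
            refine ENNReal.ofReal_le_ofReal ?_
            simp only [digitMass, one_ne_zero, if_false]
            linarith [(hz (i + 1)).1]
        _ = ENNReal.ofReal (1 - p) ^ k := by simp
    have hlim : Tendsto (fun k : ℕ => ENNReal.ofReal (1 - p) ^ k) atTop (𝓝 0) :=
      ENNReal.tendsto_pow_atTop_nhds_zero_of_lt_one
        (by rw [ENNReal.ofReal_lt_one]; linarith)
    exact le_antisymm (ge_of_tendsto' hlim hle) (zero_le)
  have hae : ∀ᵐ d ∂P, ∀ m, ∃ i, m ≤ i ∧ d i = 0 := by
    rw [ae_all_iff]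
    intro m
    refine measure_mono_null ?_ (hnull m)
    intro d hd i hi
    by_contra h
    exact hd ⟨i, hi, (Fin.exists_fin_two.1 ⟨d i, rfl⟩).elim id fun h1 => absurd h1 h⟩
  have hmeas : Measurable (Real.ofDigits : (ℕ → Fin 2) → ℝ) := Real.continuous_ofDigits.measurable
  rw [blockMeasure, Measure.map_apply hmeas (by exact measurableSet_Ico), ← hP]
  let e' : ℕ → Fin 2 := fun i => if h : i < n then e ⟨i, h⟩ else 0
  have hcongr : P (Real.ofDigits ⁻¹' dyadicInterval e) =
      P (Set.pi (Finset.range n : Finset ℕ) (fun i => {e' i})) := by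
    refine measure_congr ?_
    filter_upwards [hae] with d hd
    refine propext ?_
    change Real.ofDigits d ∈ dyadicInterval e ↔ d ∈ Set.pi _ _
    rw [ofDigits_mem_dyadicInterval e d hd]
    constructor
    · intro h i hi
      have hi' : i < n := by simpa using hi
      simpa [e', hi'] using h ⟨i, hi'⟩
    · intro h i
      have := h i (by simp)
      simpa [e'] using this
  rw [hcongr, hP, Measure.infinitePi_pi _ (fun _ _ => MeasurableSet.singleton _),
    ENNReal.ofReal_prod_of_nonneg, Finset.prod_range]
  · refine Finset.prod_congr rfl fun i _ => ?_
    rw [digitLaw_singleton]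
    simp [e']
  · intro i _
    unfold digitMass
    split_ifs <;> linarith [(hz ((i : ℕ) + 1)).1, (hz ((i : ℕ) + 1)).2]

theorem isProbabilityMeasure_blockMeasure (p ph : ℝ) (hp : 0 < p) (hpph : p < ph)
    (hph : ph ≤ 1 / 2) (t : ℕ → ℕ) : IsProbabilityMeasure (blockMeasure p ph t) := by
  have : Fact (0 ≤ p ∧ p ≤ 1) := ⟨by linarith, by linarith⟩
  have : Fact (0 ≤ ph ∧ ph ≤ 1) := ⟨by linarith, by linarith⟩
  exact Measure.isProbabilityMeasure_map Real.continuous_ofDigits.measurable.aemeasurable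

/-- The function `q ↦ log₂ (ph^q + (1 - ph)^q)`. -/
def tau (ph : ℝ) (q : ℝ) : ℝ := Real.logb 2 (ph ^ q + (1 - ph) ^ q)

end BlockMeasure

end HewittStromberg

end

noncomputable section

namespace HewittStromberg

/-! Write μ for the block measure. Its digits are independent, so the sum of the `q`-th powers of
the masses of the dyadic cells of generation `n` is exactly `2 ^ S_n`, where `S_n` adds `tau p q` or
`tau ph q` for each position according to its block (`sum_dyadicCell_rpow`). As `t (n+1) / t n → ∞`,
every block swamps all earlier ones, so `S_n / n` comes arbitrarily close to both values infinitely
often while staying between them. Quantities defined by a lower limit therefore see the minimum and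
those defined by an upper limit see the maximum: `b = min (tau p) (tau ph)` and `B = max (tau p)
(tau ph)` (`bSep_blockMeasure`, `BSep_blockMeasure`). The lower bounds come from the block measure
with Gibbs weights of exponent `q`.

For the level sets, a Chebyshev argument on the partition function bounds the dimensions above by `α
q + b q` and `α q + B q`, for every `q` (`lowerDim_levelSet_le`, `packingDim_levelSet_le`). For the
lower bounds, choose `q₁`, `q₂` at which the derivatives of `tau p` and `tau ph` equal `-α`. The
block measure with weights `gibbs p q₁`, `gibbs ph q₂` gives full mass to points of the level set,
and the exponent of its own balls oscillates between the entropies `α q₁ + tau p q₁` and `α q₂ + tau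
ph q₂`, the Legendre transforms of the two functions at `α`. Hence the Hausdorff dimension is at
least their minimum and the upper Hewitt–Stromberg dimension at least their maximum
(`le_dimH_levelSet`, `le_upperDim_levelSet`).

The bounds have to be matched. An infimum over `q` commutes with a minimum. It commutes with the
maximum if one of the minimisers lies where its own function is the larger one; since `tau p ≤ tau
ph` on `[0, 1]` and `tau ph ≤ tau p` outside, this can fail only for `α` between the one-sided
slopes of `-B` at `0` or at `1`.

Balls are compared with dyadic cells through typical digit sequences: runs of equal digits have
length `o(n)`, which keeps the point away from the endpoints of its cells (`ae_ball_estimate`). -/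

theorem zeroMass_eq_or (u v : ℝ) (t : ℕ → ℕ) (j : ℕ) :
    zeroMass u v t j = u ∨ zeroMass u v t j = v := by
  unfold zeroMass
  split_ifs <;> simp

theorem zeroMass_mem {s : Set ℝ} {u v : ℝ} (hu : u ∈ s) (hv : v ∈ s) (t : ℕ → ℕ) (j : ℕ) :
    zeroMass u v t j ∈ s := by
  rcases zeroMass_eq_or u v t j with h | h <;> rwa [h]

/-! ### Laws of large numbers for the digits -/

/-- The strong law of large numbers for independent uniformly sub-Gaussian variables. -/
theorem ae_tendsto_average_zero {Ω : Type*} [MeasurableSpace Ω] {P : Measure Ω}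
    {X : ℕ → Ω → ℝ} (hX : ProbabilityTheory.iIndepFun X P) {c : ℝ≥0}
    (hc : ∀ i, ProbabilityTheory.HasSubgaussianMGF (X i) c P) :
    ∀ᵐ ω ∂P, Tendsto (fun n : ℕ => (∑ i ∈ Finset.range n, X i ω) / n) atTop (𝓝 0) := by
  have hprob : IsProbabilityMeasure P := hX.isProbabilityMeasure
  have key : ∀ Y : ℕ → Ω → ℝ, ProbabilityTheory.iIndepFun Y P →
      (∀ i, ProbabilityTheory.HasSubgaussianMGF (Y i) c P) → ∀ ε : ℝ, 0 < ε →
      ∀ᵐ ω ∂P, ∀ᶠ n : ℕ in atTop, ∑ i ∈ Finset.range n, Y i ω < ε * n := by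
    intro Y hY hYc ε hε
    -- A strictly positive variance proxy is needed for the exponential rate `ε ^ 2 / (2 * c')` to
    -- make sense when `c = 0`.
    set c' : ℝ≥0 := c + 1
    have hYc' : ∀ i, ProbabilityTheory.HasSubgaussianMGF (Y i) c' P := by
      intro i
      refine ⟨(hYc i).integrable_exp_mul, fun s => ((hYc i).mgf_le s).trans ?_⟩
      refine Real.exp_le_exp.2 ?_
      have : (c : ℝ) ≤ c' := by simp [c']
      have h2 := mul_le_mul_of_nonneg_right this (sq_nonneg s)
      linarith
    have hc0 : (0 : ℝ) < c' := by simp only [c']; positivity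
    have hle : ∀ n : ℕ, P {ω | ε * n ≤ ∑ i ∈ Finset.range n, Y i ω} ≤
        ENNReal.ofReal (Real.exp (n * (-ε ^ 2 / (2 * c')))) := by
      intro n
      have h := ProbabilityTheory.HasSubgaussianMGF.measure_sum_range_ge_le_of_iIndepFun hY
        (c := c') (n := n) (fun i _ => hYc' i) (ε := ε * n) (by positivity)
      rw [← ENNReal.ofReal_toReal (measure_ne_top P _)]
      refine ENNReal.ofReal_le_ofReal (h.trans (Real.exp_le_exp.2 (le_of_eq ?_)))
      rcases Nat.eq_zero_or_pos n with rfl | hn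
      · simp
      · field_simp
    have hsum : Summable fun n : ℕ => Real.exp (n * (-ε ^ 2 / (2 * c'))) :=
      Real.summable_exp_nat_mul_iff.2 (div_neg_of_neg_of_pos (by simp; positivity) (by positivity))
    -- The Chernoff bounds are summable, so Borel–Cantelli applies.
    have hfin : ∑' n : ℕ, P {ω | ε * n ≤ ∑ i ∈ Finset.range n, Y i ω} ≠ ∞ :=
      ne_top_of_le_ne_top hsum.tsum_ofReal_ne_top (ENNReal.tsum_le_tsum hle)
    filter_upwards [ae_eventually_notMem hfin] with ω hω
    filter_upwards [hω] with n hn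
    simpa using hn
  have hpos : ∀ᵐ ω ∂P, ∀ k : ℕ, ∀ᶠ n : ℕ in atTop,
      ∑ i ∈ Finset.range n, X i ω < (1 / ((k : ℝ) + 1)) * n :=
    ae_all_iff.2 fun k => key X hX hc _ (by positivity)
  have hneg : ∀ᵐ ω ∂P, ∀ k : ℕ, ∀ᶠ n : ℕ in atTop,
      ∑ i ∈ Finset.range n, (-X i) ω < (1 / ((k : ℝ) + 1)) * n :=
    ae_all_iff.2 fun k => key (fun i => -X i)
      (hX.comp (fun _ x => -x) fun _ => measurable_neg) (fun i => (hc i).neg) _ (by positivity)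
  filter_upwards [hpos, hneg] with ω h1 h2
  rw [Metric.tendsto_atTop]
  intro ε hε
  obtain ⟨k, hk⟩ := exists_nat_one_div_lt hε
  obtain ⟨N, hN⟩ := eventually_atTop.1 ((h1 k).and ((h2 k).and (eventually_gt_atTop 0)))
  refine ⟨N, fun n hn => ?_⟩
  obtain ⟨a1, a2, a3⟩ := hN n hn
  have hn0 : (0 : ℝ) < n := by exact_mod_cast a3
  simp only [Pi.neg_apply, Finset.sum_neg_distrib] at a2
  rw [Real.dist_eq, sub_zero]
  refine lt_of_le_of_lt ?_ hk
  rw [abs_le]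
  constructor
  · rw [le_div_iff₀ hn0]; linarith
  · rw [div_le_iff₀ hn0]; linarith

theorem isProbabilityMeasure_digitLaw_of_mem {a c : ℝ} (ha : a ∈ Ioo (0 : ℝ) 1)
    (hc : c ∈ Ioo (0 : ℝ) 1) (t : ℕ → ℕ) (j : ℕ) : IsProbabilityMeasure (digitLaw a c t j) := by
  have : Fact (0 ≤ a ∧ a ≤ 1) := ⟨ha.1.le, ha.2.le⟩
  have : Fact (0 ≤ c ∧ c ≤ 1) := ⟨hc.1.le, hc.2.le⟩
  infer_instance

/-- The law of the digit sequence whose image is `blockMeasure`. -/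
def digitSeqLaw (a c : ℝ) (t : ℕ → ℕ) : Measure (ℕ → Fin 2) :=
  Measure.infinitePi (fun i : ℕ => digitLaw a c t (i + 1))

theorem blockMeasure_eq_map (a c : ℝ) (t : ℕ → ℕ) :
    blockMeasure a c t = (digitSeqLaw a c t).map Real.ofDigits := rfl

/-- The subtracted term is the mean of `f i` under the law of the digit; bounded independent
variables are uniformly sub-Gaussian by Hoeffding's lemma. -/
theorem ae_average_digits {a c : ℝ} (ha : a ∈ Ioo (0 : ℝ) 1) (hc : c ∈ Ioo (0 : ℝ) 1)
    (t : ℕ → ℕ) (f : ℕ → Fin 2 → ℝ) (C : ℝ) (hf : ∀ i e, |f i e| ≤ C) :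
    ∀ᵐ d ∂(digitSeqLaw a c t), Tendsto (fun n : ℕ => (∑ i ∈ Finset.range n, (f i (d i) -
      (zeroMass a c t (i + 1) * f i 0 + (1 - zeroMass a c t (i + 1)) * f i 1))) / n)
      atTop (𝓝 0) := by
  have hprob : ∀ j, IsProbabilityMeasure (digitLaw a c t j) :=
    fun j => isProbabilityMeasure_digitLaw_of_mem ha hc t j
  have hP : IsProbabilityMeasure (digitSeqLaw a c t) := by unfold digitSeqLaw; infer_instance
  set m : ℕ → ℝ :=
    fun i => zeroMass a c t (i + 1) * f i 0 + (1 - zeroMass a c t (i + 1)) * f i 1 with hm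
  have hint : ∀ i, ∫ d, f i (d i) ∂(digitSeqLaw a c t) = m i := by
    intro i
    have h1 : ∫ d, f i (d i) ∂(digitSeqLaw a c t) = ∫ e, f i e ∂(digitLaw a c t (i + 1)) := by
      rw [← Measure.infinitePi_map_eval (fun i : ℕ => digitLaw a c t (i + 1)) i,
        integral_map (measurable_pi_apply i).aemeasurable
          (measurable_of_countable (f i)).aestronglyMeasurable]
      rfl
    have hz := zeroMass_mem ha hc t (i + 1)
    have hI : ∀ (e : Fin 2) (y : ℝ), Integrable (f i) (ENNReal.ofReal y • Measure.dirac e) :=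
      fun e y => Integrable.smul_measure Integrable.of_finite ENNReal.ofReal_ne_top
    rw [h1, digitLaw, integral_add_measure (hI 0 _) (hI 1 _), integral_smul_measure, integral_smul_measure,
      integral_dirac, integral_dirac]
    simp only [digitMass, hm, if_true, one_ne_zero, if_false, smul_eq_mul]
    rw [ENNReal.toReal_ofReal hz.1.le, ENNReal.toReal_ofReal (by linarith [hz.2])]
  have hind : ProbabilityTheory.iIndepFun (fun i (d : ℕ → Fin 2) => f i (d i) - m i)
      (digitSeqLaw a c t) :=
    ProbabilityTheory.iIndepFun_infinitePi (X := fun i e => f i e - m i)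
      (fun i => measurable_of_countable _)
  have hsub : ∀ i, ProbabilityTheory.HasSubgaussianMGF
      (fun d : ℕ → Fin 2 => f i (d i) - m i) ((‖C - (-C)‖₊ / 2) ^ 2) (digitSeqLaw a c t) := by
    intro i
    rw [← hint i]
    refine ProbabilityTheory.hasSubgaussianMGF_of_mem_Icc
      (X := fun d : ℕ → Fin 2 => f i (d i)) ?_ ?_
    · exact ((measurable_of_countable (f i)).comp (measurable_pi_apply i)).aemeasurable
    · exact ae_of_all _ fun d => abs_le.1 (hf i (d i))
  exact ae_tendsto_average_zero hind hsub

/-- The finitely many small `m` contribute a constant, absorbed by `η * n`. The uniformity in `m ≤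
n` allows prefixes of two different lengths to be compared with one error term. -/
theorem eventually_forall_le_abs_le {S : ℕ → ℝ}
    (hS : Tendsto (fun n : ℕ => S n / n) atTop (𝓝 0)) {η : ℝ} (hη : 0 < η) :
    ∀ᶠ n : ℕ in atTop, ∀ m ≤ n, |S m| ≤ η * n := by
  obtain ⟨N, hN⟩ := Metric.tendsto_atTop.1 hS η hη
  set B : ℝ := ∑ i ∈ Finset.range (N + 1), |S i| with hB
  filter_upwards [eventually_ge_atTop ⌈B / η⌉₊] with n hn m hm
  rcases le_or_gt m N with h | h
  · have h1 : |S m| ≤ B :=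
      Finset.single_le_sum (f := fun i => |S i|) (fun i _ => abs_nonneg _)
        (Finset.mem_range.2 (by omega))
    have h2 : B / η ≤ n := Nat.ceil_le.1 hn
    rw [div_le_iff₀ hη] at h2
    linarith
  · have h1 := hN m h.le
    have hm0 : (0 : ℝ) < m := by exact_mod_cast (by omega : 0 < m)
    rw [Real.dist_eq, sub_zero, abs_div, Nat.abs_cast, div_lt_iff₀ hm0] at h1
    have : (m : ℝ) ≤ n := by exact_mod_cast hm
    nlinarith

/-- For almost every digit sequence, runs of a fixed digit up to position `n` have length `o(n)`. -/
theorem ae_exists_digit_eq {a c : ℝ} (ha : a ∈ Ioo (0 : ℝ) 1) (hc : c ∈ Ioo (0 : ℝ) 1)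
    (t : ℕ → ℕ) :
    ∀ᵐ d ∂(digitSeqLaw a c t), ∀ e : Fin 2, ∀ δ : ℝ, 0 < δ → ∀ᶠ n : ℕ in atTop,
      ∀ m : ℕ, (m : ℝ) + δ * n ≤ n → ∃ i, m ≤ i ∧ i < n ∧ d i = e := by
  rw [ae_all_iff]
  intro e
  have key := ae_average_digits ha hc t (fun _ e' => if e' = e then 1 else 0) 1
    (by intro i e'; split_ifs <;> simp)
  set κ : ℝ := min (min a c) (min (1 - a) (1 - c)) with hκ
  have hκ0 : 0 < κ := by
    simp only [hκ, lt_min_iff]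
    exact ⟨⟨ha.1, hc.1⟩, by linarith [ha.2], by linarith [hc.2]⟩
  have hz : ∀ j, κ ≤ zeroMass a c t j ∧ κ ≤ 1 - zeroMass a c t j := by
    intro j
    rcases zeroMass_eq_or a c t j with h | h <;> rw [h] <;> constructor <;> simp [hκ]
  filter_upwards [key] with d hd δ hδ
  filter_upwards [eventually_forall_le_abs_le hd (η := κ * δ / 3) (by positivity),
    eventually_gt_atTop 0] with n hn hn0 m hm
  by_contra! hcon
  have hmn : m ≤ n := by
    have : (0 : ℝ) ≤ δ * n := by positivity
    exact_mod_cast (by linarith : (m : ℝ) ≤ n)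
  have h1 := abs_le.1 (hn n le_rfl)
  have h2 := abs_le.1 (hn m hmn)
  -- If the digit `e` is absent from `[m, n)`, every centred indicator there is at most `-κ`, so the
  -- sum is at most `-κ δ n`; the law of large numbers at `m` and `n` allows only `2 κ δ n / 3` in
  -- absolute value.
  have h3 : ∑ i ∈ Finset.Ico m n, ((if d i = e then (1 : ℝ) else 0) -
      (zeroMass a c t (i + 1) * (if 0 = e then 1 else 0) +
        (1 - zeroMass a c t (i + 1)) * (if 1 = e then 1 else 0))) ≤
      ∑ _i ∈ Finset.Ico m n, (-κ) := by
    refine Finset.sum_le_sum fun i hi => ?_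
    rw [Finset.mem_Ico] at hi
    have := hcon i hi.1 hi.2
    rw [if_neg this]
    obtain ⟨z1, z2⟩ := hz (i + 1)
    fin_cases e <;> simp <;> linarith
  rw [Finset.sum_Ico_eq_sub _ hmn] at h3
  simp only [Finset.sum_const, Nat.card_Ico, nsmul_eq_mul, Nat.cast_sub hmn] at h3
  have hn1 : (0 : ℝ) < n := by exact_mod_cast hn0
  have h4 : κ * (δ * n) ≤ κ * (n - m) := mul_le_mul_of_nonneg_left (by linarith) hκ0.le
  have h5 : 0 < κ * δ * n := by positivity
  linarith [h1.1, h2.2]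

/-! ### Dyadic intervals and balls at typical points -/

theorem ofDigits_pos_le {d : ℕ → Fin 2} {k : ℕ} (h : ∃ i < k, d i = 1) :
    ((2 : ℝ) ^ k)⁻¹ ≤ Real.ofDigits d := by
  obtain ⟨i, hi, hd⟩ := h
  have h1 : Real.ofDigitsTerm d i ≤ Real.ofDigits d :=
    Real.summable_ofDigitsTerm.le_tsum i fun _ _ => Real.ofDigitsTerm_nonneg
  refine le_trans ?_ h1
  simp only [Real.ofDigitsTerm, hd]
  norm_num
  exact inv_anti₀ (by positivity) (pow_le_pow_right₀ (by norm_num) (by omega))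

theorem ofDigits_le_sub {k : ℕ} : ∀ {d : ℕ → Fin 2}, (∃ i < k, d i = 0) →
    Real.ofDigits d ≤ 1 - ((2 : ℝ) ^ k)⁻¹ := by
  induction k with
  | zero => rintro d ⟨i, hi, -⟩; omega
  | succ k ih =>
    rintro d ⟨i, hi, hd⟩
    rw [ofDigits_shift]
    have hle := Real.ofDigits_le_one (fun i => d (i + 1))
    have hpow : ((2 : ℝ) ^ (k + 1))⁻¹ = ((2 : ℝ) ^ k)⁻¹ / 2 := by rw [pow_succ, mul_inv]; ring
    have hpow1 : ((2 : ℝ) ^ k)⁻¹ ≤ 1 := inv_le_one_of_one_le₀ (one_le_pow₀ (by norm_num))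
    have h2 : ((d 0 : ℕ) : ℝ) ≤ 1 := by exact_mod_cast Nat.lt_succ_iff.mp (d 0).isLt
    rcases Nat.eq_zero_or_pos i with rfl | hi0
    · rw [hd, hpow]
      simp
      linarith
    · have := ih (d := fun i => d (i + 1)) ⟨i - 1, by omega, by
        rw [Nat.sub_add_cancel hi0]; exact hd⟩
      rw [hpow]
      linarith

/-- A digit `1` and a digit `0` among the positions from `m` to `M` keep the point at distance at
least `2 ^ (-M)` from the left and from the right endpoint of its interval of generation `m`. -/
theorem ball_subset_dyadicInterval {d : ℕ → Fin 2} {m M : ℕ}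
    (h0 : ∃ i, m ≤ i ∧ i < M ∧ d i = 0) (h1 : ∃ i, m ≤ i ∧ i < M ∧ d i = 1) :
    ball (Real.ofDigits d) ((2 : ℝ) ^ M)⁻¹ ⊆ dyadicInterval (fun i : Fin m => d i) := by
  obtain ⟨i, hi1, hi2, hi⟩ := h0
  obtain ⟨j, hj1, hj2, hj⟩ := h1
  have e0 := ofDigits_le_sub (d := fun k => d (k + m)) (k := M - m)
    ⟨i - m, by omega, by simpa [Nat.sub_add_cancel hi1] using hi⟩
  have e1 := ofDigits_pos_le (d := fun k => d (k + m)) (k := M - m)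
    ⟨j - m, by omega, by simpa [Nat.sub_add_cancel hj1] using hj⟩
  have hx := Real.ofDigits_eq_sum_add_ofDigits d m
  have hsum : ∑ i ∈ Finset.range m, Real.ofDigitsTerm d i =
      ∑ i : Fin m, ((d i : ℕ) : ℝ) * ((2 : ℝ) ^ ((i : ℕ) + 1))⁻¹ := by
    rw [Finset.sum_range]
    simp [Real.ofDigitsTerm]
  have hpow : ((2 : ℝ) ^ M)⁻¹ = ((2 : ℝ) ^ m)⁻¹ * ((2 : ℝ) ^ (M - m))⁻¹ := by
    rw [← mul_inv, ← pow_add]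
    congr 2
    omega
  rw [hsum] at hx
  push_cast at hx
  have hm0 : (0 : ℝ) < ((2 : ℝ) ^ m)⁻¹ := by positivity
  have f0 := mul_le_mul_of_nonneg_left e0 hm0.le
  have f1 := mul_le_mul_of_nonneg_left e1 hm0.le
  rw [mul_sub, mul_one] at f0
  intro y hy
  rw [mem_ball, Real.dist_eq, abs_lt, hpow] at hy
  refine ⟨?_, ?_⟩
  · linarith [hy.1]
  · linarith [hy.2]

theorem dyadicInterval_subset_ball {n : ℕ} {e : Fin n → Fin 2} {x r : ℝ}
    (hx : x ∈ dyadicInterval e) (hr : ((2 : ℝ) ^ n)⁻¹ ≤ r) : dyadicInterval e ⊆ ball x r := by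
  intro y hy
  rw [mem_ball, Real.dist_eq, abs_lt]
  constructor <;> linarith [hx.1, hx.2, hy.1, hy.2]

theorem digitMass_mem_Ioo {a c : ℝ} (ha : a ∈ Ioo (0 : ℝ) 1) (hc : c ∈ Ioo (0 : ℝ) 1)
    (t : ℕ → ℕ) (j : ℕ) (e : Fin 2) : digitMass a c t j e ∈ Ioo (0 : ℝ) 1 := by
  have h := zeroMass_mem ha hc t j
  unfold digitMass
  split_ifs
  · exact h
  · exact ⟨by linarith [h.2], by linarith [h.1]⟩

/-- The mass of dyadic intervals, for arbitrary digit weights. -/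
theorem blockMeasure_dyadicInterval_of_mem {a c : ℝ} (ha : a ∈ Ioo (0 : ℝ) 1)
    (hc : c ∈ Ioo (0 : ℝ) 1) (t : ℕ → ℕ) {n : ℕ} (e : Fin n → Fin 2) :
    blockMeasure a c t (dyadicInterval e) =
      ENNReal.ofReal (∏ i : Fin n, digitMass a c t ((i : ℕ) + 1) (e i)) := by
  have hprob : ∀ j, IsProbabilityMeasure (digitLaw a c t j) :=
    fun j => isProbabilityMeasure_digitLaw_of_mem ha hc t j
  have hmeas : Measurable (Real.ofDigits : (ℕ → Fin 2) → ℝ) := Real.continuous_ofDigits.measurable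
  rw [blockMeasure_eq_map, Measure.map_apply hmeas (by exact measurableSet_Ico)]
  let e' : ℕ → Fin 2 := fun i => if h : i < n then e ⟨i, h⟩ else 0
  have hcongr : digitSeqLaw a c t (Real.ofDigits ⁻¹' dyadicInterval e) =
      digitSeqLaw a c t (Set.pi (Finset.range n : Finset ℕ) (fun i => {e' i})) := by
    refine measure_congr ?_
    filter_upwards [ae_exists_digit_eq ha hc t] with d hd
    -- Short runs force infinitely many zeros, which excludes the ambiguous binary expansions: with
    -- `δ = 1 / 2` there is a zero in `[m, N)` once `N ≥ 2 m`.
    have hd' : ∀ m, ∃ i, m ≤ i ∧ d i = 0 := by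
      intro m
      obtain ⟨N, hN1, hN2⟩ := ((hd 0 (1 / 2) (by norm_num)).and
        (eventually_ge_atTop (2 * m))).exists
      obtain ⟨i, h1, -, h2⟩ := hN1 m (by
        have : ((2 * m : ℕ) : ℝ) ≤ N := by exact_mod_cast hN2
        push_cast at this
        linarith)
      exact ⟨i, h1, h2⟩
    refine propext ?_
    change Real.ofDigits d ∈ dyadicInterval e ↔ d ∈ Set.pi _ _
    rw [ofDigits_mem_dyadicInterval e d hd']
    constructor
    · intro h i hi
      have hi' : i < n := by simpa using hi
      simpa [e', hi'] using h ⟨i, hi'⟩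
    · intro h i
      have := h i (by simp)
      simpa [e'] using this
  rw [hcongr, digitSeqLaw, Measure.infinitePi_pi _ (fun _ _ => MeasurableSet.singleton _),
    ENNReal.ofReal_prod_of_nonneg, Finset.prod_range]
  · refine Finset.prod_congr rfl fun i _ => ?_
    rw [digitLaw_singleton]
    simp [e']
  · intro i _
    exact (digitMass_mem_Ioo ha hc t _ _).1.le

theorem isProbabilityMeasure_blockMeasure_of_mem {a c : ℝ} (ha : a ∈ Ioo (0 : ℝ) 1)
    (hc : c ∈ Ioo (0 : ℝ) 1) (t : ℕ → ℕ) : IsProbabilityMeasure (blockMeasure a c t) := by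
  have hprob : ∀ j, IsProbabilityMeasure (digitLaw a c t j) :=
    fun j => isProbabilityMeasure_digitLaw_of_mem ha hc t j
  have : IsProbabilityMeasure (digitSeqLaw a c t) := by unfold digitSeqLaw; infer_instance
  rw [blockMeasure_eq_map]
  exact Measure.isProbabilityMeasure_map Real.continuous_ofDigits.measurable.aemeasurable

/-- The sum of the first `n` terms of the sequence equal to `u` on the odd blocks and to `v` on
the even blocks. -/
def blockSum (u v : ℝ) (t : ℕ → ℕ) (n : ℕ) : ℝ := ∑ i ∈ Finset.range n, zeroMass u v t (i + 1)

/-- The expectation of `log₂` of the mass given by the law `(p, 1 - p)` to a digit of law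
`(a, 1 - a)`. -/
def crossLog (a p : ℝ) : ℝ := a * Real.logb 2 p + (1 - a) * Real.logb 2 (1 - p)

/-- `zeroMass` only selects between its two values according to the block, so it commutes with every
operation on them. -/
theorem zeroMass_map₂ (f : ℝ → ℝ → ℝ) (a c p ph : ℝ) (t : ℕ → ℕ) (j : ℕ) :
    zeroMass (f a p) (f c ph) t j = f (zeroMass a c t j) (zeroMass p ph t j) := by
  unfold zeroMass
  split_ifs <;> rfl

theorem blockMeasure_dyadicInterval_eq_rpow {a c : ℝ} (ha : a ∈ Ioo (0 : ℝ) 1)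
    (hc : c ∈ Ioo (0 : ℝ) 1) (t : ℕ → ℕ) (d : ℕ → Fin 2) (n : ℕ) :
    blockMeasure a c t (dyadicInterval (fun i : Fin n => d i)) =
      2 ^ (∑ i ∈ Finset.range n, Real.logb 2 (digitMass a c t (i + 1) (d i))) := by
  have h0 : ∀ i, 0 < digitMass a c t (i + 1) (d i) := fun i => (digitMass_mem_Ioo ha hc t _ _).1
  rw [blockMeasure_dyadicInterval_of_mem ha hc,
    ← Finset.prod_range (fun i => digitMass a c t (i + 1) (d i)),
    ← Real.logb_prod _ _ (fun i _ => (h0 i).ne')]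
  have hp : 0 < ∏ i ∈ Finset.range n, digitMass a c t (i + 1) (d i) :=
    Finset.prod_pos fun i _ => h0 i
  have h2 : (2 : ℝ≥0∞) = ENNReal.ofReal 2 := by simp
  rw [h2, ENNReal.ofReal_rpow_of_pos (by norm_num), Real.rpow_logb (by norm_num) (by norm_num) hp]

/-- The mass of the balls centred at `x` of radius about `2⁻ⁿ` is `2 ^ (A n + o(n))`. -/
def BallEstimate (ν : Measure ℝ) (A : ℕ → ℝ) (x : ℝ) : Prop :=
  ∀ ε : ℝ, 0 < ε → ∀ᶠ n : ℕ in atTop, ∀ r : ℝ,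
    ((2 : ℝ) ^ (n + 1))⁻¹ ≤ r → r ≤ 2 * ((2 : ℝ) ^ n)⁻¹ →
    (2 : ℝ≥0∞) ^ (A n - ε * n) ≤ ν (ball x r) ∧ ν (ball x r) ≤ 2 ^ (A n + ε * n)

/-- Only the inequality valid for arbitrary sets under a pushforward is used, so sets of typical
points need not be shown measurable. -/
theorem one_le_blockMeasure_of_ae {a c : ℝ} (ha : a ∈ Ioo (0 : ℝ) 1)
    (hc : c ∈ Ioo (0 : ℝ) 1) (t : ℕ → ℕ) {s : Set ℝ}
    (h : ∀ᵐ d ∂(digitSeqLaw a c t), Real.ofDigits d ∈ s) : 1 ≤ blockMeasure a c t s := by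
  have hprob : ∀ j, IsProbabilityMeasure (digitLaw a c t j) :=
    fun j => isProbabilityMeasure_digitLaw_of_mem ha hc t j
  have : IsProbabilityMeasure (digitSeqLaw a c t) := by unfold digitSeqLaw; infer_instance
  rw [blockMeasure_eq_map]
  refine le_trans (le_of_eq ?_)
    (Measure.le_map_apply Real.continuous_ofDigits.measurable.aemeasurable s)
  rw [← measure_univ (μ := digitSeqLaw a c t)]
  exact (measure_congr (eventuallyEq_univ.2 h)).symm

/-- The mass of small balls around typical points of a block measure. -/
theorem ae_ball_estimate {a c p ph : ℝ} (ha : a ∈ Ioo (0 : ℝ) 1) (hc : c ∈ Ioo (0 : ℝ) 1)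
    (hp : p ∈ Ioo (0 : ℝ) 1) (hph : ph ∈ Ioo (0 : ℝ) 1) (t : ℕ → ℕ) :
    ∀ᵐ d ∂(digitSeqLaw a c t),
      BallEstimate (blockMeasure p ph t) (blockSum (crossLog a p) (crossLog c ph) t)
        (Real.ofDigits d) := by
  set C : ℝ := |Real.logb 2 p| + |Real.logb 2 (1 - p)| + |Real.logb 2 ph| + |Real.logb 2 (1 - ph)|
    with hC
  have hC0 : 0 ≤ C := by positivity
  have hlog : ∀ (j : ℕ) (e : Fin 2), |Real.logb 2 (digitMass p ph t j e)| ≤ C := by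
    intro j e
    have := abs_nonneg (Real.logb 2 p)
    have := abs_nonneg (Real.logb 2 (1 - p))
    have := abs_nonneg (Real.logb 2 ph)
    have := abs_nonneg (Real.logb 2 (1 - ph))
    unfold digitMass
    rcases zeroMass_eq_or p ph t j with h | h <;> rw [h] <;> split_ifs <;> rw [hC] <;> linarith
  set A : ℕ → ℝ := blockSum (crossLog a p) (crossLog c ph) t with hA
  have hcross : ∀ j, zeroMass (crossLog a p) (crossLog c ph) t j =
      zeroMass a c t j * Real.logb 2 (digitMass p ph t j 0) +
        (1 - zeroMass a c t j) * Real.logb 2 (digitMass p ph t j 1) := by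
    intro j
    rw [zeroMass_map₂ crossLog]
    simp [crossLog, digitMass]
  have hcrossC : ∀ j, |zeroMass (crossLog a p) (crossLog c ph) t j| ≤ C := by
    intro j
    rw [hcross]
    have hz := zeroMass_mem ha hc t j
    obtain ⟨u1, u2⟩ := abs_le.1 (hlog j 0)
    obtain ⟨v1, v2⟩ := abs_le.1 (hlog j 1)
    have hz1 : 0 ≤ 1 - zeroMass a c t j := by linarith [hz.2]
    rw [abs_le]
    constructor
    · have := mul_le_mul_of_nonneg_left u1 hz.1.le
      have := mul_le_mul_of_nonneg_left v1 hz1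
      linarith
    · have := mul_le_mul_of_nonneg_left u2 hz.1.le
      have := mul_le_mul_of_nonneg_left v2 hz1
      linarith
  have hAdiff : ∀ m n : ℕ, m ≤ n → |A n - A m| ≤ C * (n - m) := by
    intro m n hmn
    have : A n - A m = ∑ i ∈ Finset.Ico m n, zeroMass (crossLog a p) (crossLog c ph) t (i + 1) := by
      rw [Finset.sum_Ico_eq_sub _ hmn]; rfl
    rw [this]
    refine (Finset.abs_sum_le_sum_abs _ _).trans ((Finset.sum_le_sum fun i _ =>
      hcrossC (i + 1)).trans (le_of_eq ?_))
    simp [Nat.cast_sub hmn]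
    ring
  filter_upwards [ae_exists_digit_eq ha hc t, ae_average_digits ha hc t
    (fun i e => Real.logb 2 (digitMass p ph t (i + 1) e)) C (fun i e => hlog _ _)] with d hrun havg
  intro ε hε
  set S : ℕ → ℝ := fun n => ∑ i ∈ Finset.range n, Real.logb 2 (digitMass p ph t (i + 1) (d i))
    with hS
  have hSA : Tendsto (fun n : ℕ => (S n - A n) / n) atTop (𝓝 0) := by
    refine havg.congr fun n => ?_
    congr 1
    rw [Finset.sum_sub_distrib]
    congr 1
    exact Finset.sum_congr rfl fun i _ => (hcross (i + 1)).symm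
  -- Runs have length at most `δ n`, and dropping that many digits changes the exponent by at most
  -- `C δ n ≤ ε n / 8`.
  set δ : ℝ := min (1 / 2) (ε / (8 * (C + 1))) with hδ
  have hδ0 : 0 < δ := by simp only [hδ, lt_min_iff]; constructor <;> positivity
  have hδ1 : δ ≤ 1 / 2 := min_le_left _ _
  have hδC : C * δ ≤ ε / 8 := by
    have : δ ≤ ε / (8 * (C + 1)) := min_le_right _ _
    calc C * δ ≤ (C + 1) * (ε / (8 * (C + 1))) := by gcongr; linarith
      _ = ε / 8 := by field_simp
  have hev := eventually_forall_le_abs_le hSA (η := ε / 4) (by positivity)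
  have hev1 := (tendsto_add_atTop_nat 1).eventually hev
  have hr0 := (tendsto_sub_atTop_nat 1).eventually (hrun 0 δ hδ0)
  have hr1 := (tendsto_sub_atTop_nat 1).eventually (hrun 1 δ hδ0)
  filter_upwards [hev1, hr0, hr1, eventually_ge_atTop 3,
    eventually_ge_atTop ⌈(8 * C + 1) * 2 / ε⌉₊] with n e1 f0 f1 hn3 hnC r hrl hru
  have hn8 : (8 * C + 1) * 2 ≤ ε * n := by
    have := Nat.ceil_le.1 hnC
    rw [div_le_iff₀ hε] at this
    linarith
  have hn1 : (3 : ℝ) ≤ n := by exact_mod_cast hn3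
  constructor
  · have hzero : ∀ m, ∃ i, m ≤ i ∧ d i = 0 := by
      intro m
      obtain ⟨N, hN1, hN2⟩ := ((hrun 0 (1 / 2) (by norm_num)).and
        (eventually_ge_atTop (2 * m))).exists
      obtain ⟨i, h1, -, h2⟩ := hN1 m (by
        have : ((2 * m : ℕ) : ℝ) ≤ N := by exact_mod_cast hN2
        push_cast at this
        linarith)
      exact ⟨i, h1, h2⟩
    -- Lower bound: the ball contains the interval of generation `n + 1` around its centre.
    have hsub := dyadicInterval_subset_ball
      ((ofDigits_mem_dyadicInterval (fun i : Fin (n + 1) => d i) d hzero).2 fun _ => rfl) hrl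
    refine le_trans ?_ (measure_mono hsub)
    rw [blockMeasure_dyadicInterval_eq_rpow hp hph]
    refine ENNReal.rpow_le_rpow_of_exponent_le (by norm_num) ?_
    have g1 := abs_le.1 (e1 (n + 1) le_rfl)
    have g2 := abs_le.1 (hAdiff n (n + 1) (by omega))
    push_cast at g1 g2
    have : S (n + 1) = ∑ i ∈ Finset.range (n + 1),
      Real.logb 2 (digitMass p ph t (i + 1) (d i)) := rfl
    rw [← this]
    nlinarith [g1.1, g2.1]
  -- Upper bound: with `n = M + 1` the radius is at most `2 ^ (-M)`, and both digits occur among the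
  -- last `⌈δ M⌉` positions before `M`, so the ball lies in the interval of generation `m = M - ⌈δ
  -- M⌉`.
  · obtain ⟨M, rfl⟩ : ∃ M, n = M + 1 := ⟨n - 1, by omega⟩
    rw [Nat.add_sub_cancel] at f0 f1
    push_cast at hn1 hn8
    have hk : (⌈δ * M⌉₊ : ℝ) < δ * M + 1 := Nat.ceil_lt_add_one (by positivity)
    have hk' : δ * M ≤ ⌈δ * M⌉₊ := Nat.le_ceil _
    have hkM : ⌈δ * M⌉₊ ≤ M := by
      refine Nat.ceil_le.2 ?_
      have : (0 : ℝ) ≤ M := Nat.cast_nonneg _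
      nlinarith
    set m := M - ⌈δ * M⌉₊ with hm
    have hmc : (m : ℝ) = M - ⌈δ * M⌉₊ := by rw [hm, Nat.cast_sub hkM]
    have hball : ball (Real.ofDigits d) r ⊆ dyadicInterval (fun i : Fin m => d i) := by
      refine Subset.trans (ball_subset_ball ?_) (ball_subset_dyadicInterval
        (f0 m (by linarith)) (f1 m (by linarith)))
      rw [pow_succ, mul_inv] at hru
      linarith
    refine (measure_mono hball).trans ?_
    rw [blockMeasure_dyadicInterval_eq_rpow hp hph]
    refine ENNReal.rpow_le_rpow_of_exponent_le (by norm_num) ?_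
    have g1 := abs_le.1 (e1 m (by omega))
    have g2 := abs_le.1 (hAdiff m (M + 1) (by omega))
    push_cast at g1 g2 ⊢
    have : S m = ∑ i ∈ Finset.range m, Real.logb 2 (digitMass p ph t (i + 1) (d i)) := rfl
    rw [← this]
    have h6 : C * ((M : ℝ) + 1 - m) ≤ C * (δ * M + 2) :=
      mul_le_mul_of_nonneg_left (by linarith) hC0
    have h7 : C * δ * M ≤ ε / 8 * M := mul_le_mul_of_nonneg_right hδC (Nat.cast_nonneg _)
    linarith [g1.2, g2.1]

/-! ### The partition function and moments of balls -/

theorem sum_dyadic_left_endpoints (n : ℕ) (g : ℝ → ℝ≥0∞) :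
    ∑ e : Fin n → Fin 2, g (∑ i : Fin n, ((e i : ℕ) : ℝ) * ((2 : ℝ) ^ ((i : ℕ) + 1))⁻¹) =
      ∑ k ∈ Finset.range (2 ^ n), g (k * ((2 : ℝ) ^ n)⁻¹) := by
  induction n generalizing g with
  | zero => simp
  | succ n ih =>
    have key : ∀ (x : Fin 2) (e : Fin n → Fin 2),
        ∑ i : Fin (n + 1), (((Fin.cons x e : Fin (n + 1) → Fin 2) i : ℕ) : ℝ) *
          ((2 : ℝ) ^ ((i : ℕ) + 1))⁻¹ =
        ((x : ℕ) : ℝ) / 2 + (∑ i : Fin n, ((e i : ℕ) : ℝ) * ((2 : ℝ) ^ ((i : ℕ) + 1))⁻¹) / 2 := by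
      intro x e
      rw [Fin.sum_univ_succ, Finset.sum_div]
      congr 1
      · simp [div_eq_mul_inv]
      · refine Finset.sum_congr rfl fun i _ => ?_
        rw [Fin.val_succ, pow_succ _ ((i : ℕ) + 1), mul_inv, Fin.cons_succ]
        ring
    rw [← (Fin.consEquiv (fun _ : Fin (n + 1) => Fin 2)).sum_comp, Fintype.sum_prod_type,
      Fin.sum_univ_two]
    simp only [Fin.consEquiv_apply]
    simp_rw [key]
    rw [ih (fun y => g (((0 : Fin 2) : ℕ) / 2 + y / 2)),
      ih (fun y => g (((1 : Fin 2) : ℕ) / 2 + y / 2)), pow_succ, mul_two, Finset.sum_range_add]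
    congr 1 <;> refine Finset.sum_congr rfl fun k _ => ?_
    · congr 1
      simp only [Fin.val_zero, Nat.cast_zero, pow_succ, mul_inv]
      ring
    · congr 1
      have : (2 : ℝ) ^ n ≠ 0 := by positivity
      push_cast
      rw [pow_succ]
      field_simp
      simp

theorem zeroMass_comp (f : ℝ → ℝ) (p ph : ℝ) (t : ℕ → ℕ) (j : ℕ) :
    zeroMass (f p) (f ph) t j = f (zeroMass p ph t j) :=
  zeroMass_map₂ (fun x _ => f x) p ph p ph t j

theorem two_rpow_sum {ι : Type*} (s : Finset ι) (f : ι → ℝ) :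
    (2 : ℝ≥0∞) ^ (∑ i ∈ s, f i) = ∏ i ∈ s, (2 : ℝ≥0∞) ^ f i := by
  classical
  induction s using Finset.induction_on with
  | empty => simp
  | insert i s hi ih =>
    rw [Finset.sum_insert hi, Finset.prod_insert hi,
      ENNReal.rpow_add _ _ (by norm_num) (by norm_num), ih]

theorem two_rpow_tau {p : ℝ} (hp : p ∈ Ioo (0 : ℝ) 1) (q : ℝ) :
    (2 : ℝ≥0∞) ^ tau p q = ENNReal.ofReal p ^ q + ENNReal.ofReal (1 - p) ^ q := by
  have h1 : 0 < 1 - p := by linarith [hp.2]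
  have h2 : (2 : ℝ≥0∞) = ENNReal.ofReal 2 := by simp
  have h3 : 0 < p ^ q := Real.rpow_pos_of_pos hp.1 q
  have h4 : 0 < (1 - p) ^ q := Real.rpow_pos_of_pos h1 q
  rw [h2, ENNReal.ofReal_rpow_of_pos (by norm_num), tau,
    Real.rpow_logb (by norm_num) (by norm_num) (by positivity), ENNReal.ofReal_rpow_of_pos hp.1,
    ENNReal.ofReal_rpow_of_pos h1, ENNReal.ofReal_add h3.le h4.le]

/-- The dyadic interval of generation `n` with left endpoint `k / 2ⁿ`. -/
def dyadicCell (n : ℕ) (k : ℤ) : Set ℝ := Ico (k * ((2 : ℝ) ^ n)⁻¹) ((k + 1) * ((2 : ℝ) ^ n)⁻¹)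

theorem mem_dyadicCell_iff {n : ℕ} {k : ℤ} {x : ℝ} : x ∈ dyadicCell n k ↔ ⌊2 ^ n * x⌋ = k := by
  have h : (0 : ℝ) < 2 ^ n := by positivity
  rw [Int.floor_eq_iff, dyadicCell, mem_Ico, ← div_eq_mul_inv, ← div_eq_mul_inv, div_le_iff₀ h,
    lt_div_iff₀ h, mul_comm x]

/-- The partition function of a block measure. -/
theorem sum_dyadicCell_rpow {p ph : ℝ} (hp : p ∈ Ioo (0 : ℝ) 1) (hph : ph ∈ Ioo (0 : ℝ) 1)
    (t : ℕ → ℕ) (q : ℝ) (n : ℕ) :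
    ∑ k ∈ Finset.range (2 ^ n), blockMeasure p ph t (dyadicCell n k) ^ q =
      2 ^ blockSum (tau p q) (tau ph q) t n := by
  have h1 := sum_dyadic_left_endpoints n
    (fun y => blockMeasure p ph t (Ico y (y + ((2 : ℝ) ^ n)⁻¹)) ^ q)
  have h2 : ∀ k : ℕ, Ico ((k : ℝ) * ((2 : ℝ) ^ n)⁻¹) (k * ((2 : ℝ) ^ n)⁻¹ + ((2 : ℝ) ^ n)⁻¹) =
      dyadicCell n k := by
    intro k
    simp [dyadicCell, add_mul]
  simp only [h2] at h1
  rw [← h1]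
  have h3 : ∀ e : Fin n → Fin 2, blockMeasure p ph t
      (Ico (∑ i : Fin n, ((e i : ℕ) : ℝ) * ((2 : ℝ) ^ ((i : ℕ) + 1))⁻¹)
        (∑ i : Fin n, ((e i : ℕ) : ℝ) * ((2 : ℝ) ^ ((i : ℕ) + 1))⁻¹ + ((2 : ℝ) ^ n)⁻¹)) ^ q =
      ∏ i : Fin n, ENNReal.ofReal (digitMass p ph t ((i : ℕ) + 1) (e i)) ^ q := by
    intro e
    have := blockMeasure_dyadicInterval_of_mem hp hph t e
    rw [dyadicInterval] at this
    rw [this, ENNReal.ofReal_prod_of_nonneg fun i _ => (digitMass_mem_Ioo hp hph t _ _).1.le,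
      ENNReal.prod_rpow_of_ne_top fun i _ => ENNReal.ofReal_ne_top]
  rw [Finset.sum_congr rfl fun e _ => h3 e, blockSum, two_rpow_sum, Finset.prod_range]
  -- Expanding the product of the two-term sums runs over all digit strings; this is where
  -- independence turns the moment into a product.
  have h4 := Finset.prod_univ_sum (fun _ : Fin n => (Finset.univ : Finset (Fin 2)))
    (fun i e => ENNReal.ofReal (digitMass p ph t ((i : ℕ) + 1) e) ^ q)
  rw [Fintype.piFinset_univ] at h4
  rw [← h4]
  refine Finset.prod_congr rfl fun i _ => ?_
  rw [zeroMass_comp (fun x => tau x q), two_rpow_tau (zeroMass_mem hp hph t _), Fin.sum_univ_two]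
  simp [digitMass]

theorem blockMeasure_dyadicCell_eq_zero {p ph : ℝ} (hp : p ∈ Ioo (0 : ℝ) 1)
    (hph : ph ∈ Ioo (0 : ℝ) 1) (t : ℕ → ℕ) {n : ℕ} {k : ℤ} (hk : ¬ (0 ≤ k ∧ k < 2 ^ n)) :
    blockMeasure p ph t (dyadicCell n k) = 0 := by
  have hprob := isProbabilityMeasure_blockMeasure_of_mem hp hph t
  have h1 : blockMeasure p ph t (Ico 0 1) = 1 := by
    have := blockMeasure_dyadicInterval_of_mem hp hph t (n := 0) (fun _ => 0)
    simpa [dyadicInterval] using this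
  have h2 : blockMeasure p ph t (Ico 0 1)ᶜ = 0 := by
    rw [prob_compl_eq_zero_iff measurableSet_Ico, h1]
  refine measure_mono_null (t := (Ico 0 1)ᶜ) (fun x hx hx' => hk ?_) h2
  rw [mem_dyadicCell_iff] at hx
  have hn : (0 : ℝ) < 2 ^ n := by positivity
  rw [← hx]
  constructor
  · exact Int.floor_nonneg.2 (mul_nonneg hn.le hx'.1)
  · rw [Int.floor_lt]
    push_cast
    nlinarith [hx'.2]

/-- The weighted masses of the cells, extended by zero outside the unit interval. -/
def cellWeight (μ : Measure ℝ) (q : ℝ) (n : ℕ) (k : ℤ) : ℝ≥0∞ :=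
  if 0 ≤ k ∧ k < 2 ^ n then μ (dyadicCell n k) ^ q else 0

/-- Cells outside the unit interval have mass zero, whose power is `1` for `q = 0` and `∞` for `q <
0`; setting their weight to zero keeps the sum over all integers equal to the partition function. -/
theorem tsum_cellWeight {p ph : ℝ} (hp : p ∈ Ioo (0 : ℝ) 1) (hph : ph ∈ Ioo (0 : ℝ) 1)
    (t : ℕ → ℕ) (q : ℝ) (n : ℕ) :
    ∑' k : ℤ, cellWeight (blockMeasure p ph t) q n k =
      2 ^ blockSum (tau p q) (tau ph q) t n := by
  rw [← sum_dyadicCell_rpow hp hph, tsum_eq_sum (s := (Finset.range (2 ^ n)).map Nat.castEmbedding)]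
  · rw [Finset.sum_map]
    refine Finset.sum_congr rfl fun k hk => ?_
    rw [Finset.mem_range] at hk
    rw [cellWeight, if_pos]
    · simp
    · simp only [Nat.castEmbedding_apply, Nat.cast_nonneg, true_and]
      exact_mod_cast hk
  · intro k hk
    rw [cellWeight, if_neg]
    rintro ⟨h0, h1⟩
    refine hk (Finset.mem_map.2 ⟨k.toNat, ?_, by simp [h0]⟩)
    rw [Finset.mem_range]
    zify
    rwa [Int.toNat_of_nonneg h0]

theorem rpow_le_rpow_of_nonpos_exponent {x y : ℝ≥0∞} {q : ℝ} (hq : q ≤ 0) (h : x ≤ y) :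
    y ^ q ≤ x ^ q := by
  have : q = -(-q) := by ring
  rw [this, ENNReal.rpow_neg y (-q), ENNReal.rpow_neg x (-q), ENNReal.inv_le_inv]
  exact ENNReal.rpow_le_rpow h (by linarith)

/-- For `q ≤ 0` the ball contains a whole cell of the unit interval and the power reverses
inclusion; for `q > 0` the ball is covered by the five cells nearest to its centre. -/
theorem measure_ball_rpow_le {p ph : ℝ} (hp : p ∈ Ioo (0 : ℝ) 1) (hph : ph ∈ Ioo (0 : ℝ) 1)
    (t : ℕ → ℕ) (q : ℝ) {n : ℕ} {x r : ℝ} (hx : x ∈ Icc (0 : ℝ) 1) (hr : ((2 : ℝ) ^ n)⁻¹ < r)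
    (hr' : r ≤ 2 * ((2 : ℝ) ^ n)⁻¹) :
    blockMeasure p ph t (ball x r) ^ q ≤ 5 ^ |q| *
      ∑ i ∈ Finset.Icc (-2 : ℤ) 2, cellWeight (blockMeasure p ph t) q n (⌊2 ^ n * x⌋ + i) := by
  set μ := blockMeasure p ph t with hμ
  have hn : (0 : ℝ) < 2 ^ n := by positivity
  rcases le_or_gt q 0 with hq | hq
  · have h5 : (1 : ℝ≥0∞) ≤ 5 ^ |q| := by
      simpa using ENNReal.rpow_le_rpow_of_exponent_le (x := 5) (by norm_num) (abs_nonneg q)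
    refine le_trans ?_ (le_mul_of_one_le_left (zero_le) h5)
    obtain ⟨i, hi, hk, hsub⟩ : ∃ i ∈ Finset.Icc (-2 : ℤ) 2,
        (0 ≤ ⌊2 ^ n * x⌋ + i ∧ ⌊2 ^ n * x⌋ + i < 2 ^ n) ∧
          dyadicCell n (⌊2 ^ n * x⌋ + i) ⊆ ball x r := by
      rcases hx.2.lt_or_eq with h1 | h1
      · refine ⟨0, by simp, ?_, ?_⟩
        · rw [add_zero]
          refine ⟨Int.floor_nonneg.2 (mul_nonneg hn.le hx.1), ?_⟩
          rw [Int.floor_lt]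
          push_cast
          nlinarith
        · rw [add_zero]
          have hxm : x ∈ dyadicCell n ⌊2 ^ n * x⌋ := mem_dyadicCell_iff.2 rfl
          intro y hy
          rw [mem_ball, Real.dist_eq, abs_lt]
          unfold dyadicCell at hxm hy
          rw [add_mul, one_mul] at hxm hy
          constructor <;> linarith [hxm.1, hxm.2, hy.1, hy.2]
      -- The cell of the point `1` is outside the unit interval, so the last cell `[1 - 2 ^ (-n),
      -- 1)` takes its place.
      · subst h1
        have hf : ⌊(2 : ℝ) ^ n * 1⌋ = 2 ^ n := by
          rw [mul_one]
          exact_mod_cast Int.floor_natCast (R := ℝ) (2 ^ n)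
        refine ⟨-1, by simp, ?_, ?_⟩
        · rw [hf]
          have : (1 : ℤ) ≤ 2 ^ n := one_le_pow₀ (by norm_num)
          omega
        · rw [hf]
          intro y hy
          unfold dyadicCell at hy
          push_cast at hy
          rw [neg_add_cancel_right, mul_inv_cancel₀ hn.ne', add_mul, mul_inv_cancel₀ hn.ne'] at hy
          rw [mem_ball, Real.dist_eq, abs_lt]
          constructor <;> linarith [hy.1, hy.2]
    refine le_trans ?_ (Finset.single_le_sum (f := fun i => cellWeight μ q n (⌊2 ^ n * x⌋ + i))
      (fun _ _ => zero_le) hi)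
    simp only [cellWeight]
    rw [if_pos hk]
    exact rpow_le_rpow_of_nonpos_exponent hq (measure_mono hsub)
  · have hsub : ball x r ⊆ ⋃ i ∈ Finset.Icc (-2 : ℤ) 2, dyadicCell n (⌊2 ^ n * x⌋ + i) := by
      intro y hy
      rw [mem_ball, Real.dist_eq, abs_lt] at hy
      have hmul : 2 ^ n * (2 * ((2 : ℝ) ^ n)⁻¹) = 2 := by field_simp
      have h1 : 2 ^ n * (y - x) < 2 := by
        exact (mul_lt_mul_of_pos_left (hy.2.trans_le hr') hn).trans_eq hmul
      have h2 : 2 ^ n * (x - y) < 2 := by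
        refine (mul_lt_mul_of_pos_left ?_ hn).trans_eq hmul
        linarith [hy.1]
      rw [mul_sub] at h1 h2
      simp only [mem_iUnion, mem_dyadicCell_iff, exists_prop, Finset.mem_Icc]
      refine ⟨⌊2 ^ n * y⌋ - ⌊2 ^ n * x⌋, ⟨?_, ?_⟩, by ring⟩
      · have : ⌊2 ^ n * x⌋ < ⌊2 ^ n * y⌋ + 3 := by
          rw [Int.floor_lt]
          push_cast
          linarith [Int.lt_floor_add_one (2 ^ n * y)]
        omega
      · have : ⌊2 ^ n * y⌋ < ⌊2 ^ n * x⌋ + 3 := by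
          rw [Int.floor_lt]
          push_cast
          linarith [Int.lt_floor_add_one (2 ^ n * x)]
        omega
    -- Bounding by five times the heaviest cell gives a single power to estimate, whence the factor
    -- `5 ^ |q|`.
    obtain ⟨j, hj, hmax⟩ := Finset.exists_max_image (Finset.Icc (-2 : ℤ) 2)
      (fun i => μ (dyadicCell n (⌊2 ^ n * x⌋ + i))) ⟨0, by simp⟩
    have hle : μ (ball x r) ≤ 5 * μ (dyadicCell n (⌊2 ^ n * x⌋ + j)) := by
      refine (measure_mono hsub).trans ((measure_biUnion_finset_le _ _).trans ?_)
      refine (Finset.sum_le_card_nsmul _ _ _ hmax).trans (le_of_eq ?_)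
      simp
    have hcell : μ (dyadicCell n (⌊2 ^ n * x⌋ + j)) ^ q ≤ cellWeight μ q n (⌊2 ^ n * x⌋ + j) := by
      rw [cellWeight]
      split_ifs with hk
      · exact le_rfl
      · rw [hμ, blockMeasure_dyadicCell_eq_zero hp hph t hk, ENNReal.zero_rpow_of_pos hq]
    rw [abs_of_pos hq]
    calc μ (ball x r) ^ q ≤ (5 * μ (dyadicCell n (⌊2 ^ n * x⌋ + j))) ^ q :=
          ENNReal.rpow_le_rpow hle hq.le
      _ = 5 ^ q * μ (dyadicCell n (⌊2 ^ n * x⌋ + j)) ^ q := ENNReal.mul_rpow_of_nonneg _ _ hq.le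
      _ ≤ _ := by
        gcongr
        exact hcell.trans (Finset.single_le_sum
          (f := fun i => cellWeight μ q n (⌊2 ^ n * x⌋ + i)) (fun _ _ => zero_le) hj)

/-- The `q`-th moment of balls of radius about `2⁻ⁿ` whose centres lie in distinct dyadic cells. -/
theorem tsum_measure_ball_rpow_le {p ph : ℝ} (hp : p ∈ Ioo (0 : ℝ) 1) (hph : ph ∈ Ioo (0 : ℝ) 1)
    (t : ℕ → ℕ) (q : ℝ) {n : ℕ} {ι : Type*} {x r : ι → ℝ} (hx : ∀ i, x i ∈ Icc (0 : ℝ) 1)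
    (hr : ∀ i, ((2 : ℝ) ^ n)⁻¹ < r i) (hr' : ∀ i, r i ≤ 2 * ((2 : ℝ) ^ n)⁻¹)
    (hinj : Function.Injective fun i => ⌊2 ^ n * x i⌋) :
    ∑' i, blockMeasure p ph t (ball (x i) (r i)) ^ q ≤
      5 ^ |q| * 5 * 2 ^ blockSum (tau p q) (tau ph q) t n := by
  calc ∑' i, blockMeasure p ph t (ball (x i) (r i)) ^ q
      ≤ ∑' i, 5 ^ |q| * ∑ j ∈ Finset.Icc (-2 : ℤ) 2,
          cellWeight (blockMeasure p ph t) q n (⌊2 ^ n * x i⌋ + j) :=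
        ENNReal.tsum_le_tsum fun i => measure_ball_rpow_le hp hph t q (hx i) (hr i) (hr' i)
    _ = 5 ^ |q| * ∑ j ∈ Finset.Icc (-2 : ℤ) 2, ∑' i,
          cellWeight (blockMeasure p ph t) q n (⌊2 ^ n * x i⌋ + j) := by
        rw [ENNReal.tsum_mul_left, Summable.tsum_finsetSum fun _ _ => ENNReal.summable]
    _ ≤ 5 ^ |q| * ∑ j ∈ Finset.Icc (-2 : ℤ) 2, 2 ^ blockSum (tau p q) (tau ph q) t n := by
        gcongr with j _
        rw [← tsum_cellWeight hp hph]
        -- For fixed `j` the shifted cells are still distinct, so each of the five sums is at most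
        -- the full partition function.
        exact ENNReal.tsum_comp_le_tsum_of_injective
          (f := fun i => ⌊2 ^ n * x i⌋ + j) (fun a b hab => hinj (add_right_cancel hab)) _
    _ = _ := by
        rw [Finset.sum_const, mul_assoc]
        simp

/-- Separated points lie in distinct dyadic cells. -/
theorem dist_lt_of_floor_eq {n : ℕ} {x y : ℝ} (h : ⌊2 ^ n * x⌋ = ⌊2 ^ n * y⌋) :
    dist x y < ((2 : ℝ) ^ n)⁻¹ := by
  have hx : x ∈ dyadicCell n ⌊2 ^ n * x⌋ := mem_dyadicCell_iff.2 rfl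
  have hy : y ∈ dyadicCell n ⌊2 ^ n * x⌋ := mem_dyadicCell_iff.2 h.symm
  unfold dyadicCell at hx hy
  rw [add_mul, one_mul] at hx hy
  rw [Real.dist_eq, abs_lt]
  constructor <;> linarith [hx.1, hx.2, hy.1, hy.2]

theorem exists_dyadic_scale {r : ℝ} (hr : 0 < r) (hr1 : r ≤ 1) :
    ∃ n : ℕ, ((2 : ℝ) ^ n)⁻¹ < r ∧ r ≤ 2 * ((2 : ℝ) ^ n)⁻¹ := by
  obtain ⟨n, h1, h2⟩ := exists_nat_pow_near_of_lt_one hr hr1 (y := (1 / 2 : ℝ))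
    (by norm_num) (by norm_num)
  refine ⟨n + 1, ?_, ?_⟩
  · rw [← inv_pow]; simpa using h1
  · rw [← inv_pow, pow_succ]
    norm_num at h2 ⊢
    linarith

/-! ### Mass distribution principles and comparison of dimensions -/

section GeneralDimensions

variable {X : Type*}

theorem methodI_mono {ν ν' : Set X → ℝ≥0∞} (h : ∀ A, ν A ≤ ν' A) (E : Set X) :
    methodI ν E ≤ methodI ν' E :=
  iInf₂_mono fun A _ => ENNReal.tsum_le_tsum fun i => h (A i)

theorem methodI_mono_set (ν : Set X → ℝ≥0∞) {E F : Set X} (h : E ⊆ F) :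
    methodI ν E ≤ methodI ν F :=
  le_iInf₂ fun A hA => iInf₂_le A (h.trans hA)

theorem methodI_eq_zero {ν : Set X → ℝ≥0∞} {E : Set X} (A : ℕ → Set X) (hA : E ⊆ ⋃ i, A i)
    (h : ∀ i, ν (A i) = 0) : methodI ν E = 0 := by
  refine le_antisymm ((iInf₂_le A hA).trans ?_) zero_le
  simp [h]

/-- Applied to an arbitrary countable cover `A` and to sets `F m` of uniform validity of an
estimate: some member of the cover carries positive mass on which the estimate is uniform. -/
theorem exists_measure_inter_ne_zero [MeasurableSpace X] {ν : Measure X} {E : Set X}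
    (hE : ν E ≠ 0) {A F : ℕ → Set X} (hA : E ⊆ ⋃ i, A i) (hF : E ⊆ ⋃ m, F m) :
    ∃ i m, ν (A i ∩ F m) ≠ 0 := by
  by_contra! hcon
  refine hE (measure_mono_null (t := ⋃ i, ⋃ m, A i ∩ F m) (fun x hx => ?_)
    (measure_iUnion_null fun i => measure_iUnion_null fun m => hcon i m))
  obtain ⟨i, hi⟩ := mem_iUnion.1 (hA hx)
  obtain ⟨m, hm⟩ := mem_iUnion.1 (hF hx)
  exact mem_iUnion.2 ⟨i, mem_iUnion.2 ⟨m, hi, hm⟩⟩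

/-- A set of positive measure on which `P x r` holds for all small `r` is covered by countably many
sets on which it holds uniformly. -/
theorem subset_iUnion_uniform {E : Set X} {P : X → ℝ → Prop}
    (h : ∀ x ∈ E, ∀ᶠ r in 𝓝[>] (0 : ℝ), P x r) :
    E ⊆ ⋃ m : ℕ, {x ∈ E | ∀ r, 0 < r → r < 1 / ((m : ℝ) + 1) → P x r} := by
  intro x hx
  obtain ⟨u, hu, hu'⟩ := mem_nhdsGT_iff_exists_Ioo_subset.1 (h x hx)
  obtain ⟨m, hm⟩ := exists_nat_one_div_lt (mem_Ioi.1 hu)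
  exact mem_iUnion.2 ⟨m, hx, fun r h0 h1 => hu' ⟨h0, h1.trans hm⟩⟩

variable [MetricSpace X]

theorem tendsto_ofReal_two_mul : Tendsto (fun r : ℝ => ENNReal.ofReal (2 * r)) (𝓝[>] 0) (𝓝 0) := by
  have : Tendsto (fun r : ℝ => ENNReal.ofReal (2 * r)) (𝓝 0) (𝓝 (ENNReal.ofReal (2 * 0))) :=
    (ENNReal.continuous_ofReal.comp (continuous_const_mul 2)).tendsto 0
  rw [mul_zero, ENNReal.ofReal_zero] at this
  exact this.mono_left nhdsWithin_le_nhds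

theorem tendsto_ofReal_two_mul_rpow_of_neg {s : ℝ} (hs : s < 0) :
    Tendsto (fun r : ℝ => ENNReal.ofReal (2 * r) ^ s) (𝓝[>] 0) (𝓝 ∞) := by
  have := (ENNReal.continuous_rpow_const (y := s)).tendsto 0
  rw [ENNReal.zero_rpow_of_neg hs] at this
  exact this.comp tendsto_ofReal_two_mul

theorem tendsto_two_pow_inv : Tendsto (fun n : ℕ => ((2 : ℝ) ^ n)⁻¹) atTop (𝓝[>] 0) := by
  refine tendsto_nhdsWithin_iff.2 ⟨?_, Eventually.of_forall fun n => ?_⟩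
  · have := tendsto_pow_atTop_nhds_zero_of_lt_one (r := (1 / 2 : ℝ)) (by norm_num) (by norm_num)
    simpa using this
  · exact mem_Ioi.2 (by positivity)

/-- Every set has a centred packing whose balls of twice the radius cover it. -/
theorem exists_isCenteredPacking_cover (F : Set X) {r : ℝ} (hr : 0 < r) :
    ∃ s, IsCenteredPacking F r s ∧ F ⊆ ⋃ x ∈ s, ball x (2 * r) := by
  obtain ⟨s, hs⟩ := zorn_subset {s | IsCenteredPacking F r s} (by
    intro c hc hchain
    refine ⟨⋃₀ c, ⟨sUnion_subset fun s hs => (hc hs).1, ?_⟩, fun s hs => subset_sUnion_of_mem hs⟩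
    exact (pairwise_sUnion hchain.directedOn).2 fun s hs => (hc hs).2)
  refine ⟨s, hs.prop, fun x hx => ?_⟩
  by_contra hcon
  simp only [mem_iUnion, mem_ball, exists_prop, not_exists, not_and, not_lt] at hcon
  have hins : IsCenteredPacking F r (insert x s) := by
    refine ⟨insert_subset hx hs.prop.1, hs.prop.2.insert fun y hy _ => ?_⟩
    exact ball_disjoint_ball (by linarith [hcon y hy])
  have hxs : x ∈ s := hs.le_of_ge hins (subset_insert x s) (mem_insert x s)
  have := hcon x hxs
  rw [dist_self] at this
  linarith

theorem exists_countable_subcover [SecondCountableTopology X] {F s : Set X} {r : ℝ}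
    (hs : F ⊆ ⋃ x ∈ s, ball x r) : ∃ T ⊆ s, T.Countable ∧ F ⊆ ⋃ x ∈ T, ball x r := by
  obtain ⟨T, h1, h2, h3⟩ := TopologicalSpace.isOpen_biUnion_countable s (fun x => ball x r)
    fun _ _ => isOpen_ball
  exact ⟨T, h1, h2, h3 ▸ hs⟩

/-- Mass distribution for the lower measures: a cover of a piece `F` by balls of radius `r` has
weight at least `ν F * (2 r) ^ (-t')`, and multiplication by `(2 r) ^ t` with `t < t'` makes this
tend to infinity. A lower limit requires the estimate at all small radii. -/
theorem lowerMeasure_eq_top [SecondCountableTopology X] [MeasurableSpace X] {ν : Measure X}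
    {w : X → ℝ → ℝ≥0∞} {t t' : ℝ} (htt : t < t') {E : Set X} (hE : ν E ≠ 0)
    (h : ∀ x ∈ E, ∀ᶠ r in 𝓝[>] (0 : ℝ), ν (ball x r) ≤ w x r * ENNReal.ofReal (2 * r) ^ t') :
    lowerMeasure w t E = ∞ := by
  simp only [lowerMeasure, methodI, iInf_eq_top]
  intro A hA
  obtain ⟨i, m, him⟩ := exists_measure_inter_ne_zero hE hA (subset_iUnion_uniform h)
  refine ENNReal.tsum_eq_top_of_eq_top ⟨i, ?_⟩
  set F := A i ∩ {x ∈ E | ∀ r, 0 < r → r < 1 / ((m : ℝ) + 1) →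
    ν (ball x r) ≤ w x r * ENNReal.ofReal (2 * r) ^ t'} with hF
  rw [eq_top_iff]
  -- The supremum over subsets in the pre-measure permits passing from the member of the cover to
  -- its piece `F`.
  refine le_trans ?_ (le_iSup₂_of_le F inter_subset_left le_rfl)
  have hlim : Tendsto (fun r : ℝ => ν F * ENNReal.ofReal (2 * r) ^ (t - t')) (𝓝[>] 0) (𝓝 ∞) := by
    have := ENNReal.Tendsto.const_mul (a := ν F)
      (tendsto_ofReal_two_mul_rpow_of_neg (s := t - t') (by linarith)) (Or.inl (by simp))
    rwa [ENNReal.mul_top him] at this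
  rw [← hlim.liminf_eq]
  refine liminf_le_liminf ?_
  filter_upwards [Ioo_mem_nhdsGT (show (0 : ℝ) < 1 / ((m : ℝ) + 1) by positivity)] with r hr
  have hc0 : ENNReal.ofReal (2 * r) ≠ 0 := by simp [hr.1]
  have hc1 : ENNReal.ofReal (2 * r) ≠ ∞ := ENNReal.ofReal_ne_top
  have key : ν F * ENNReal.ofReal (2 * r) ^ (-t') ≤ coveringSum w r F := by
    refine le_iInf₂ fun s hs => ?_
    -- The set of centres may be uncountable; a Lindelöf subcover makes countable subadditivity of
    -- `ν` available.
    obtain ⟨T, hT1, hT2, hT3⟩ := exists_countable_subcover hs.2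
    have h1 : ν F ≤ ∑' x : T, ν (ball (x : X) r) :=
      (measure_mono hT3).trans (measure_biUnion_le _ hT2 _)
    have h2 : ν F ≤ (∑' x : s, w x r) * ENNReal.ofReal (2 * r) ^ t' := by
      refine h1.trans ((ENNReal.tsum_mono_subtype (fun x => ν (ball x r)) hT1).trans ?_)
      rw [← ENNReal.tsum_mul_right]
      exact ENNReal.tsum_le_tsum fun x => (hs.1 x.2).2.2 r hr.1 hr.2
    calc ν F * ENNReal.ofReal (2 * r) ^ (-t')
        ≤ (∑' x : s, w x r) * ENNReal.ofReal (2 * r) ^ t' * ENNReal.ofReal (2 * r) ^ (-t') := by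
          gcongr
      _ = ∑' x : s, w x r := by
          rw [mul_assoc, ← ENNReal.rpow_add _ _ hc0 hc1, add_neg_cancel, ENNReal.rpow_zero, mul_one]
  calc ν F * ENNReal.ofReal (2 * r) ^ (t - t')
      = ν F * ENNReal.ofReal (2 * r) ^ (-t') * ENNReal.ofReal (2 * r) ^ t := by
        rw [mul_assoc, ← ENNReal.rpow_add _ _ hc0 hc1]
        congr 2
        ring
    _ ≤ _ := by gcongr

/-- Mass distribution for the upper measures: because of the upper limit, infinitely many `good`
scales suffice. A maximal packing covers only after doubling its radii, hence the ball of radius `2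
* 2 ^ (-n)` on the left and the weight at radius `2 ^ (-n)` on the right. -/
theorem upperMeasure_eq_top [SecondCountableTopology X] [MeasurableSpace X] {ν : Measure X}
    {w : X → ℝ → ℝ≥0∞} {t t' : ℝ} (htt : t < t') {E : Set X} (hE : ν E ≠ 0) {good : ℕ → Prop}
    (hgood : ∃ᶠ n in atTop, good n)
    (h : ∀ x ∈ E, ∀ᶠ n : ℕ in atTop, good n → ν (ball x (2 * ((2 : ℝ) ^ n)⁻¹)) ≤
      w x ((2 : ℝ) ^ n)⁻¹ * ENNReal.ofReal (2 * ((2 : ℝ) ^ n)⁻¹) ^ t') :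
    upperMeasure w t E = ∞ := by
  simp only [upperMeasure, methodI, iInf_eq_top]
  intro A hA
  set G : ℕ → Set X := fun m => {x ∈ E | ∀ n ≥ m, good n → ν (ball x (2 * ((2 : ℝ) ^ n)⁻¹)) ≤
      w x ((2 : ℝ) ^ n)⁻¹ * ENNReal.ofReal (2 * ((2 : ℝ) ^ n)⁻¹) ^ t'} with hG
  have hEG : E ⊆ ⋃ m, G m := by
    intro x hx
    obtain ⟨m, hm⟩ := eventually_atTop.1 (h x hx)
    exact mem_iUnion.2 ⟨m, hx, hm⟩
  obtain ⟨i, m, him⟩ := exists_measure_inter_ne_zero hE hA hEG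
  refine ENNReal.tsum_eq_top_of_eq_top ⟨i, ?_⟩
  have hlim : Tendsto (fun n : ℕ => ν (A i ∩ G m) *
      ENNReal.ofReal (2 * ((2 : ℝ) ^ n)⁻¹) ^ (t - t')) atTop (𝓝 ∞) := by
    have := ENNReal.Tendsto.const_mul (a := ν (A i ∩ G m))
      ((tendsto_ofReal_two_mul_rpow_of_neg (s := t - t') (by linarith)).comp tendsto_two_pow_inv)
      (Or.inl (by simp))
    rwa [ENNReal.mul_top him] at this
  refine ENNReal.eq_top_of_forall_nnreal_le fun b => ?_
  refine le_limsup_of_frequently_le' (tendsto_two_pow_inv.frequently ?_)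
  refine (hgood.and_eventually ((hlim.eventually_const_le
    (ENNReal.coe_lt_top (r := b))).and (eventually_ge_atTop m))).mono ?_
  rintro n ⟨hgn, hbn, hmn⟩
  set r : ℝ := ((2 : ℝ) ^ n)⁻¹ with hr
  have hr0 : 0 < r := by positivity
  have hc0 : ENNReal.ofReal (2 * r) ≠ 0 := by simp [hr0]
  have hc1 : ENNReal.ofReal (2 * r) ≠ ∞ := ENNReal.ofReal_ne_top
  obtain ⟨s, hs, hcov⟩ := exists_isCenteredPacking_cover (A i ∩ G m) hr0
  have hcount : s.Countable := hs.2.countable_of_isOpen (fun _ _ => isOpen_ball)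
    fun x _ => ⟨x, mem_ball_self hr0⟩
  have h2 : ν (A i ∩ G m) ≤ packingSum w r (A i) * ENNReal.ofReal (2 * r) ^ t' := by
    calc ν (A i ∩ G m) ≤ ∑' x : s, ν (ball (x : X) (2 * r)) :=
          (measure_mono hcov).trans (measure_biUnion_le _ hcount _)
      _ ≤ ∑' x : s, w x r * ENNReal.ofReal (2 * r) ^ t' :=
          ENNReal.tsum_le_tsum fun x => (hs.1 x.2).2.2 n hmn hgn
      _ = (∑' x : s, w x r) * ENNReal.ofReal (2 * r) ^ t' := ENNReal.tsum_mul_right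
      _ ≤ packingSum w r (A i) * ENNReal.ofReal (2 * r) ^ t' := by
          gcongr
          exact le_iSup₂_of_le s ⟨hs.1.trans inter_subset_left, hs.2⟩ le_rfl
  calc (b : ℝ≥0∞) ≤ ν (A i ∩ G m) * ENNReal.ofReal (2 * r) ^ (t - t') := hbn
    _ ≤ packingSum w r (A i) * ENNReal.ofReal (2 * r) ^ t' *
        ENNReal.ofReal (2 * r) ^ (t - t') := by gcongr
    _ = packingSum w r (A i) * ENNReal.ofReal (2 * r) ^ t := by
        rw [mul_assoc, ← ENNReal.rpow_add _ _ hc0 hc1]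
        congr 2
        ring

/-- A packing by balls of one radius is a particular packing by balls of varying radii. -/
theorem upperPremeasure_le_packingPremeasure (t : ℝ) (E : Set X) :
    upperPremeasure (fun _ _ => 1) t E ≤ packingPremeasure t E := by
  refine le_iInf₂ fun δ hδ => limsup_le_of_le (by isBoundedDefault) ?_
  filter_upwards [Ioo_mem_nhdsGT hδ] with r hr
  rw [packingSum, ENNReal.iSup_mul]
  refine iSup_le fun s => ?_
  rw [ENNReal.iSup_mul]
  refine iSup_le fun hs => ?_
  have hinj : Function.Injective (fun x : X => (x, r)) := fun x y h => (Prod.mk.inj h).1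
  refine le_trans (le_of_eq ?_) (le_iSup₂_of_le ((fun x : X => (x, r)) '' s) ⟨?_, ?_⟩ le_rfl)
  · rw [← ENNReal.tsum_mul_right,
      tsum_image (fun b : X × ℝ => ENNReal.ofReal (2 * b.2) ^ t) hinj.injOn]
    simp
  · rintro _ ⟨x, hx, rfl⟩
    exact ⟨hs.1 hx, hr.1, hr.2.le⟩
  · rintro _ ⟨x, hx, rfl⟩ _ ⟨y, hy, rfl⟩ hne
    exact hs.2 hx hy fun h => hne (by rw [h])

theorem upperDim_le_packingDim (E : Set X) : upperDim E ≤ packingDim E := by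
  refine iSup₂_le fun t ht => le_iSup₂_of_le t ?_ le_rfl
  rw [eq_top_iff, ← ht]
  exact methodI_mono (fun A => upperPremeasure_le_packingPremeasure _ A) E

/-- Balls of radius `r` have diameter at most `2 r`, so near-optimal covers along a sequence of
scales realising the lower limit bound the Hausdorff measure. -/
theorem hausdorffMeasure_le_lowerContent [SecondCountableTopology X] [MeasurableSpace X]
    [BorelSpace X] (t : ℝ≥0) (F : Set X) :
    μH[(t : ℝ)] F ≤ lowerContent (fun _ _ => 1) t F := by
  refine le_of_forall_gt fun a ha => ?_
  obtain ⟨a', ha', haa'⟩ := exists_between ha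
  refine lt_of_le_of_lt ?_ haa'
  set P : ℝ → Set X → Prop := fun r T => T.Countable ∧ F ⊆ ⋃ x ∈ T, ball x r ∧
    (∑' _x : T, (1 : ℝ≥0∞)) * ENNReal.ofReal (2 * r) ^ (t : ℝ) ≤ a' with hP
  have hfreq : ∃ᶠ r in 𝓝[>] (0 : ℝ), ∃ T, P r T := by
    have h1 := frequently_lt_of_liminf_lt (by isBoundedDefault) ha'
    refine (h1.and_eventually self_mem_nhdsWithin).mono ?_
    rintro r ⟨hr, hr0⟩
    have hr0 : 0 < r := hr0
    have hc0 : ENNReal.ofReal (2 * r) ^ (t : ℝ) ≠ 0 := by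
      simp [ENNReal.rpow_eq_zero_iff, hr0]
    have hc1 : ENNReal.ofReal (2 * r) ^ (t : ℝ) ≠ ∞ :=
      ENNReal.rpow_ne_top_of_nonneg t.coe_nonneg ENNReal.ofReal_ne_top
    rw [← ENNReal.lt_div_iff_mul_lt (Or.inl hc0) (Or.inl hc1)] at hr
    simp only [coveringSum, iInf_lt_iff, exists_prop] at hr
    obtain ⟨s, hs, hsr⟩ := hr
    obtain ⟨T, hT1, hT2, hT3⟩ := exists_countable_subcover hs.2
    refine ⟨T, hT2, hT3, ?_⟩
    have h2 : (∑' _x : T, (1 : ℝ≥0∞)) < a' / ENNReal.ofReal (2 * r) ^ (t : ℝ) :=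
      lt_of_le_of_lt (ENNReal.tsum_mono_subtype (fun _ => 1) hT1) hsr
    exact (ENNReal.lt_div_iff_mul_lt (Or.inl hc0) (Or.inl hc1)).1 h2 |>.le
  classical
  set T : ℝ → Set X := fun r => if h : ∃ T, P r T then h.choose else ∅ with hT
  have hTP : ∀ r, (∃ T, P r T) → P r (T r) := by
    intro r h
    simp only [hT, dif_pos h]
    exact h.choose_spec
  have hTc : ∀ r, Countable (T r) := by
    intro r
    by_cases h : ∃ T, P r T
    · exact (hTP r h).1.to_subtype
    · simp only [hT, dif_neg h]
      infer_instance
  set l : Filter ℝ := 𝓝[>] (0 : ℝ) ⊓ 𝓟 {r | ∃ T, P r T} with hl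
  have hne : NeBot l := frequently_mem_iff_neBot.1 hfreq
  have hmem : ∀ᶠ r in l, ∃ T, P r T := mem_inf_of_right (mem_principal_self _)
  have hdiam : ∀ r, ∀ x : X, Metric.ediam (ball x r) ≤ ENNReal.ofReal (2 * r) := by
    intro r x
    rw [← Metric.eball_ofReal, ENNReal.ofReal_mul (by norm_num), ENNReal.ofReal_ofNat]
    exact Metric.ediam_eball_le
  have key := Measure.hausdorffMeasure_le_liminf_tsum (t : ℝ) F (l := l)
    (fun r => ENNReal.ofReal (2 * r)) (tendsto_ofReal_two_mul.mono_left inf_le_left)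
    (fun r (x : T r) => ball (x : X) r) (Eventually.of_forall fun r x => hdiam r x)
    (hmem.mono fun r hr => by simpa only [biUnion_eq_iUnion] using (hTP r hr).2.1)
  refine key.trans (liminf_le_of_frequently_le' (Eventually.frequently (hmem.mono fun r hr => ?_)))
  refine le_trans ?_ (hTP r hr).2.2
  rw [← ENNReal.tsum_mul_right]
  refine ENNReal.tsum_le_tsum fun x => ?_
  rw [one_mul]
  exact ENNReal.rpow_le_rpow (hdiam r x) t.2

theorem dimH_le_lowerDim [SecondCountableTopology X] (E : Set X) : dimH E ≤ lowerDim E := by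
  borelize X
  rw [dimH_def]
  refine iSup₂_le fun t ht => le_iSup₂_of_le t ?_ le_rfl
  rw [eq_top_iff, ← ht]
  refine le_iInf₂ fun A hA => (measure_mono hA).trans ((measure_iUnion_le A).trans ?_)
  exact ENNReal.tsum_le_tsum fun i => (hausdorffMeasure_le_lowerContent t (A i)).trans
    (le_iSup₂_of_le (A i) Subset.rfl le_rfl)

/-- The mass distribution principle. -/
theorem le_dimH_of_measure_ball_le [MeasurableSpace X] [BorelSpace X] {ν : Measure X}
    {E : Set X} (hE : ν E ≠ 0) (s : ℝ≥0)
    (h : ∀ x ∈ E, ∀ᶠ r in 𝓝[>] (0 : ℝ), ν (ball x r) ≤ ENNReal.ofReal (2 * r) ^ (s : ℝ)) :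
    s ≤ dimH E := by
  obtain ⟨-, m, him⟩ := exists_measure_inter_ne_zero hE (A := fun _ => univ)
    (fun x _ => mem_iUnion.2 ⟨0, mem_univ x⟩) (subset_iUnion_uniform h)
  rw [univ_inter] at him
  set F := {x ∈ E | ∀ r, 0 < r → r < 1 / ((m : ℝ) + 1) →
    ν (ball x r) ≤ ENNReal.ofReal (2 * r) ^ (s : ℝ)} with hF
  refine le_trans ?_ (dimH_mono (show F ⊆ E from fun x hx => hx.1))
  refine le_dimH_of_hausdorffMeasure_ne_zero ?_
  -- A set of diameter `δ` meeting `F` at `x` lies in every ball `ball x r` with `r > δ`; letting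
  -- `r` decrease to `δ` gives `(2 δ) ^ s`, and `c` absorbs the `2`.
  set c : ℝ≥0∞ := 2 ^ (s : ℝ) with hc
  have hc0 : c ≠ 0 := by simp [hc, ENNReal.rpow_eq_zero_iff]
  have hc1 : c ≠ ∞ := by simp [hc, ENNReal.rpow_eq_top_iff]
  set η : ℝ := 1 / (2 * ((m : ℝ) + 1)) with hη
  have hη0 : 0 < η := by positivity
  have hηm : η < 1 / ((m : ℝ) + 1) := by
    rw [hη]
    exact one_div_lt_one_div_of_lt (by positivity) (by linarith [show (0 : ℝ) ≤ m by positivity])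
  have hle : c⁻¹ • ν.restrict F ≤ μH[(s : ℝ)] := by
    refine Measure.le_hausdorffMeasure _ _ (ENNReal.ofReal η) (ENNReal.ofReal_pos.2 hη0) fun S hS => ?_
    rw [Measure.smul_apply, smul_eq_mul, ENNReal.inv_mul_le_iff hc0 hc1]
    -- Neither `F` nor `S` need be measurable; the closure is, and it has the same diameter.
    have h1 : ν.restrict F S ≤ ν (closure S ∩ F) := by
      rw [← Measure.restrict_apply measurableSet_closure]
      exact measure_mono subset_closure
    refine h1.trans ?_
    rcases (closure S ∩ F).eq_empty_or_nonempty with hem | ⟨x, hxS, hxF⟩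
    · simp [hem]
    have hdtop : Metric.ediam S ≠ ∞ := ne_top_of_le_ne_top ENNReal.ofReal_ne_top hS
    set δ : ℝ := (Metric.ediam S).toReal with hδ
    have hδS : Metric.ediam S = ENNReal.ofReal δ := (ENNReal.ofReal_toReal hdtop).symm
    have hδη : δ ≤ η := ENNReal.toReal_le_of_le_ofReal hη0.le hS
    have hball : ∀ᶠ r in 𝓝[>] δ, ν (closure S ∩ F) ≤ ENNReal.ofReal (2 * r) ^ (s : ℝ) := by
      filter_upwards [Ioo_mem_nhdsGT (hδη.trans_lt hηm)] with r hr
      have hδ0 : 0 ≤ δ := ENNReal.toReal_nonneg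
      refine le_trans (measure_mono fun y hy => ?_) (hxF.2 r (hδ0.trans_lt hr.1) hr.2)
      have hed : edist y x ≤ ENNReal.ofReal δ := by
        rw [← hδS, ← Metric.ediam_closure]
        exact Metric.edist_le_ediam_of_mem hy.1 hxS
      rw [edist_dist, ENNReal.ofReal_le_ofReal_iff hδ0] at hed
      exact mem_ball.2 (hed.trans_lt hr.1)
    have hcont : Tendsto (fun r : ℝ => ENNReal.ofReal (2 * r) ^ (s : ℝ)) (𝓝[>] δ)
        (𝓝 (ENNReal.ofReal (2 * δ) ^ (s : ℝ))) :=
      ((ENNReal.continuous_rpow_const.comp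
        (ENNReal.continuous_ofReal.comp (continuous_const_mul 2))).tendsto δ).mono_left
        nhdsWithin_le_nhds
    refine (ge_of_tendsto hcont hball).trans (le_of_eq ?_)
    rw [hδS, hc, ENNReal.ofReal_mul (by norm_num), ENNReal.ofReal_ofNat,
      ENNReal.mul_rpow_of_nonneg _ _ s.coe_nonneg]
  have := hle F
  rw [Measure.smul_apply, Measure.restrict_apply_self, smul_eq_mul] at this
  intro h0
  rw [h0, nonpos_iff_eq_zero, mul_eq_zero] at this
  rcases this with h1 | h1
  · exact ENNReal.inv_ne_zero.2 hc1 h1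
  · exact him h1

end GeneralDimensions

/-! ### Oscillation of the block averages -/

section BlockSums

theorem zeroMass_of_odd_block {t : ℕ → ℕ} (u v : ℝ) {k j : ℕ} (h1 : t (2 * k + 1) ≤ j)
    (h2 : j < t (2 * k + 2)) : zeroMass u v t j = u :=
  if_pos ⟨k, h1, h2⟩

theorem zeroMass_of_even_block {t : ℕ → ℕ} (ht : StrictMono t) (u v : ℝ) {k j : ℕ}
    (h1 : t (2 * k) ≤ j) (h2 : j < t (2 * k + 1)) : zeroMass u v t j = v := by
  refine if_neg ?_
  rintro ⟨l, h3, h4⟩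
  have h5 : 2 * k < 2 * l + 2 := ht.lt_iff_lt.1 (h1.trans_lt h4)
  have h6 : 2 * l + 1 < 2 * k + 1 := ht.lt_iff_lt.1 (h3.trans_lt h2)
  omega

theorem blockSum_le (u v : ℝ) (t : ℕ → ℕ) (n : ℕ) : blockSum u v t n ≤ n * max u v := by
  refine (Finset.sum_le_card_nsmul _ _ (max u v) fun i _ => ?_).trans (le_of_eq (by simp))
  exact zeroMass_mem (s := Iic (max u v)) (le_max_left u v) (le_max_right u v) t _

theorem le_blockSum (u v : ℝ) (t : ℕ → ℕ) (n : ℕ) : n * min u v ≤ blockSum u v t n := by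
  refine (le_of_eq (by simp)).trans (Finset.card_nsmul_le_sum (Finset.range n) _ (min u v)
    fun i _ => ?_)
  exact zeroMass_mem (s := Ici (min u v)) (min_le_left u v) (min_le_right u v) t _

theorem blockSum_linear (x u v u' v' : ℝ) (t : ℕ → ℕ) (n : ℕ) :
    blockSum (x * u - u') (x * v - v') t n = x * blockSum u v t n - blockSum u' v' t n := by
  simp only [blockSum]
  rw [Finset.mul_sum, ← Finset.sum_sub_distrib]
  refine Finset.sum_congr rfl fun i _ => ?_
  unfold zeroMass
  split_ifs <;> rfl

theorem blockSum_self (u : ℝ) (t : ℕ → ℕ) (n : ℕ) : blockSum u u t n = n * u := by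
  simp [blockSum, zeroMass]

/-- The sum of length `n` covers the positions `1, …, n`, so `n = t (m + 1) - 1` is exactly the end
of block `m`; only the positions before `t m` can differ from `c`. -/
theorem abs_blockSum_sub_le {u v c : ℝ} {t : ℕ → ℕ} (ht : StrictMono t) (hc : c = u ∨ c = v) {m : ℕ}
    (h : ∀ j, t m ≤ j → j < t (m + 1) → zeroMass u v t j = c) :
    |blockSum u v t (t (m + 1) - 1) - (t (m + 1) - 1 : ℕ) * c| ≤ t m * |u - v| := by
  have h1 : blockSum u v t (t (m + 1) - 1) - (t (m + 1) - 1 : ℕ) * c =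
      ∑ i ∈ Finset.range (t (m + 1) - 1), (zeroMass u v t (i + 1) - c) := by
    rw [Finset.sum_sub_distrib]
    simp [blockSum]
  have hlt : t m < t (m + 1) := ht (Nat.lt_succ_self m)
  have h2 : ∑ i ∈ Finset.range (t m - 1), (zeroMass u v t (i + 1) - c) =
      ∑ i ∈ Finset.range (t (m + 1) - 1), (zeroMass u v t (i + 1) - c) := by
    refine Finset.sum_subset (Finset.range_subset_range.2 (by omega)) fun i hi hi' => ?_
    rw [Finset.mem_range] at hi hi'
    rw [h (i + 1) (by omega) (by omega), sub_self]
  rw [h1, ← h2]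
  refine (Finset.abs_sum_le_sum_abs _ _).trans ?_
  refine (Finset.sum_le_card_nsmul _ _ |u - v| fun i _ => ?_).trans ?_
  · have := abs_nonneg (u - v)
    rcases zeroMass_eq_or u v t (i + 1) with h | h <;> rcases hc with rfl | rfl <;> rw [h] <;>
      simp [abs_sub_comm]
  · rw [Finset.card_range, nsmul_eq_mul]
    gcongr
    omega

theorem frequently_abs_blockSum_sub_le {u v c : ℝ} {t : ℕ → ℕ} (htmono : StrictMono t)
    (ht : Tendsto (fun n => (t (n + 1) : ℝ) / (t n : ℝ)) atTop atTop) (hc : c = u ∨ c = v)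
    (h : ∃ᶠ m in atTop, ∀ j, t m ≤ j → j < t (m + 1) → zeroMass u v t j = c) {ε : ℝ} (hε : 0 < ε) :
    ∃ᶠ n : ℕ in atTop, |blockSum u v t n - n * c| ≤ ε * n := by
  rw [frequently_atTop]
  intro N
  -- The `+ 1` in the threshold pays for the `- 1` in `t (m + 1) - 1`, using `1 ≤ t m`.
  obtain ⟨m, hm, hm1, hm2, hm3⟩ := (h.and_eventually ((ht.eventually_ge_atTop
    (|u - v| / ε + 1)).and ((eventually_ge_atTop N).and (eventually_ge_atTop 1)))).exists
  have hid := htmono.id_le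
  have h1 : m + 1 ≤ t (m + 1) := hid (m + 1)
  have htm : 1 ≤ t m := hm3.trans (hid m)
  have htm' : (1 : ℝ) ≤ t m := by exact_mod_cast htm
  refine ⟨t (m + 1) - 1, by omega, (abs_blockSum_sub_le htmono hc hm).trans ?_⟩
  rw [le_div_iff₀ (by linarith)] at hm1
  have h2 : ((t (m + 1) - 1 : ℕ) : ℝ) = t (m + 1) - 1 := by
    rw [Nat.cast_sub (by omega)]; simp
  rw [h2]
  have h3 : |u - v| / ε * t m ≤ (t (m + 1) : ℝ) - 1 := by nlinarith
  calc (t m : ℝ) * |u - v| = ε * (|u - v| / ε * t m) := by field_simp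
    _ ≤ _ := mul_le_mul_of_nonneg_left h3 hε.le

theorem frequently_abs_blockSum_sub_left_le {u v : ℝ} {t : ℕ → ℕ} (htmono : StrictMono t)
    (ht : Tendsto (fun n => (t (n + 1) : ℝ) / (t n : ℝ)) atTop atTop) {ε : ℝ} (hε : 0 < ε) :
    ∃ᶠ n : ℕ in atTop, |blockSum u v t n - n * u| ≤ ε * n := by
  refine frequently_abs_blockSum_sub_le htmono ht (Or.inl rfl) ?_ hε
  refine frequently_atTop.2 fun N => ⟨2 * N + 1, by omega, fun j h1 h2 => ?_⟩
  exact zeroMass_of_odd_block u v h1 h2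

theorem frequently_abs_blockSum_sub_right_le {u v : ℝ} {t : ℕ → ℕ} (htmono : StrictMono t)
    (ht : Tendsto (fun n => (t (n + 1) : ℝ) / (t n : ℝ)) atTop atTop) {ε : ℝ} (hε : 0 < ε) :
    ∃ᶠ n : ℕ in atTop, |blockSum u v t n - n * v| ≤ ε * n := by
  refine frequently_abs_blockSum_sub_le htmono ht (Or.inr rfl) ?_ hε
  refine frequently_atTop.2 fun N => ⟨2 * N, by omega, fun j h1 h2 => ?_⟩
  exact zeroMass_of_even_block htmono u v h1 h2

theorem frequently_blockSum_le_min (u v : ℝ) {t : ℕ → ℕ} (htmono : StrictMono t)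
    (ht : Tendsto (fun n => (t (n + 1) : ℝ) / (t n : ℝ)) atTop atTop) {ε : ℝ} (hε : 0 < ε) :
    ∃ᶠ n : ℕ in atTop, blockSum u v t n ≤ n * (min u v + ε) := by
  rcases le_total u v with h | h
  · rw [min_eq_left h]
    refine (frequently_abs_blockSum_sub_left_le htmono ht hε (u := u) (v := v)).mono fun n hn => ?_
    linarith [(abs_le.1 hn).2]
  · rw [min_eq_right h]
    refine (frequently_abs_blockSum_sub_right_le htmono ht hε (u := u) (v := v)).mono fun n hn => ?_
    linarith [(abs_le.1 hn).2]

theorem frequently_max_le_blockSum (u v : ℝ) {t : ℕ → ℕ} (htmono : StrictMono t)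
    (ht : Tendsto (fun n => (t (n + 1) : ℝ) / (t n : ℝ)) atTop atTop) {ε : ℝ} (hε : 0 < ε) :
    ∃ᶠ n : ℕ in atTop, n * (max u v - ε) ≤ blockSum u v t n := by
  rcases le_total u v with h | h
  · rw [max_eq_right h]
    refine (frequently_abs_blockSum_sub_right_le htmono ht hε (u := u) (v := v)).mono fun n hn => ?_
    linarith [(abs_le.1 hn).1]
  · rw [max_eq_left h]
    refine (frequently_abs_blockSum_sub_left_le htmono ht hε (u := u) (v := v)).mono fun n hn => ?_
    linarith [(abs_le.1 hn).1]

end BlockSums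

/-! ### Estimates at dyadic scales -/

section Scales

theorem rpow_mem_of_mem {m : ℝ≥0∞} {A e : ℝ} (h1 : (2 : ℝ≥0∞) ^ (A - e) ≤ m)
    (h2 : m ≤ 2 ^ (A + e)) (q : ℝ) :
    (2 : ℝ≥0∞) ^ (q * A - |q| * e) ≤ m ^ q ∧ m ^ q ≤ 2 ^ (q * A + |q| * e) := by
  rcases le_total 0 q with hq | hq
  · have g1 := ENNReal.rpow_le_rpow h1 hq
    have g2 := ENNReal.rpow_le_rpow h2 hq
    rw [← ENNReal.rpow_mul] at g1 g2
    rw [abs_of_nonneg hq]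
    constructor
    · convert g1 using 2; ring
    · convert g2 using 2; ring
  · have g1 := rpow_le_rpow_of_nonpos_exponent hq h1
    have g2 := rpow_le_rpow_of_nonpos_exponent hq h2
    rw [← ENNReal.rpow_mul] at g1 g2
    rw [abs_of_nonpos hq]
    constructor
    · convert g2 using 2; ring
    · convert g1 using 2; ring

theorem two_rpow_sub_nat (n : ℕ) (k : ℝ) :
    (2 : ℝ≥0∞) ^ (-(n : ℝ) + k) = ENNReal.ofReal ((2 : ℝ) ^ k * ((2 : ℝ) ^ n)⁻¹) := by
  have h2 : (2 : ℝ≥0∞) = ENNReal.ofReal 2 := by simp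
  rw [h2, ENNReal.ofReal_rpow_of_pos (by norm_num), Real.rpow_add (by norm_num),
    Real.rpow_neg (by norm_num), Real.rpow_natCast, mul_comm]

theorem ofReal_rpow_mem {n : ℕ} {r : ℝ} (h1 : ((2 : ℝ) ^ (n + 1))⁻¹ ≤ r)
    (h2 : r ≤ 4 * ((2 : ℝ) ^ n)⁻¹) (s : ℝ) :
    (2 : ℝ≥0∞) ^ (s * (-n) - |s| * 2) ≤ ENNReal.ofReal r ^ s ∧
      ENNReal.ofReal r ^ s ≤ 2 ^ (s * (-n) + |s| * 2) := by
  have hn : (0 : ℝ) < ((2 : ℝ) ^ n)⁻¹ := by positivity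
  refine rpow_mem_of_mem ?_ ?_ s
  · rw [sub_eq_add_neg, two_rpow_sub_nat]
    refine ENNReal.ofReal_le_ofReal (le_trans ?_ h1)
    rw [pow_succ, mul_inv, Real.rpow_neg (by norm_num)]
    norm_num
    linarith
  · rw [two_rpow_sub_nat]
    refine ENNReal.ofReal_le_ofReal (h2.trans (le_of_eq ?_))
    norm_num

theorem two_rpow_mul (x y : ℝ) : (2 : ℝ≥0∞) ^ x * 2 ^ y = 2 ^ (x + y) :=
  (ENNReal.rpow_add _ _ (by norm_num) (by norm_num)).symm

theorem two_rpow_ne_top (x : ℝ) : (2 : ℝ≥0∞) ^ x ≠ ∞ := by simp [ENNReal.rpow_eq_top_iff]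

theorem eventually_of_dyadic_scale {P : ℝ → Prop}
    (h : ∀ᶠ n : ℕ in atTop, ∀ r, ((2 : ℝ) ^ n)⁻¹ < r → r ≤ 2 * ((2 : ℝ) ^ n)⁻¹ → P r) :
    ∀ᶠ r in 𝓝[>] (0 : ℝ), P r := by
  obtain ⟨N, hN⟩ := eventually_atTop.1 h
  filter_upwards [Ioo_mem_nhdsGT (show (0 : ℝ) < ((2 : ℝ) ^ N)⁻¹ by positivity)] with r hr
  have hN1 : ((2 : ℝ) ^ N)⁻¹ ≤ 1 := inv_le_one_of_one_le₀ (one_le_pow₀ (by norm_num))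
  obtain ⟨n, h1, h2⟩ := exists_dyadic_scale hr.1 (hr.2.le.trans hN1)
  refine hN n ?_ r h1 h2
  have := h1.trans hr.2
  rw [inv_lt_inv₀ (by positivity) (by positivity)] at this
  exact ((pow_lt_pow_iff_right₀ (by norm_num)).1 this).le

theorem eventually_mul_add_le {c η : ℝ} (hη : 0 < η) : ∀ᶠ n : ℕ in atTop, c ≤ η * n := by
  filter_upwards [eventually_ge_atTop ⌈c / η⌉₊] with n hn
  have := Nat.ceil_le.1 hn
  rw [div_le_iff₀ hη] at this
  linarith

/-- The comparison of `ν` with the weight `μ ^ q (2 r) ^ s` at a typical point. -/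
theorem eventually_measure_ball_le {ν μ : Measure ℝ} {A A' : ℕ → ℝ} {x : ℝ}
    (hμ : BallEstimate μ A x) (hν : BallEstimate ν A' x) {q s η : ℝ} (hη : 0 < η) :
    ∀ᶠ n : ℕ in atTop, A' n ≤ q * A n - n * (s + η) →
      ∀ r, ((2 : ℝ) ^ (n + 1))⁻¹ ≤ r → r ≤ 2 * ((2 : ℝ) ^ n)⁻¹ →
      ∀ r', ((2 : ℝ) ^ (n + 1))⁻¹ ≤ r' → r' ≤ 2 * ((2 : ℝ) ^ n)⁻¹ →
      ν (ball x r) ≤ ballPow μ q x r' * ENNReal.ofReal (2 * r') ^ s := by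
  -- The errors for `ν` and for `μ ^ q` add up to `(1 + |q|) ε n = η n / 2`; the other half of `η n`
  -- absorbs the constant `2 |s|` lost between the radius and `2 ^ (-n)`.
  set ε : ℝ := η / (2 * (1 + |q|)) with hε
  have hq := abs_nonneg q
  have hε0 : 0 < ε := by positivity
  have hεη : ε + |q| * ε = η / 2 := by rw [hε]; field_simp
  filter_upwards [hμ ε hε0, hν ε hε0,
    eventually_mul_add_le (c := |s| * 2) (η := η / 2) (by positivity)] with n h1 h2 h3 hA r hr hr'
      r' hs hs'
  refine (h2 r hr hr').2.trans ?_
  have g1 := (rpow_mem_of_mem (h1 r' hs hs').1 (h1 r' hs hs').2 q).1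
  have hpos : 0 < ((2 : ℝ) ^ (n + 1))⁻¹ := by positivity
  have g2 := (ofReal_rpow_mem (n := n) (r := 2 * r') (by linarith) (by linarith) s).1
  refine le_trans ?_ (mul_le_mul' g1 g2)
  rw [two_rpow_mul]
  refine ENNReal.rpow_le_rpow_of_exponent_le (by norm_num) ?_
  have : ε * n + |q| * (ε * n) = η / 2 * n := by rw [← hεη]; ring
  linarith

theorem tendsto_two_rpow_neg_mul {η : ℝ} (hη : 0 < η) :
    Tendsto (fun n : ℕ => (2 : ℝ≥0∞) ^ (-η * n)) atTop (𝓝 0) := by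
  have h1 : (2 : ℝ≥0∞) ^ (-η) < 1 := ENNReal.rpow_lt_one_of_one_lt_of_neg (by norm_num) (by linarith)
  refine (ENNReal.tendsto_pow_atTop_nhds_zero_of_lt_one h1).congr fun n => ?_
  rw [ENNReal.rpow_mul, ENNReal.rpow_natCast]

theorem scaled_le {c C : ℝ≥0∞} {D s η : ℝ} {n : ℕ} {r : ℝ} (hc : c ≤ C * 2 ^ D)
    (hD : D ≤ n * (s - η)) (h1 : ((2 : ℝ) ^ (n + 1))⁻¹ ≤ r) (h2 : r ≤ 4 * ((2 : ℝ) ^ n)⁻¹) :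
    c * ENNReal.ofReal r ^ s ≤ C * 2 ^ (|s| * 2) * 2 ^ (-η * n) := by
  calc c * ENNReal.ofReal r ^ s ≤ C * 2 ^ D * 2 ^ (s * (-n) + |s| * 2) :=
        mul_le_mul' hc (ofReal_rpow_mem h1 h2 s).2
    _ = C * 2 ^ (D + (s * (-n) + |s| * 2)) := by rw [mul_assoc, two_rpow_mul]
    _ ≤ C * 2 ^ (|s| * 2 + -η * n) := by
        refine mul_le_mul' le_rfl (ENNReal.rpow_le_rpow_of_exponent_le (by norm_num) ?_)
        linarith
    _ = _ := by rw [mul_assoc, two_rpow_mul]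

theorem tendsto_const_mul_two_rpow {C : ℝ≥0∞} (hC : C ≠ ∞) (s : ℝ) {η : ℝ} (hη : 0 < η) :
    Tendsto (fun n : ℕ => C * 2 ^ (|s| * 2) * (2 : ℝ≥0∞) ^ (-η * n)) atTop (𝓝 0) := by
  have := ENNReal.Tendsto.const_mul (a := C * 2 ^ (|s| * 2)) (tendsto_two_rpow_neg_mul hη)
    (Or.inr (ENNReal.mul_ne_top hC (two_rpow_ne_top _)))
  rwa [mul_zero] at this

/-- The lower limit needs a good exponent `D n` only for infinitely many `n`, but the supremum over
subsets requires the covering bound for every `F ⊆ E`. -/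
theorem lowerPremeasure_eq_zero {w : ℝ → ℝ → ℝ≥0∞} {s η : ℝ} (hη : 0 < η) {E : Set ℝ}
    {C : ℝ≥0∞} (hC : C ≠ ∞) {D : ℕ → ℝ} (hD : ∃ᶠ n : ℕ in atTop, D n ≤ n * (s - η))
    (h : ∀ F ⊆ E, ∀ᶠ n : ℕ in atTop, coveringSum w (2 * ((2 : ℝ) ^ n)⁻¹) F ≤ C * 2 ^ D n) :
    lowerPremeasure w s E = 0 := by
  refine le_antisymm (iSup₂_le fun F hF => ?_) zero_le
  refine le_of_forall_gt fun b hb => ?_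
  obtain ⟨b', hb0, hb'⟩ := exists_between hb
  refine lt_of_le_of_lt (liminf_le_of_frequently_le' ?_) hb'
  have hscale : Tendsto (fun n : ℕ => 2 * ((2 : ℝ) ^ n)⁻¹) atTop (𝓝[>] 0) := by
    refine (tendsto_two_pow_inv.comp (tendsto_sub_atTop_nat 1)).congr' ?_
    filter_upwards [eventually_ge_atTop 1] with n hn
    obtain ⟨k, rfl⟩ : ∃ k, n = k + 1 := ⟨n - 1, by omega⟩
    simp [pow_succ]
  refine hscale.frequently ((hD.and_eventually ((h F hF).and
    ((tendsto_const_mul_two_rpow hC s hη).eventually_le_const hb0))).mono ?_)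
  rintro n ⟨h1, h2, h3⟩
  have hn : (0 : ℝ) < ((2 : ℝ) ^ n)⁻¹ := by positivity
  refine (scaled_le h2 h1 ?_ ?_).trans h3
  · rw [pow_succ, mul_inv]; linarith
  · linarith

theorem upperPremeasure_eq_zero {w : ℝ → ℝ → ℝ≥0∞} {s η : ℝ} (hη : 0 < η) {E : Set ℝ}
    {C : ℝ≥0∞} (hC : C ≠ ∞) {D : ℕ → ℝ} (hD : ∀ n : ℕ, D n ≤ n * (s - η))
    (h : ∀ᶠ n : ℕ in atTop, ∀ r, ((2 : ℝ) ^ n)⁻¹ < r → r ≤ 2 * ((2 : ℝ) ^ n)⁻¹ →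
      packingSum w r E ≤ C * 2 ^ D n) :
    upperPremeasure w s E = 0 := by
  refine le_antisymm (le_of_forall_gt fun b hb => ?_) zero_le
  obtain ⟨b', hb0, hb'⟩ := exists_between hb
  refine lt_of_le_of_lt (limsup_le_of_le (by isBoundedDefault) ?_) hb'
  refine eventually_of_dyadic_scale ?_
  filter_upwards [h, (tendsto_const_mul_two_rpow hC s hη).eventually_le_const hb0]
    with n h1 h2 r hr hr'
  have hn : (0 : ℝ) < ((2 : ℝ) ^ n)⁻¹ := by positivity
  refine (scaled_le (h1 r hr hr') (hD n) ?_ ?_).trans h2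
  · rw [pow_succ, mul_inv]; linarith
  · linarith

end Scales

/-! ### Gibbs measures and the separator functions -/

section Separators

/-- The Gibbs weight associated with the exponent `q`. -/
def gibbs (p q : ℝ) : ℝ := p ^ q / (p ^ q + (1 - p) ^ q)

theorem gibbs_mem_Ioo {p : ℝ} (hp : p ∈ Ioo (0 : ℝ) 1) (q : ℝ) : gibbs p q ∈ Ioo (0 : ℝ) 1 := by
  have h3 : 0 < p ^ q := Real.rpow_pos_of_pos hp.1 q
  have h4 : 0 < (1 - p) ^ q := Real.rpow_pos_of_pos (by linarith [hp.2]) q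
  refine ⟨by unfold gibbs; positivity, ?_⟩
  rw [gibbs, div_lt_one (by positivity)]
  linarith

/-- The logarithm of each Gibbs digit mass is `q` times that of the original mass, minus `tau p q`;
this averages the relation. It makes the Gibbs measure of a cell of generation `n` equal to its
`μ`-mass to the power `q` times `2 ^ (-S_n)`, with `S_n` the block sum of the `tau` values. -/
theorem crossLog_gibbs {p : ℝ} (hp : p ∈ Ioo (0 : ℝ) 1) (q : ℝ) :
    crossLog (gibbs p q) (gibbs p q) = q * crossLog (gibbs p q) p - tau p q := by
  have h0 : 0 < 1 - p := by linarith [hp.2]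
  have h3 : 0 < p ^ q := Real.rpow_pos_of_pos hp.1 q
  have h4 : 0 < (1 - p) ^ q := Real.rpow_pos_of_pos h0 q
  have hZ : p ^ q + (1 - p) ^ q ≠ 0 := by positivity
  have e1 : Real.logb 2 (gibbs p q) = q * Real.logb 2 p - tau p q := by
    rw [gibbs, Real.logb_div h3.ne' hZ, Real.logb_rpow_eq_mul_logb_of_pos hp.1, tau]
  have e2 : Real.logb 2 (1 - gibbs p q) = q * Real.logb 2 (1 - p) - tau p q := by
    have : 1 - gibbs p q = (1 - p) ^ q / (p ^ q + (1 - p) ^ q) := by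
      rw [gibbs]; field_simp; ring
    rw [this, Real.logb_div h4.ne' hZ, Real.logb_rpow_eq_mul_logb_of_pos h0, tau]
  unfold crossLog
  rw [e1, e2]
  ring

theorem mem_support_of_ballEstimate {μ : Measure ℝ} {A : ℕ → ℝ} {x : ℝ}
    (h : BallEstimate μ A x) : x ∈ μ.support := by
  rw [nhds_basis_ball.mem_measureSupport]
  intro r hr
  obtain ⟨n, h1, h2⟩ := ((h 1 one_pos).and ((tendsto_two_pow_inv.mono_right
    nhdsWithin_le_nhds).eventually_lt_const hr)).exists
  have hn : (0 : ℝ) < ((2 : ℝ) ^ n)⁻¹ := by positivity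
  have h3 := (h1 ((2 : ℝ) ^ n)⁻¹ (by rw [pow_succ, mul_inv]; linarith) (by linarith)).1
  refine lt_of_lt_of_le ?_ (h3.trans (measure_mono (ball_subset_ball h2.le)))
  exact ENNReal.rpow_pos (by norm_num) (by norm_num)

theorem support_blockMeasure_subset {p ph : ℝ} (hp : p ∈ Ioo (0 : ℝ) 1) (hph : ph ∈ Ioo (0 : ℝ) 1)
    (t : ℕ → ℕ) : (blockMeasure p ph t).support ⊆ Icc 0 1 := by
  have hprob := isProbabilityMeasure_blockMeasure_of_mem hp hph t
  refine Measure.support_subset_of_isClosed isClosed_Icc ?_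
  rw [mem_ae_iff, prob_compl_eq_zero_iff measurableSet_Icc]
  refine le_antisymm prob_le_one (one_le_blockMeasure_of_ae hp hph t (ae_of_all _ fun d => ?_))
  exact ⟨Real.ofDigits_nonneg d, Real.ofDigits_le_one d⟩

variable {p ph : ℝ} {t : ℕ → ℕ}

/-- Centres of disjoint balls of radius larger than `2 ^ (-n)` lie in distinct cells. -/
theorem packingSum_ballPow_le (hp : p ∈ Ioo (0 : ℝ) 1) (hph : ph ∈ Ioo (0 : ℝ) 1) (q : ℝ)
    {E : Set ℝ} (hE : E ⊆ Icc 0 1) {n : ℕ} {r : ℝ} (hr : ((2 : ℝ) ^ n)⁻¹ < r)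
    (hr' : r ≤ 2 * ((2 : ℝ) ^ n)⁻¹) :
    packingSum (ballPow (blockMeasure p ph t) q) r E ≤
      5 ^ |q| * 5 * 2 ^ blockSum (tau p q) (tau ph q) t n := by
  refine iSup₂_le fun s hs => ?_
  refine tsum_measure_ball_rpow_le hp hph t q (x := fun x : s => (x : ℝ)) (r := fun _ => r)
    (fun x => hE (hs.1 x.2)) (fun _ => hr) (fun _ => hr') fun x y hxy => ?_
  by_contra hne
  have hd := hs.2 x.2 y.2 (fun h => hne (Subtype.ext h))
  have hr0 : 0 < r := lt_trans (by positivity) hr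
  exact disjoint_left.1 hd (mem_ball_self hr0) (mem_ball.2 ((dist_lt_of_floor_eq hxy).trans hr))

/-- Every set has a centred cover whose centres lie in distinct dyadic cells. -/
theorem exists_isCenteredCover_injOn (F : Set ℝ) {n : ℕ} {r : ℝ} (hr : ((2 : ℝ) ^ n)⁻¹ < r) :
    ∃ s, IsCenteredCover F r s ∧ InjOn (fun x : ℝ => ⌊2 ^ n * x⌋) s := by
  obtain ⟨s, hs, hbij⟩ := F.exists_subset_bijOn (fun x : ℝ => ⌊2 ^ n * x⌋)
  refine ⟨s, ⟨hs, fun x hx => ?_⟩, hbij.injOn⟩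
  obtain ⟨y, hy, hxy⟩ := hbij.surjOn ⟨x, hx, rfl⟩
  exact mem_biUnion hy (mem_ball.2 ((dist_lt_of_floor_eq (Eq.symm hxy)).trans hr))

theorem coveringSum_ballPow_le (hp : p ∈ Ioo (0 : ℝ) 1) (hph : ph ∈ Ioo (0 : ℝ) 1) (q : ℝ)
    {F : Set ℝ} (hF : F ⊆ Icc 0 1) {n : ℕ} {r : ℝ} (hr : ((2 : ℝ) ^ n)⁻¹ < r)
    (hr' : r ≤ 2 * ((2 : ℝ) ^ n)⁻¹) :
    coveringSum (ballPow (blockMeasure p ph t) q) r F ≤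
      5 ^ |q| * 5 * 2 ^ blockSum (tau p q) (tau ph q) t n := by
  obtain ⟨s, hs, hinj⟩ := exists_isCenteredCover_injOn F hr
  refine iInf₂_le_of_le s hs ?_
  exact tsum_measure_ball_rpow_le hp hph t q (x := fun x : s => (x : ℝ)) (r := fun _ => r)
    (fun x => hF (hs.1 x.2)) (fun _ => hr) (fun _ => hr') (injOn_iff_injective.1 hinj)

theorem five_rpow_mul_ne_top (q : ℝ) : (5 : ℝ≥0∞) ^ |q| * 5 ≠ ∞ :=
  ENNReal.mul_ne_top (ENNReal.rpow_ne_top_of_nonneg (abs_nonneg q) (by norm_num)) (by norm_num)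

/-- The set of points which are typical both for a block measure and for its Gibbs measure of
exponent `q` has full Gibbs measure. -/
theorem blockMeasure_gibbs_typical_ne_zero (hp : p ∈ Ioo (0 : ℝ) 1) (hph : ph ∈ Ioo (0 : ℝ) 1)
    (q : ℝ) :
    blockMeasure (gibbs p q) (gibbs ph q) t
      {x | BallEstimate (blockMeasure p ph t)
          (blockSum (crossLog (gibbs p q) p) (crossLog (gibbs ph q) ph) t) x ∧
        BallEstimate (blockMeasure (gibbs p q) (gibbs ph q) t)
          (blockSum (crossLog (gibbs p q) (gibbs p q)) (crossLog (gibbs ph q) (gibbs ph q)) t) x}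
      ≠ 0 := by
  have hg := gibbs_mem_Ioo hp q
  have hg' := gibbs_mem_Ioo hph q
  refine (lt_of_lt_of_le zero_lt_one (one_le_blockMeasure_of_ae hg hg' t ?_)).ne'
  filter_upwards [ae_ball_estimate hg hg' hp hph t, ae_ball_estimate hg hg' hg hg' t] with d h1 h2
  exact ⟨h1, h2⟩

/-- Above: the partition function has exponent close to `n * min` at infinitely many scales, and the
lower limit uses only those. Below: the block sum is at least `n * min` at every scale, so the Gibbs
measure satisfies the mass distribution estimate at all small radii. -/
theorem bSep_blockMeasure (hp : p ∈ Ioo (0 : ℝ) 1) (hph : ph ∈ Ioo (0 : ℝ) 1)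
    (htmono : StrictMono t) (ht : Tendsto (fun n => (t (n + 1) : ℝ) / (t n : ℝ)) atTop atTop)
    (q : ℝ) : bSep (blockMeasure p ph t) q = (min (tau p q) (tau ph q) : ℝ) := by
  refine le_antisymm (iSup₂_le fun s hs => ?_) (EReal.ge_of_forall_gt_iff_ge.1 fun s hs => ?_)
  · by_contra! hlt
    rw [EReal.coe_lt_coe_iff] at hlt
    have hK := support_blockMeasure_subset hp hph t
    set η := (s - min (tau p q) (tau ph q)) / 2 with hη
    have h0 : lowerPremeasure (ballPow (blockMeasure p ph t) q) s (blockMeasure p ph t).support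
        = 0 := by
      refine lowerPremeasure_eq_zero (η := η) (by linarith) (five_rpow_mul_ne_top q)
        (D := blockSum (tau p q) (tau ph q) t) ?_ fun F hF => Eventually.of_forall fun n => ?_
      · refine (frequently_blockSum_le_min (tau p q) (tau ph q) htmono ht (ε := η)
          (by linarith)).mono fun n hn => hn.trans (le_of_eq ?_)
        rw [hη]; ring
      · have hn : (0 : ℝ) < ((2 : ℝ) ^ n)⁻¹ := by positivity
        exact coveringSum_ballPow_le hp hph q (hF.trans hK) (by linarith) le_rfl
    have : lowerMeasure (ballPow (blockMeasure p ph t) q) s (blockMeasure p ph t).support = 0 :=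
      methodI_eq_zero (fun _ => _) (iUnion_const _).symm.subset fun _ => h0
    rw [this] at hs
    exact ENNReal.zero_ne_top hs
  · rw [EReal.coe_lt_coe_iff] at hs
    refine le_iSup₂_of_le s ?_ le_rfl
    set m := min (tau p q) (tau ph q) with hm
    set η := (m - s) / 2 with hη
    have hη0 : 0 < η := by linarith
    refine eq_top_mono (methodI_mono_set _ fun x hx => mem_support_of_ballEstimate hx.1)
      (lowerMeasure_eq_top (t := s) (t' := s + η) (by linarith)
        (blockMeasure_gibbs_typical_ne_zero (t := t) hp hph q) ?_)
    rintro x ⟨h1, h2⟩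
    refine eventually_of_dyadic_scale ?_
    filter_upwards [eventually_measure_ball_le h1 h2 (q := q) (s := s + η) hη0] with n hn r hr hr'
    have hpos : (0 : ℝ) < ((2 : ℝ) ^ n)⁻¹ := by positivity
    have hr2 : ((2 : ℝ) ^ (n + 1))⁻¹ ≤ r := by rw [pow_succ, mul_inv]; linarith
    refine hn ?_ r hr2 hr' r hr2 hr'
    rw [crossLog_gibbs hp, crossLog_gibbs hph, blockSum_linear]
    have := le_blockSum (tau p q) (tau ph q) t n
    have hms : s + η + η = m := by rw [hη]; ring
    rw [hms]
    linarith

/-- Dual to the lower case: the bound by `n * max` holds at all scales, as an upper limit requires,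
while the mass distribution estimate is needed only at the scales where the block sum is close to `n
* max`. -/
theorem BSep_blockMeasure (hp : p ∈ Ioo (0 : ℝ) 1) (hph : ph ∈ Ioo (0 : ℝ) 1)
    (htmono : StrictMono t) (ht : Tendsto (fun n => (t (n + 1) : ℝ) / (t n : ℝ)) atTop atTop)
    (q : ℝ) : BSep (blockMeasure p ph t) q = (max (tau p q) (tau ph q) : ℝ) := by
  refine le_antisymm (iSup₂_le fun s hs => ?_) (EReal.ge_of_forall_gt_iff_ge.1 fun s hs => ?_)
  · by_contra! hlt
    rw [EReal.coe_lt_coe_iff] at hlt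
    have hK := support_blockMeasure_subset hp hph t
    set η := s - max (tau p q) (tau ph q) with hη
    have h0 : upperPremeasure (ballPow (blockMeasure p ph t) q) s (blockMeasure p ph t).support
        = 0 := by
      refine upperPremeasure_eq_zero (η := η) (by linarith) (five_rpow_mul_ne_top q)
        (D := blockSum (tau p q) (tau ph q) t) (fun n => ?_)
        (Eventually.of_forall fun n r hr hr' => packingSum_ballPow_le hp hph q hK hr hr')
      refine (blockSum_le _ _ t n).trans (le_of_eq ?_)
      rw [hη]; ring
    have : upperMeasure (ballPow (blockMeasure p ph t) q) s (blockMeasure p ph t).support = 0 :=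
      methodI_eq_zero (fun _ => _) (iUnion_const _).symm.subset fun _ => h0
    rw [this] at hs
    exact ENNReal.zero_ne_top hs
  · rw [EReal.coe_lt_coe_iff] at hs
    refine le_iSup₂_of_le s ?_ le_rfl
    set m := max (tau p q) (tau ph q) with hm
    set η := (m - s) / 3 with hη
    have hη0 : 0 < η := by linarith
    refine eq_top_mono (methodI_mono_set _ fun x hx => mem_support_of_ballEstimate hx.1)
      (upperMeasure_eq_top (t := s) (t' := s + η) (by linarith)
        (blockMeasure_gibbs_typical_ne_zero (t := t) hp hph q)
        (frequently_max_le_blockSum (tau p q) (tau ph q) htmono ht hη0) ?_)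
    rintro x ⟨h1, h2⟩
    filter_upwards [eventually_measure_ball_le h1 h2 (q := q) (s := s + η) hη0] with n hn hgood
    have hpos : (0 : ℝ) < ((2 : ℝ) ^ n)⁻¹ := by positivity
    have hr2 : ((2 : ℝ) ^ (n + 1))⁻¹ ≤ ((2 : ℝ) ^ n)⁻¹ := by rw [pow_succ, mul_inv]; linarith
    refine hn ?_ _ (by linarith) le_rfl _ hr2 (by linarith)
    rw [crossLog_gibbs hp, crossLog_gibbs hph, blockSum_linear]
    have hms : s + η + η = m - η := by rw [hη]; ring
    rw [hms]
    linarith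

end Separators

/-! ### Dimensions of the level sets -/

section LevelSets

variable {p ph : ℝ} {t : ℕ → ℕ}

theorem tendsto_log_div_log {μ : Measure ℝ} [IsFiniteMeasure μ] {α : ℝ} {x : ℝ}
    (h : BallEstimate μ (fun n => -(n * α)) x) :
    Tendsto (fun r : ℝ => Real.log (μ.real (ball x r)) / Real.log r) (𝓝[>] 0) (𝓝 α) := by
  rw [Metric.tendsto_nhds]
  intro ε hε
  refine eventually_of_dyadic_scale ?_
  -- The binary logarithm of the mass is `-n α` up to `ε n / 8`, and that of the radius is `-n` up
  -- to `1`; together the error is at most `ε n / 4`, and division by at least `n - 1 ≥ n / 2` stays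
  -- below `ε`.
  filter_upwards [h (ε / 8) (by positivity),
    eventually_mul_add_le (c := |α|) (η := ε / 8) (by positivity), eventually_ge_atTop 2]
    with n hn hα hn2 r hr hr'
  have hpos : (0 : ℝ) < ((2 : ℝ) ^ n)⁻¹ := by positivity
  have hr0 : 0 < r := hpos.trans hr
  have hn2' : (2 : ℝ) ≤ n := by exact_mod_cast hn2
  obtain ⟨h1, h2⟩ := hn r (by rw [pow_succ, mul_inv]; linarith) hr'
  have h12 : ∀ y : ℝ, ((2 : ℝ≥0∞) ^ y).toReal = 2 ^ y := fun y => by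
    rw [← ENNReal.toReal_rpow]; simp
  have g1 := ENNReal.toReal_mono (measure_ne_top μ _) h1
  have g2 := ENNReal.toReal_mono (two_rpow_ne_top _) h2
  rw [h12] at g1 g2
  change _ ≤ μ.real (ball x r) at g1
  change μ.real (ball x r) ≤ _ at g2
  have hm0 : 0 < μ.real (ball x r) := lt_of_lt_of_le (by positivity) g1
  rw [← Real.le_logb_iff_rpow_le (by norm_num) hm0] at g1
  rw [← Real.logb_le_iff_le_rpow (by norm_num) hm0] at g2
  have l1 : -(n : ℝ) < Real.logb 2 r := by
    rw [Real.lt_logb_iff_rpow_lt (by norm_num) hr0, Real.rpow_neg (by norm_num), Real.rpow_natCast]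
    exact hr
  have l2 : Real.logb 2 r ≤ -(n : ℝ) + 1 := by
    rw [Real.logb_le_iff_le_rpow (by norm_num) hr0, Real.rpow_add (by norm_num),
      Real.rpow_neg (by norm_num), Real.rpow_natCast, Real.rpow_one, mul_comm]
    exact hr'
  have hlog : Real.log (μ.real (ball x r)) / Real.log r =
      Real.logb 2 (μ.real (ball x r)) / Real.logb 2 r := by
    have : Real.log 2 ≠ 0 := (Real.log_pos (by norm_num)).ne'
    rw [Real.logb, Real.logb, div_div_div_cancel_right₀ this]
  set M := Real.logb 2 (μ.real (ball x r)) with hM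
  set l := Real.logb 2 r with hl
  have hl0 : l < 0 := by linarith
  rw [hlog, Real.dist_eq]
  have : M / l - α = (M - α * l) / l := by
    rw [sub_div, mul_div_cancel_right₀ _ hl0.ne]
  rw [this, abs_div, div_lt_iff₀ (abs_pos.2 hl0.ne), abs_of_neg hl0]
  have k1 : |α * (n + l)| ≤ |α| := by
    rw [abs_mul]
    refine mul_le_of_le_one_right (abs_nonneg _) (abs_le.2 ⟨?_, ?_⟩) <;> linarith
  obtain ⟨k2, k3⟩ := abs_le.1 k1
  have k4 : |M - α * l| ≤ ε / 4 * n := by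
    rw [abs_le]
    constructor <;> linarith
  nlinarith

theorem mem_levelSet_of_ballEstimate {μ : Measure ℝ} [IsFiniteMeasure μ] {α : ℝ} {x : ℝ}
    (h : BallEstimate μ (fun n => -(n * α)) x) : x ∈ levelSet μ α := by
  have hlim := (continuous_coe_real_ereal.tendsto α).comp (tendsto_log_div_log h)
  exact ⟨mem_support_of_ballEstimate h, hlim.liminf_eq.ge, hlim.limsup_eq.le⟩

theorem eventually_of_mem_levelSet {μ : Measure ℝ} [IsFiniteMeasure μ] {α : ℝ} {x : ℝ}
    (h : x ∈ levelSet μ α) {ε : ℝ} (hε : 0 < ε) :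
    ∀ᶠ r in 𝓝[>] (0 : ℝ), ENNReal.ofReal r ^ (α + ε) ≤ μ (ball x r) ∧
      μ (ball x r) ≤ ENNReal.ofReal r ^ (α - ε) := by
  obtain ⟨hsupp, h1, h2⟩ := h
  have e1 := eventually_lt_of_lt_liminf (lt_of_lt_of_le
    (EReal.coe_lt_coe_iff.2 (show α - ε < α by linarith)) h1)
  have e2 := eventually_lt_of_limsup_lt (lt_of_le_of_lt h2
    (EReal.coe_lt_coe_iff.2 (show α < α + ε by linarith)))
  filter_upwards [e1, e2, Ioo_mem_nhdsGT (show (0 : ℝ) < 1 by norm_num)] with r g1 g2 hr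
  rw [EReal.coe_lt_coe_iff] at g1 g2
  have hm0 : 0 < μ.real (ball x r) :=
    ENNReal.toReal_pos ((nhds_basis_ball.mem_measureSupport.1 hsupp r hr.1).ne')
      (measure_ne_top μ _)
  have hlr : Real.log r < 0 := Real.log_neg hr.1 hr.2
  rw [lt_div_iff_of_neg hlr, ← Real.log_rpow hr.1,
    Real.log_lt_log_iff hm0 (Real.rpow_pos_of_pos hr.1 _)] at g1
  rw [div_lt_iff_of_neg hlr, ← Real.log_rpow hr.1,
    Real.log_lt_log_iff (Real.rpow_pos_of_pos hr.1 _) hm0] at g2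
  rw [ENNReal.ofReal_rpow_of_pos hr.1, ENNReal.ofReal_rpow_of_pos hr.1,
    ← ofReal_measureReal (μ := μ) (s := ball x r)]
  exact ⟨ENNReal.ofReal_le_ofReal g2.le, ENNReal.ofReal_le_ofReal g1.le⟩

/-- The points of `[0, 1]` at which the mass of the balls of radius less than `1 / (k + 1)` is
comparable to the power `α` of the radius, up to the exponent `ε`. -/
def levelPiece (μ : Measure ℝ) (α ε : ℝ) (k : ℕ) : Set ℝ :=
  {x ∈ Icc (0 : ℝ) 1 | ∀ r, 0 < r → r < 1 / ((k : ℝ) + 1) →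
    ENNReal.ofReal r ^ (α + ε) ≤ μ (ball x r) ∧ μ (ball x r) ≤ ENNReal.ofReal r ^ (α - ε)}

theorem levelSet_subset_iUnion_levelPiece (hp : p ∈ Ioo (0 : ℝ) 1) (hph : ph ∈ Ioo (0 : ℝ) 1)
    (α : ℝ) {ε : ℝ} (hε : 0 < ε) :
    levelSet (blockMeasure p ph t) α ⊆ ⋃ k, levelPiece (blockMeasure p ph t) α ε k := by
  have hprob := isProbabilityMeasure_blockMeasure_of_mem hp hph t
  intro x hx
  obtain ⟨k, hk⟩ := mem_iUnion.1 (subset_iUnion_uniform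
    (fun x hx => eventually_of_mem_levelSet hx hε) hx)
  exact mem_iUnion.2 ⟨k, support_blockMeasure_subset hp hph t hx.1, hk.2⟩

/-- The Chebyshev step: each ball contributes at least a known amount to the `q`-th moment, so the
number of balls is bounded by the partition function. -/
theorem one_le_measure_ball_rpow_mul {μ : Measure ℝ} {α ε : ℝ} (hε : 0 < ε) {k n : ℕ}
    (hn : 2 * ((2 : ℝ) ^ n)⁻¹ < 1 / ((k : ℝ) + 1)) {x r : ℝ} (hx : x ∈ levelPiece μ α ε k)
    (hr : ((2 : ℝ) ^ n)⁻¹ < r) (hr' : r ≤ 2 * ((2 : ℝ) ^ n)⁻¹) (q : ℝ) :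
    1 ≤ μ (ball x r) ^ q * 2 ^ (|q| * (2 * (|α| + ε)) + n * (α * q + ε * |q|)) := by
  have hpos : (0 : ℝ) < ((2 : ℝ) ^ n)⁻¹ := by positivity
  obtain ⟨h1, h2⟩ := hx.2 r (hpos.trans hr) (hr'.trans_lt hn)
  have hr2 : ((2 : ℝ) ^ (n + 1))⁻¹ ≤ r := by rw [pow_succ, mul_inv]; linarith
  have hr4 : r ≤ 4 * ((2 : ℝ) ^ n)⁻¹ := by linarith
  have a1 : |α + ε| ≤ |α| + ε := (abs_add_le _ _).trans (by rw [abs_of_pos hε])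
  have a2 : |α - ε| ≤ |α| + ε := (abs_sub _ _).trans (by rw [abs_of_pos hε])
  have g1 : (2 : ℝ≥0∞) ^ (-(n * α) - (n * ε + 2 * (|α| + ε))) ≤ μ (ball x r) :=
    le_trans (ENNReal.rpow_le_rpow_of_exponent_le (by norm_num) (by linarith))
      ((ofReal_rpow_mem hr2 hr4 (α + ε)).1.trans h1)
  have g2 : μ (ball x r) ≤ (2 : ℝ≥0∞) ^ (-(n * α) + (n * ε + 2 * (|α| + ε))) :=
    (h2.trans (ofReal_rpow_mem hr2 hr4 (α - ε)).2).trans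
      (ENNReal.rpow_le_rpow_of_exponent_le (by norm_num) (by linarith))
  refine le_trans (le_of_eq ?_) (mul_le_mul' (rpow_mem_of_mem g1 g2 q).1 le_rfl)
  rw [two_rpow_mul, ← ENNReal.rpow_zero (x := 2)]
  congr 1
  ring

/-- The number of balls of radius about `2⁻ⁿ` centred in distinct cells at points of a
`levelPiece`. -/
theorem tsum_one_le_of_mem_levelPiece (hp : p ∈ Ioo (0 : ℝ) 1) (hph : ph ∈ Ioo (0 : ℝ) 1)
    (q : ℝ) {α ε : ℝ} (hε : 0 < ε) {k n : ℕ} (hn : 2 * ((2 : ℝ) ^ n)⁻¹ < 1 / ((k : ℝ) + 1))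
    {ι : Type*} {x r : ι → ℝ} (hx : ∀ i, x i ∈ levelPiece (blockMeasure p ph t) α ε k)
    (hr : ∀ i, ((2 : ℝ) ^ n)⁻¹ < r i) (hr' : ∀ i, r i ≤ 2 * ((2 : ℝ) ^ n)⁻¹)
    (hinj : Function.Injective fun i => ⌊2 ^ n * x i⌋) :
    ∑' _i : ι, (1 : ℝ≥0∞) ≤ 5 ^ |q| * 5 * 2 ^ (|q| * (2 * (|α| + ε))) *
      2 ^ (blockSum (tau p q) (tau ph q) t n + n * (α * q + ε * |q|)) := by
  calc ∑' _i : ι, (1 : ℝ≥0∞)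
      ≤ ∑' i, blockMeasure p ph t (ball (x i) (r i)) ^ q *
          2 ^ (|q| * (2 * (|α| + ε)) + n * (α * q + ε * |q|)) :=
        ENNReal.tsum_le_tsum fun i => one_le_measure_ball_rpow_mul hε hn (hx i) (hr i) (hr' i) q
    _ ≤ 5 ^ |q| * 5 * 2 ^ blockSum (tau p q) (tau ph q) t n *
          2 ^ (|q| * (2 * (|α| + ε)) + n * (α * q + ε * |q|)) := by
        rw [ENNReal.tsum_mul_right]
        gcongr
        exact tsum_measure_ball_rpow_le hp hph t q (fun i => (hx i).1) hr hr' hinj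
    _ = _ := by
        rw [mul_assoc (5 ^ |q| * 5), two_rpow_mul, mul_assoc (5 ^ |q| * 5), two_rpow_mul]
        congr 2
        ring

theorem eventually_two_mul_two_pow_inv_lt {δ : ℝ} (hδ : 0 < δ) :
    ∀ᶠ n : ℕ in atTop, 2 * ((2 : ℝ) ^ n)⁻¹ < δ := by
  filter_upwards [(tendsto_two_pow_inv.mono_right nhdsWithin_le_nhds).eventually_lt_const
    (half_pos hδ)] with n hn
  linarith

theorem levelPiece_const_ne_top (q α ε : ℝ) :
    (5 : ℝ≥0∞) ^ |q| * 5 * 2 ^ (|q| * (2 * (|α| + ε))) ≠ ∞ :=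
  ENNReal.mul_ne_top (five_rpow_mul_ne_top q) (two_rpow_ne_top _)

/-- On each piece the number of balls at scale `n` has exponent at most the block sum plus `n (α q +
ε |q|)`, and the block sum is close to `n * min` at infinitely many scales. -/
theorem lowerDim_levelSet_le (hp : p ∈ Ioo (0 : ℝ) 1) (hph : ph ∈ Ioo (0 : ℝ) 1)
    (htmono : StrictMono t) (ht : Tendsto (fun n => (t (n + 1) : ℝ) / (t n : ℝ)) atTop atTop)
    (q α : ℝ) : lowerDim (levelSet (blockMeasure p ph t) α) ≤
      ENNReal.ofReal (α * q + min (tau p q) (tau ph q)) := by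
  refine iSup₂_le fun s hs => ?_
  by_contra! hlt
  have hlt' : α * q + min (tau p q) (tau ph q) < s := by
    rw [← ENNReal.ofReal_coe_nnreal] at hlt
    exact lt_of_not_ge fun h => hlt.not_ge (ENNReal.ofReal_le_ofReal h)
  set η : ℝ := (s - (α * q + min (tau p q) (tau ph q))) / 3 with hη
  have hη0 : 0 < η := by linarith
  have hq := abs_nonneg q
  set ε : ℝ := η / (1 + |q|) with hε
  have hε0 : 0 < ε := by positivity
  have hεq : ε * |q| ≤ η := by
    rw [hε, div_mul_eq_mul_div, div_le_iff₀ (by positivity)]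
    nlinarith
  have hzero : lowerMeasure (fun _ _ => 1) s (levelSet (blockMeasure p ph t) α) = 0 := by
    refine methodI_eq_zero _ (levelSet_subset_iUnion_levelPiece hp hph α hε0) fun k => ?_
    refine lowerPremeasure_eq_zero hη0 (levelPiece_const_ne_top q α ε)
      (D := fun n => blockSum (tau p q) (tau ph q) t n + n * (α * q + ε * |q|)) ?_ ?_
    · refine (frequently_blockSum_le_min (tau p q) (tau ph q) htmono ht hη0).mono fun n hn => ?_
      have h1 : (n : ℝ) * (ε * |q|) ≤ n * η := by gcongr
      have h2 : (s : ℝ) - η = min (tau p q) (tau ph q) + η + (α * q + η) := by rw [hη]; ring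
      rw [h2]
      linarith
    · intro F hF
      filter_upwards [eventually_two_mul_two_pow_inv_lt
        (show (0 : ℝ) < 1 / ((k : ℝ) + 1) by positivity)] with n hn
      have hpos : (0 : ℝ) < ((2 : ℝ) ^ n)⁻¹ := by positivity
      have hr : ((2 : ℝ) ^ n)⁻¹ < 2 * ((2 : ℝ) ^ n)⁻¹ := by linarith
      obtain ⟨s, hs, hinj⟩ := exists_isCenteredCover_injOn F hr
      refine iInf₂_le_of_le s hs ?_
      exact tsum_one_le_of_mem_levelPiece hp hph q hε0 hn (x := fun x : s => (x : ℝ))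
        (r := fun _ => 2 * ((2 : ℝ) ^ n)⁻¹) (fun x => hF (hs.1 x.2)) (fun _ => hr)
        (fun _ => le_rfl) (injOn_iff_injective.1 hinj)
  rw [hzero] at hs
  exact ENNReal.zero_ne_top hs

/-- A sum over balls of various radii, grouped by dyadic scales. -/
theorem packingPremeasureAt_le {E : Set ℝ} {s η : ℝ} {C : ℝ≥0∞} {D : ℕ → ℝ} {N : ℕ}
    (hD : ∀ n : ℕ, D n ≤ n * (s - η))
    (h : ∀ n ≥ N, ∀ S : Set (ℝ × ℝ), (∀ b ∈ S, b.1 ∈ E ∧ ((2 : ℝ) ^ n)⁻¹ < b.2 ∧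
      b.2 ≤ 2 * ((2 : ℝ) ^ n)⁻¹) → S.PairwiseDisjoint (fun b => ball b.1 b.2) →
      ∑' _b : S, (1 : ℝ≥0∞) ≤ C * 2 ^ D n) {δ : ℝ} (hδN : δ ≤ ((2 : ℝ) ^ N)⁻¹) :
    packingPremeasureAt δ s E ≤
      ∑' n : ℕ, if N ≤ n then C * 2 ^ (|s| * 2) * 2 ^ (-η * n) else 0 := by
  refine iSup₂_le fun S hS => ?_
  obtain ⟨hS1, hS2⟩ := hS
  have hN1 : ((2 : ℝ) ^ N)⁻¹ ≤ 1 := inv_le_one_of_one_le₀ (one_le_pow₀ (by norm_num))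
  have hscale : ∀ b : S, ∃ n : ℕ, ((2 : ℝ) ^ n)⁻¹ < b.1.2 ∧ b.1.2 ≤ 2 * ((2 : ℝ) ^ n)⁻¹ := by
    intro b
    obtain ⟨-, h1, h2⟩ := hS1 b b.2
    exact exists_dyadic_scale h1 (by linarith)
  choose m hm1 hm2 using hscale
  have hmN : ∀ b, N ≤ m b := by
    intro b
    have h1 := (hm1 b).trans_le ((hS1 b b.2).2.2.trans hδN)
    rw [inv_lt_inv₀ (by positivity) (by positivity)] at h1
    exact ((pow_lt_pow_iff_right₀ (by norm_num)).1 h1).le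
  calc ∑' b : S, ENNReal.ofReal (2 * b.1.2) ^ s
      ≤ ∑' b : S, ∑' n : ℕ, if m b = n then ENNReal.ofReal (2 * b.1.2) ^ s else 0 := by
        refine ENNReal.tsum_le_tsum fun b => ?_
        exact le_trans (le_of_eq (if_pos rfl).symm) (ENNReal.le_tsum (m b))
    _ = ∑' n : ℕ, ∑' b : S, if m b = n then ENNReal.ofReal (2 * b.1.2) ^ s else 0 :=
        ENNReal.tsum_comm
    _ ≤ _ := by
        refine ENNReal.tsum_le_tsum fun n => ?_
        split_ifs with hn
        · set T : Set (ℝ × ℝ) := {b | ∃ hb : b ∈ S, m ⟨b, hb⟩ = n} with hT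
          have hTS : T ⊆ S := fun b hb => hb.1
          have hT1 : ∀ b ∈ T, b.1 ∈ E ∧ ((2 : ℝ) ^ n)⁻¹ < b.2 ∧ b.2 ≤ 2 * ((2 : ℝ) ^ n)⁻¹ := by
            rintro b ⟨hb, rfl⟩
            exact ⟨(hS1 b hb).1, hm1 ⟨b, hb⟩, hm2 ⟨b, hb⟩⟩
          have hcount := h n hn T hT1 (hS2.subset hTS)
          have hpos : (0 : ℝ) < ((2 : ℝ) ^ n)⁻¹ := by positivity
          calc ∑' b : S, (if m b = n then ENNReal.ofReal (2 * b.1.2) ^ s else 0)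
              ≤ ∑' b : S, T.indicator (fun _ => (2 : ℝ≥0∞) ^ (s * (-n) + |s| * 2)) b := by
                refine ENNReal.tsum_le_tsum fun b => ?_
                split_ifs with hb
                · have hbT : (b : ℝ × ℝ) ∈ T := ⟨b.2, hb⟩
                  rw [indicator_of_mem hbT]
                  obtain ⟨-, h1, h2⟩ := hT1 b hbT
                  refine (ofReal_rpow_mem ?_ (by linarith) s).2
                  rw [pow_succ, mul_inv]
                  linarith
                · exact zero_le
            _ ≤ ∑' b : ℝ × ℝ, T.indicator (fun _ => (2 : ℝ≥0∞) ^ (s * (-n) + |s| * 2)) b :=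
                ENNReal.tsum_comp_le_tsum_of_injective Subtype.val_injective _
            _ = (∑' _b : T, (1 : ℝ≥0∞)) * 2 ^ (s * (-n) + |s| * 2) := by
                rw [← tsum_subtype, ← ENNReal.tsum_mul_right, one_mul]
            _ ≤ C * 2 ^ D n * 2 ^ (s * (-n) + |s| * 2) := mul_le_mul' hcount le_rfl
            _ ≤ _ := by
                rw [mul_assoc, mul_assoc, two_rpow_mul, two_rpow_mul]
                refine mul_le_mul' le_rfl
                  (ENNReal.rpow_le_rpow_of_exponent_le (by norm_num) ?_)
                linarith [hD n]
        · refine le_of_eq (ENNReal.tsum_eq_zero.2 fun b => if_neg fun hb => hn ?_)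
          rw [← hb]
          exact hmN b

/-- A packing with small balls uses many scales at once; the contributions of the scales `n ≥ M` are
dominated by the tail of a geometric series of ratio `2 ^ (-η)`. -/
theorem packingPremeasure_eq_zero {E : Set ℝ} {s η : ℝ} (hη : 0 < η) {C : ℝ≥0∞} (hC : C ≠ ∞)
    {D : ℕ → ℝ} (hD : ∀ n : ℕ, D n ≤ n * (s - η))
    (h : ∀ᶠ n : ℕ in atTop, ∀ S : Set (ℝ × ℝ), (∀ b ∈ S, b.1 ∈ E ∧ ((2 : ℝ) ^ n)⁻¹ < b.2 ∧
      b.2 ≤ 2 * ((2 : ℝ) ^ n)⁻¹) → S.PairwiseDisjoint (fun b => ball b.1 b.2) →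
      ∑' _b : S, (1 : ℝ≥0∞) ≤ C * 2 ^ D n) :
    packingPremeasure s E = 0 := by
  obtain ⟨N, hN⟩ := eventually_atTop.1 h
  set C' : ℝ≥0∞ := C * 2 ^ (|s| * 2) with hC'
  have hC'top : C' ≠ ∞ := ENNReal.mul_ne_top hC (two_rpow_ne_top _)
  have hsum : ∑' n : ℕ, C' * (2 : ℝ≥0∞) ^ (-η * n) ≠ ∞ := by
    rw [ENNReal.tsum_mul_left]
    refine ENNReal.mul_ne_top hC'top ?_
    have h1 : (2 : ℝ≥0∞) ^ (-η) < 1 :=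
      ENNReal.rpow_lt_one_of_one_lt_of_neg (by norm_num) (by linarith)
    have h2 : ∀ n : ℕ, (2 : ℝ≥0∞) ^ (-η * n) = ((2 : ℝ≥0∞) ^ (-η)) ^ n := fun n => by
      rw [ENNReal.rpow_mul, ENNReal.rpow_natCast]
    simp_rw [h2]
    rw [ENNReal.tsum_geometric]
    exact ENNReal.inv_ne_top.2 (tsub_pos_of_lt h1).ne'
  have htail : Tendsto (fun M : ℕ => ∑' n : ℕ, C' * (2 : ℝ≥0∞) ^ (-η * ((n + M : ℕ) : ℝ)))
      atTop (𝓝 0) := ENNReal.tendsto_sum_nat_add (fun n : ℕ => C' * (2 : ℝ≥0∞) ^ (-η * n)) hsum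
  have hle : ∀ M ≥ N, packingPremeasure s E ≤
      ∑' n : ℕ, C' * (2 : ℝ≥0∞) ^ (-η * ((n + M : ℕ) : ℝ)) := by
    intro M hM
    have h1 : packingPremeasure s E ≤ packingPremeasureAt ((2 : ℝ) ^ M)⁻¹ s E :=
      iInf₂_le _ (by positivity)
    refine h1.trans ((packingPremeasureAt_le hD (fun n hn => hN n (hM.trans hn)) le_rfl).trans
      (le_of_eq ?_))
    have hsplit := Summable.sum_add_tsum_nat_add' (k := M)
      (f := fun n : ℕ => if M ≤ n then C' * (2 : ℝ≥0∞) ^ (-η * n) else 0) ENNReal.summable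
    rw [← hsplit, Finset.sum_eq_zero, zero_add]
    · refine tsum_congr fun n => ?_
      rw [if_pos (Nat.le_add_left M n)]
    · intro n hn
      rw [Finset.mem_range] at hn
      rw [if_neg (by omega)]
  have hev : ∀ᶠ M : ℕ in atTop, packingPremeasure s E ≤
      ∑' n : ℕ, C' * (2 : ℝ≥0∞) ^ (-η * ((n + M : ℕ) : ℝ)) := eventually_atTop.2 ⟨N, hle⟩
  have hlim : packingPremeasure s E ≤ 0 := ge_of_tendsto htail hev
  exact le_antisymm hlim zero_le

/-- Packings mix scales, so the ball count must be controlled at every scale, and there only `n *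
max` bounds the block sum. -/
theorem packingDim_levelSet_le (hp : p ∈ Ioo (0 : ℝ) 1) (hph : ph ∈ Ioo (0 : ℝ) 1) (q α : ℝ) :
    packingDim (levelSet (blockMeasure p ph t) α) ≤
      ENNReal.ofReal (α * q + max (tau p q) (tau ph q)) := by
  refine iSup₂_le fun s hs => ?_
  by_contra! hlt
  have hlt' : α * q + max (tau p q) (tau ph q) < s := by
    rw [← ENNReal.ofReal_coe_nnreal] at hlt
    exact lt_of_not_ge fun h => hlt.not_ge (ENNReal.ofReal_le_ofReal h)
  set η : ℝ := (s - (α * q + max (tau p q) (tau ph q))) / 2 with hη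
  have hη0 : 0 < η := by linarith
  have hq := abs_nonneg q
  set ε : ℝ := η / (1 + |q|) with hε
  have hε0 : 0 < ε := by positivity
  have hεq : ε * |q| ≤ η := by
    rw [hε, div_mul_eq_mul_div, div_le_iff₀ (by positivity)]
    nlinarith
  have hzero : methodI (packingPremeasure s) (levelSet (blockMeasure p ph t) α) = 0 := by
    refine methodI_eq_zero _ (levelSet_subset_iUnion_levelPiece hp hph α hε0) fun k => ?_
    refine packingPremeasure_eq_zero hη0 (levelPiece_const_ne_top q α ε)
      (D := fun n => blockSum (tau p q) (tau ph q) t n + n * (α * q + ε * |q|)) ?_ ?_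
    · intro n
      have h1 : (n : ℝ) * (ε * |q|) ≤ n * η := by gcongr
      have h2 : (s : ℝ) - η = max (tau p q) (tau ph q) + (α * q + η) := by rw [hη]; ring
      have h3 := blockSum_le (tau p q) (tau ph q) t n
      rw [h2]
      linarith
    · filter_upwards [eventually_two_mul_two_pow_inv_lt
        (show (0 : ℝ) < 1 / ((k : ℝ) + 1) by positivity)] with n hn S hS1 hS2
      refine tsum_one_le_of_mem_levelPiece hp hph q hε0 hn (x := fun b : S => b.1.1)
        (r := fun b : S => b.1.2) (fun b => (hS1 b b.2).1) (fun b => (hS1 b b.2).2.1)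
        (fun b => (hS1 b b.2).2.2) fun b b' hbb => ?_
      by_contra hne
      have hd := hS2 b.2 b'.2 (fun h => hne (Subtype.ext h))
      have hpos : (0 : ℝ) < ((2 : ℝ) ^ n)⁻¹ := by positivity
      refine disjoint_left.1 hd (mem_ball_self (hpos.trans (hS1 b b.2).2.1)) (mem_ball.2 ?_)
      exact (dist_lt_of_floor_eq hbb).trans (hS1 b' b'.2).2.1
  rw [hzero] at hs
  exact ENNReal.zero_ne_top hs

/-- The points typical for the block measure with digit weights `a`, `c` chosen such that the local
dimension of `blockMeasure p ph t` is `α`. -/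
theorem exists_typical_subset_levelSet {a c : ℝ} (ha : a ∈ Ioo (0 : ℝ) 1) (hc : c ∈ Ioo (0 : ℝ) 1)
    (hp : p ∈ Ioo (0 : ℝ) 1) (hph : ph ∈ Ioo (0 : ℝ) 1) {α : ℝ} (h1 : crossLog a p = -α)
    (h2 : crossLog c ph = -α) :
    ∃ E ⊆ levelSet (blockMeasure p ph t) α, blockMeasure a c t E ≠ 0 ∧
      ∀ x ∈ E, BallEstimate (blockMeasure a c t) (blockSum (crossLog a a) (crossLog c c) t) x := by
  have hprob := isProbabilityMeasure_blockMeasure_of_mem hp hph t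
  refine ⟨{x | BallEstimate (blockMeasure p ph t) (fun n => -(n * α)) x ∧
    BallEstimate (blockMeasure a c t) (blockSum (crossLog a a) (crossLog c c) t) x},
    fun x hx => mem_levelSet_of_ballEstimate hx.1, ?_, fun x hx => hx.2⟩
  refine (lt_of_lt_of_le zero_lt_one (one_le_blockMeasure_of_ae ha hc t ?_)).ne'
  filter_upwards [ae_ball_estimate ha hc hp hph t, ae_ball_estimate ha hc ha hc t] with d g1 g2
  refine ⟨?_, g2⟩
  have : blockSum (crossLog a p) (crossLog c ph) t = fun n : ℕ => -((n : ℝ) * α) := by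
    funext n
    rw [h1, h2, blockSum_self]
    ring
  rwa [this] at g1

/-- The auxiliary measure has ball exponents between the two entropies, so its lower local dimension
is at least the smaller one. -/
theorem le_dimH_levelSet {a c : ℝ} (ha : a ∈ Ioo (0 : ℝ) 1) (hc : c ∈ Ioo (0 : ℝ) 1)
    (hp : p ∈ Ioo (0 : ℝ) 1) (hph : ph ∈ Ioo (0 : ℝ) 1) {α : ℝ} (h1 : crossLog a p = -α)
    (h2 : crossLog c ph = -α) :
    ENNReal.ofReal (min (-crossLog a a) (-crossLog c c)) ≤
      dimH (levelSet (blockMeasure p ph t) α) := by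
  obtain ⟨E, hE, hE0, hEx⟩ := exists_typical_subset_levelSet (t := t) ha hc hp hph h1 h2
  refine ENNReal.le_of_forall_nnreal_lt fun s hs => (?_ : (s : ℝ≥0∞) ≤ dimH E).trans (dimH_mono hE)
  have hs' : (s : ℝ) < min (-crossLog a a) (-crossLog c c) := by
    rw [← ENNReal.ofReal_coe_nnreal] at hs
    exact (ENNReal.ofReal_lt_ofReal_iff_of_nonneg s.coe_nonneg).1 hs
  rw [min_neg_neg] at hs'
  refine le_dimH_of_measure_ball_le hE0 s fun x hx => eventually_of_dyadic_scale ?_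
  set η := -max (crossLog a a) (crossLog c c) - s with hη
  -- With `q = 0` the weight is `1`, and the comparison is with a power of the radius alone.
  filter_upwards [eventually_measure_ball_le (hEx x hx) (hEx x hx) (q := 0) (s := s) (η := η)
    (by linarith)] with n hn r hr hr'
  have hpos : (0 : ℝ) < ((2 : ℝ) ^ n)⁻¹ := by positivity
  have hr2 : ((2 : ℝ) ^ (n + 1))⁻¹ ≤ r := by rw [pow_succ, mul_inv]; linarith
  have := hn ?_ r hr2 hr' r hr2 hr'
  · simpa [ballPow] using this
  · have := blockSum_le (crossLog a a) (crossLog c c) t n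
    have hms : (s : ℝ) + η = -max (crossLog a a) (crossLog c c) := by rw [hη]; ring
    rw [hms]
    linarith

/-- Infinitely many scales suffice here, and at the ends of suitable blocks the ball exponent is
close to the larger entropy. -/
theorem le_upperDim_levelSet {a c : ℝ} (ha : a ∈ Ioo (0 : ℝ) 1) (hc : c ∈ Ioo (0 : ℝ) 1)
    (hp : p ∈ Ioo (0 : ℝ) 1) (hph : ph ∈ Ioo (0 : ℝ) 1) (htmono : StrictMono t)
    (ht : Tendsto (fun n => (t (n + 1) : ℝ) / (t n : ℝ)) atTop atTop) {α : ℝ}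
    (h1 : crossLog a p = -α) (h2 : crossLog c ph = -α) :
    ENNReal.ofReal (max (-crossLog a a) (-crossLog c c)) ≤
      upperDim (levelSet (blockMeasure p ph t) α) := by
  obtain ⟨E, hE, hE0, hEx⟩ := exists_typical_subset_levelSet (t := t) ha hc hp hph h1 h2
  refine ENNReal.le_of_forall_nnreal_lt fun s hs => le_iSup₂_of_le s ?_ le_rfl
  have hs' : (s : ℝ) < max (-crossLog a a) (-crossLog c c) := by
    rw [← ENNReal.ofReal_coe_nnreal] at hs
    exact (ENNReal.ofReal_lt_ofReal_iff_of_nonneg s.coe_nonneg).1 hs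
  rw [max_neg_neg] at hs'
  set m := min (crossLog a a) (crossLog c c) with hm
  set η := (-m - s) / 3 with hη
  have hη0 : 0 < η := by linarith
  refine eq_top_mono (methodI_mono_set _ hE) (upperMeasure_eq_top (t := s) (t' := s + η)
    (by linarith) hE0 (frequently_blockSum_le_min (crossLog a a) (crossLog c c) htmono ht hη0) ?_)
  intro x hx
  filter_upwards [eventually_measure_ball_le (hEx x hx) (hEx x hx) (q := 0) (s := s + η) (η := η)
    hη0] with n hn hgood
  have hpos : (0 : ℝ) < ((2 : ℝ) ^ n)⁻¹ := by positivity
  have hr2 : ((2 : ℝ) ^ (n + 1))⁻¹ ≤ ((2 : ℝ) ^ n)⁻¹ := by rw [pow_succ, mul_inv]; linarith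
  have := hn ?_ _ (by linarith) le_rfl _ hr2 (by linarith)
  · simpa [ballPow] using this
  · have hms : (s : ℝ) + η + η = -m - η := by rw [hη]; ring
    rw [hms]
    linarith

end LevelSets

/-! ### The functions `tau` and their comparison -/

section PressureFunction

variable {p ph : ℝ}

theorem hasDerivAt_tau (hp : p ∈ Ioo (0 : ℝ) 1) (q : ℝ) :
    HasDerivAt (tau p) (crossLog (gibbs p q) p) q := by
  have h0 : 0 < 1 - p := by linarith [hp.2]
  have h3 : 0 < p ^ q := Real.rpow_pos_of_pos hp.1 q
  have h4 : 0 < (1 - p) ^ q := Real.rpow_pos_of_pos h0 q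
  have hZ : p ^ q + (1 - p) ^ q ≠ 0 := by positivity
  have h1 := (Real.hasStrictDerivAt_const_rpow hp.1 q).hasDerivAt.add
    (Real.hasStrictDerivAt_const_rpow h0 q).hasDerivAt
  have h2 := (h1.log hZ).div_const (Real.log 2)
  refine h2.congr_deriv ?_
  have hl : Real.log 2 ≠ 0 := (Real.log_pos (by norm_num)).ne'
  have : 1 - gibbs p q = (1 - p) ^ q / (p ^ q + (1 - p) ^ q) := by
    rw [gibbs]; field_simp; ring
  rw [crossLog, this, gibbs, Real.logb, Real.logb]
  simp only [Pi.add_apply]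
  field_simp

theorem gibbs_eq_inv (hp : p ∈ Ioo (0 : ℝ) 1) (q : ℝ) :
    gibbs p q = (1 + ((1 - p) / p) ^ q)⁻¹ := by
  have h0 : 0 < 1 - p := by linarith [hp.2]
  have h3 : 0 < p ^ q := Real.rpow_pos_of_pos hp.1 q
  rw [gibbs, Real.div_rpow h0.le hp.1.le]
  field_simp

theorem one_lt_odds (hp : 0 < p) (hp2 : p < 1 / 2) : 1 < (1 - p) / p := by
  rw [lt_div_iff₀ hp]; linarith

theorem gibbs_strictAnti (hp : 0 < p) (hp2 : p < 1 / 2) : StrictAnti (gibbs p) := by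
  intro x y hxy
  have hb := one_lt_odds hp hp2
  have hp' : p ∈ Ioo (0 : ℝ) 1 := ⟨hp, by linarith⟩
  rw [gibbs_eq_inv hp', gibbs_eq_inv hp']
  have h1 : 0 < ((1 - p) / p) ^ x := Real.rpow_pos_of_pos (by linarith) _
  have h2 := Real.rpow_lt_rpow_of_exponent_lt hb hxy
  exact inv_strictAnti₀ (by linarith) (by linarith)

theorem crossLog_eq (w p : ℝ) :
    crossLog w p = Real.logb 2 (1 - p) + w * (Real.logb 2 p - Real.logb 2 (1 - p)) := by
  unfold crossLog; ring

theorem crossLog_gibbs_strictMono (hp : 0 < p) (hp2 : p < 1 / 2) :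
    StrictMono fun q => crossLog (gibbs p q) p := by
  intro x y hxy
  have h1 := gibbs_strictAnti hp hp2 hxy
  have h2 : Real.logb 2 p < Real.logb 2 (1 - p) :=
    Real.logb_lt_logb (by norm_num) hp (by linarith)
  simp only [crossLog_eq]
  nlinarith

theorem tendsto_gibbs_atTop (hp : 0 < p) (hp2 : p < 1 / 2) :
    Tendsto (gibbs p) atTop (𝓝 0) := by
  have h := tendsto_rpow_atTop_of_base_gt_one _ (one_lt_odds hp hp2)
  have := (tendsto_atTop_add_const_left atTop 1 h).inv_tendsto_atTop
  exact this.congr fun q => (gibbs_eq_inv ⟨hp, by linarith⟩ q).symm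

theorem tendsto_gibbs_atBot (hp : 0 < p) (hp2 : p < 1 / 2) :
    Tendsto (gibbs p) atBot (𝓝 1) := by
  have h := tendsto_rpow_atBot_of_base_gt_one _ (one_lt_odds hp hp2)
  have := (h.const_add 1).inv₀ (by norm_num)
  simp only [add_zero, inv_one] at this
  exact this.congr fun q => (gibbs_eq_inv ⟨hp, by linarith⟩ q).symm

theorem tendsto_crossLog_gibbs_atTop (hp : 0 < p) (hp2 : p ≤ 1 / 2) :
    Tendsto (fun q => crossLog (gibbs p q) p) atTop (𝓝 (Real.logb 2 (1 - p))) := by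
  simp only [crossLog_eq]
  rcases hp2.lt_or_eq with h | h
  · simpa using ((tendsto_gibbs_atTop hp h).mul_const
      (Real.logb 2 p - Real.logb 2 (1 - p))).const_add (Real.logb 2 (1 - p))
  · have : 1 - p = p := by linarith
    simp [this]

theorem tendsto_crossLog_gibbs_atBot (hp : 0 < p) (hp2 : p ≤ 1 / 2) :
    Tendsto (fun q => crossLog (gibbs p q) p) atBot (𝓝 (Real.logb 2 p)) := by
  simp only [crossLog_eq]
  rcases hp2.lt_or_eq with h | h
  · simpa using ((tendsto_gibbs_atBot hp h).mul_const
      (Real.logb 2 p - Real.logb 2 (1 - p))).const_add (Real.logb 2 (1 - p))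
  · have : 1 - p = p := by linarith
    simp [this]

theorem continuous_gibbs (hp : p ∈ Ioo (0 : ℝ) 1) : Continuous (gibbs p) := by
  have h0 : 0 < 1 - p := by linarith [hp.2]
  have h1 : Continuous fun q : ℝ => p ^ q := Real.continuous_const_rpow hp.1.ne'
  have h2 : Continuous fun q : ℝ => (1 - p) ^ q := Real.continuous_const_rpow h0.ne'
  refine h1.div (h1.add h2) fun q => ?_
  have h3 : 0 < p ^ q := Real.rpow_pos_of_pos hp.1 q
  have h4 : 0 < (1 - p) ^ q := Real.rpow_pos_of_pos h0 q
  positivity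

theorem exists_crossLog_gibbs_eq (hp : 0 < p) (hp2 : p ≤ 1 / 2) {y : ℝ}
    (h1 : Real.logb 2 p < y) (h2 : y < Real.logb 2 (1 - p)) : ∃ q, crossLog (gibbs p q) p = y := by
  have hcont : Continuous fun q => crossLog (gibbs p q) p := by
    have := continuous_gibbs (p := p) ⟨hp, by linarith⟩
    unfold crossLog
    fun_prop
  obtain ⟨a, ha⟩ := ((tendsto_crossLog_gibbs_atBot hp hp2).eventually_lt_const h1).exists
  obtain ⟨b, hb⟩ := ((tendsto_crossLog_gibbs_atTop hp hp2).eventually_const_lt h2).exists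
  exact mem_range_of_exists_le_of_exists_ge hcont ⟨a, ha.le⟩ ⟨b, hb.le⟩

/-- Each of the two terms in the sum defining `tau p q` bounds it from below; averaging the bounds
with weights `w`, `1 - w` gives `tau p q ≥ q * crossLog w p`. -/
theorem mul_add_tau_nonneg (hp : p ∈ Ioo (0 : ℝ) 1) {w α : ℝ} (hw : w ∈ Ioo (0 : ℝ) 1)
    (h : crossLog w p = -α) (q : ℝ) : 0 ≤ α * q + tau p q := by
  have h0 : 0 < 1 - p := by linarith [hp.2]
  have h3 : 0 < p ^ q := Real.rpow_pos_of_pos hp.1 q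
  have h4 : 0 < (1 - p) ^ q := Real.rpow_pos_of_pos h0 q
  have h5 : q * Real.logb 2 p ≤ tau p q := by
    rw [← Real.logb_rpow_eq_mul_logb_of_pos hp.1]
    exact Real.logb_le_logb_of_le (by norm_num) h3 (by linarith)
  have h6 : q * Real.logb 2 (1 - p) ≤ tau p q := by
    rw [← Real.logb_rpow_eq_mul_logb_of_pos h0]
    exact Real.logb_le_logb_of_le (by norm_num) h4 (by linarith)
  have h7 := mul_le_mul_of_nonneg_left h5 hw.1.le
  have h8 := mul_le_mul_of_nonneg_left h6 (by linarith [hw.2] : 0 ≤ 1 - w)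
  have : α = -crossLog w p := by linarith
  rw [this, crossLog]
  linarith

/-- Convexity of the power for nonpositive exponents: the weighted mean inequality is used once for
`x`, `y` and once for their powers, with the geometric mean in between. -/
theorem rpow_weighted_le_of_nonpos {q : ℝ} (hq : q ≤ 0) {x y a b : ℝ} (hx : 0 < x) (hy : 0 < y)
    (ha : 0 ≤ a) (hb : 0 ≤ b) (hab : a + b = 1) :
    (a * x + b * y) ^ q ≤ a * x ^ q + b * y ^ q := by
  have h1 := Real.geom_mean_le_arith_mean2_weighted ha hb hx.le hy.le hab
  have h2 := Real.geom_mean_le_arith_mean2_weighted ha hb (Real.rpow_nonneg hx.le q)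
    (Real.rpow_nonneg hy.le q) hab
  have h3 : 0 < x ^ a * y ^ b := mul_pos (Real.rpow_pos_of_pos hx _) (Real.rpow_pos_of_pos hy _)
  refine (Real.rpow_le_rpow_of_nonpos h3 h1 hq).trans (le_trans (le_of_eq ?_) h2)
  rw [Real.mul_rpow (by positivity) (by positivity), ← Real.rpow_mul hx.le, ← Real.rpow_mul hy.le,
    ← Real.rpow_mul hx.le, ← Real.rpow_mul hy.le, mul_comm a, mul_comm b]

/-- The pair `(ph, 1 - ph)` is a mixture of `(p, 1 - p)` and its swap, so concavity or convexity of
the power decides which of `tau p`, `tau ph` is larger. -/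
theorem exists_convex_weights (hpph : p < ph) (hph : ph ≤ 1 / 2) :
    ∃ a b : ℝ, 0 ≤ a ∧ 0 ≤ b ∧ a + b = 1 ∧ a * p + b * (1 - p) = ph ∧
      b * p + a * (1 - p) = 1 - ph := by
  have h : (0 : ℝ) < 1 - 2 * p := by linarith
  have hu : (1 - 2 * p) * (1 - 2 * p)⁻¹ = 1 := mul_inv_cancel₀ h.ne'
  have hu0 := inv_nonneg.2 h.le
  refine ⟨(1 - p - ph) * (1 - 2 * p)⁻¹, (ph - p) * (1 - 2 * p)⁻¹,
    mul_nonneg (by linarith) hu0, mul_nonneg (by linarith) hu0, ?_, ?_, ?_⟩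
  · linear_combination hu
  · linear_combination ph * hu
  · linear_combination (1 - ph) * hu

theorem tau_le_tau_of_mem (hp : 0 < p) (hpph : p < ph) (hph : ph ≤ 1 / 2) {q : ℝ}
    (hq : q ∈ Icc (0 : ℝ) 1) : tau p q ≤ tau ph q := by
  obtain ⟨a, b, ha, hb, hab, h1, h2⟩ := exists_convex_weights hpph hph
  have hc := (Real.concaveOn_rpow hq.1 hq.2).2
  have hp1 : (0 : ℝ) ≤ 1 - p := by linarith
  have g1 := hc (mem_Ici.2 hp.le) (mem_Ici.2 hp1) ha hb hab
  have g2 := hc (mem_Ici.2 hp.le) (mem_Ici.2 hp1) hb ha (by linarith)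
  simp only [smul_eq_mul] at g1 g2
  rw [h1] at g1
  rw [h2] at g2
  have h3 : 0 < p ^ q := Real.rpow_pos_of_pos hp q
  have h4 : 0 < (1 - p) ^ q := Real.rpow_pos_of_pos (by linarith) q
  refine Real.logb_le_logb_of_le (by norm_num) (by positivity) ?_
  have hb' : b = 1 - a := by linarith
  subst hb'
  linarith

theorem tau_le_tau_of_le_or_le (hp : 0 < p) (hpph : p < ph) (hph : ph ≤ 1 / 2) {q : ℝ}
    (hq : q ≤ 0 ∨ 1 ≤ q) : tau ph q ≤ tau p q := by
  obtain ⟨a, b, ha, hb, hab, h1, h2⟩ := exists_convex_weights hpph hph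
  have hp1 : 0 < 1 - p := by linarith
  have hc : ∀ a b : ℝ, 0 ≤ a → 0 ≤ b → a + b = 1 →
      (a * p + b * (1 - p)) ^ q ≤ a * p ^ q + b * (1 - p) ^ q := by
    intro a b ha hb hab
    rcases hq with hq | hq
    · exact rpow_weighted_le_of_nonpos hq hp hp1 ha hb hab
    · exact (convexOn_rpow hq).2 (mem_Ici.2 hp.le) (mem_Ici.2 hp1.le) ha hb hab
  have g1 := hc a b ha hb hab
  have g2 := hc b a hb ha (by linarith)
  rw [h1] at g1
  rw [h2] at g2
  have h3 : 0 < ph ^ q := Real.rpow_pos_of_pos (by linarith) q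
  have h4 : 0 < (1 - ph) ^ q := Real.rpow_pos_of_pos (by linarith) q
  refine Real.logb_le_logb_of_le (by norm_num) (by positivity) ?_
  have hb' : b = 1 - a := by linarith
  subst hb'
  linarith

end PressureFunction

/-! ### Matching the bounds with the Legendre transform -/

section LegendreTransform

/-- A lower bound `m` that is not exceeded by every upper bound collapses the chain. Nonnegativity
of `α q + f q` ensures that `ENNReal.ofReal` truncates nothing. -/
theorem eq_legendre_of_le {X Y : ℝ≥0∞} {m α : ℝ} {f : ℝ → ℝ} {χ : ℝ → EReal}
    (hχ : ∀ q, χ q = (f q : EReal)) (hX : ENNReal.ofReal m ≤ X) (hXY : X ≤ Y)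
    (hY : ∀ q, Y ≤ ENNReal.ofReal (α * q + f q)) (h0 : ∀ q, 0 ≤ α * q + f q)
    (hq : ∃ q, α * q + f q ≤ m) : X = Y ∧ (Y : EReal) = legendre χ α := by
  obtain ⟨q, hq⟩ := hq
  have hYm : Y ≤ ENNReal.ofReal m := (hY q).trans (ENNReal.ofReal_le_ofReal hq)
  refine ⟨le_antisymm hXY (hYm.trans hX), le_antisymm (le_iInf fun y => ?_) (iInf_le_of_le q ?_)⟩
  · rw [hχ, ← EReal.coe_add, ← max_eq_left (h0 y), ← EReal.coe_ennreal_ofReal]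
    exact EReal.coe_ennreal_le_coe_ennreal_iff.2 (hY y)
  · have hm : 0 ≤ m := (h0 q).trans hq
    rw [hχ, ← EReal.coe_add]
    refine (EReal.coe_le_coe_iff.2 hq).trans ?_
    rw [← max_eq_left hm, ← EReal.coe_ennreal_ofReal]
    exact EReal.coe_ennreal_le_coe_ennreal_iff.2 (hX.trans hXY)

end LegendreTransform

section OneSidedDerivatives

theorem hasDerivWithinAt_Ici_of_eqOn {f g : ℝ → ℝ} {g' a b : ℝ} (hg : HasDerivAt g g' a)
    (hab : a < b) (h : EqOn f g (Ico a b)) : HasDerivWithinAt f g' (Ici a) a := by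
  refine hg.hasDerivWithinAt.congr_of_eventuallyEq ?_ (h (left_mem_Ico.2 hab))
  filter_upwards [Ico_mem_nhdsGE hab] with x hx using h hx

theorem hasDerivWithinAt_Iic_of_eqOn {f g : ℝ → ℝ} {g' a b : ℝ} (hg : HasDerivAt g g' a)
    (hab : b < a) (h : EqOn f g (Ioc b a)) : HasDerivWithinAt f g' (Iic a) a := by
  refine hg.hasDerivWithinAt.congr_of_eventuallyEq ?_ (h (right_mem_Ioc.2 hab))
  filter_upwards [Ioc_mem_nhdsLE hab] with x hx using h hx

end OneSidedDerivatives

end HewittStromberg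

end

/-! ### The multifractal formalism for block measures -/

theorem theorem4p4 (p ph : ℝ) (hp : 0 < p) (hpph : p < ph) (hph : ph ≤ 1 / 2)
    (t : ℕ → ℕ) (ht0 : t 0 = 1) (htmono : StrictMono t)
    (ht : Tendsto (fun n => (t (n + 1) : ℝ) / (t n : ℝ)) atTop atTop)
    (μ : Measure ℝ) (hμ : μ = HewittStromberg.blockMeasure p ph t) :
    ∃ (b B : ℝ → ℝ) (tauPos tauNeg : ℝ),
      -- the separator functions are finite
      (∀ q : ℝ, HewittStromberg.bSep μ q = (b q : EReal)) ∧
      (∀ q : ℝ, HewittStromberg.BSep μ q = (B q : EReal)) ∧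
      -- their one-sided derivatives at `0` and `1` exist
      (∀ q : ℝ, q = 0 ∨ q = 1 →
        DifferentiableWithinAt ℝ b (Ici q) q ∧ DifferentiableWithinAt ℝ b (Iic q) q ∧
        DifferentiableWithinAt ℝ B (Ici q) q ∧ DifferentiableWithinAt ℝ B (Iic q) q) ∧
      -- the limits of the derivative of `tau ph` at `+∞` and `-∞`
      Tendsto (deriv (HewittStromberg.tau ph)) atTop (𝓝 tauPos) ∧
      Tendsto (deriv (HewittStromberg.tau ph)) atBot (𝓝 tauNeg) ∧
      ∀ α ∈ Ioo (-tauPos) (-tauNeg),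
        (α ∉ Icc (-derivWithin b (Ici 0) 0) (-derivWithin b (Iic 0) 0) ∪
              Icc (-derivWithin b (Ici 1) 1) (-derivWithin b (Iic 1) 1) →
          dimH (HewittStromberg.levelSet μ α) =
              HewittStromberg.lowerDim (HewittStromberg.levelSet μ α) ∧
            (HewittStromberg.lowerDim (HewittStromberg.levelSet μ α) : EReal) =
              HewittStromberg.legendre (HewittStromberg.bSep μ) α) ∧
        (α ∉ Icc (-derivWithin B (Ici 0) 0) (-derivWithin B (Iic 0) 0) ∪
              Icc (-derivWithin B (Ici 1) 1) (-derivWithin B (Iic 1) 1) →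
          HewittStromberg.packingDim (HewittStromberg.levelSet μ α) =
              HewittStromberg.upperDim (HewittStromberg.levelSet μ α) ∧
            (HewittStromberg.upperDim (HewittStromberg.levelSet μ α) : EReal) =
              HewittStromberg.legendre (HewittStromberg.BSep μ) α) := by
  open HewittStromberg in
  subst hμ
  have hpI : p ∈ Ioo (0 : ℝ) 1 := ⟨hp, by linarith⟩
  have hphI : ph ∈ Ioo (0 : ℝ) 1 := ⟨by linarith, by linarith⟩
  have hin : ∀ q ∈ Icc (0 : ℝ) 1, tau p q ≤ tau ph q :=
    fun q hq => tau_le_tau_of_mem hp hpph hph hq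
  have hout : ∀ q : ℝ, q ≤ 0 ∨ 1 ≤ q → tau ph q ≤ tau p q :=
    fun q hq => tau_le_tau_of_le_or_le hp hpph hph hq
  set b : ℝ → ℝ := fun q => min (tau p q) (tau ph q) with hb
  set B : ℝ → ℝ := fun q => max (tau p q) (tau ph q) with hB
  -- On each side of `0` and of `1` one of the two smooth functions realises the minimum, and the
  -- other one the maximum; the roles switch at both points.
  have hb0r : HasDerivWithinAt b (crossLog (gibbs p 0) p) (Ici 0) 0 :=
    hasDerivWithinAt_Ici_of_eqOn (hasDerivAt_tau hpI 0) one_pos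
      fun q hq => min_eq_left (hin q ⟨hq.1, hq.2.le⟩)
  have hb0l : HasDerivWithinAt b (crossLog (gibbs ph 0) ph) (Iic 0) 0 :=
    hasDerivWithinAt_Iic_of_eqOn (hasDerivAt_tau hphI 0) neg_one_lt_zero
      fun q hq => min_eq_right (hout q (Or.inl hq.2))
  have hb1r : HasDerivWithinAt b (crossLog (gibbs ph 1) ph) (Ici 1) 1 :=
    hasDerivWithinAt_Ici_of_eqOn (hasDerivAt_tau hphI 1) one_lt_two
      fun q hq => min_eq_right (hout q (Or.inr hq.1))
  have hb1l : HasDerivWithinAt b (crossLog (gibbs p 1) p) (Iic 1) 1 :=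
    hasDerivWithinAt_Iic_of_eqOn (hasDerivAt_tau hpI 1) one_pos
      fun q hq => min_eq_left (hin q ⟨hq.1.le, hq.2⟩)
  have hB0r : HasDerivWithinAt B (crossLog (gibbs ph 0) ph) (Ici 0) 0 :=
    hasDerivWithinAt_Ici_of_eqOn (hasDerivAt_tau hphI 0) one_pos
      fun q hq => max_eq_right (hin q ⟨hq.1, hq.2.le⟩)
  have hB0l : HasDerivWithinAt B (crossLog (gibbs p 0) p) (Iic 0) 0 :=
    hasDerivWithinAt_Iic_of_eqOn (hasDerivAt_tau hpI 0) neg_one_lt_zero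
      fun q hq => max_eq_left (hout q (Or.inl hq.2))
  have hB1r : HasDerivWithinAt B (crossLog (gibbs p 1) p) (Ici 1) 1 :=
    hasDerivWithinAt_Ici_of_eqOn (hasDerivAt_tau hpI 1) one_lt_two
      fun q hq => max_eq_left (hout q (Or.inr hq.1))
  have hB1l : HasDerivWithinAt B (crossLog (gibbs ph 1) ph) (Iic 1) 1 :=
    hasDerivWithinAt_Iic_of_eqOn (hasDerivAt_tau hphI 1) one_pos
      fun q hq => max_eq_right (hin q ⟨hq.1.le, hq.2⟩)
  have hderiv : deriv (tau ph) = fun q => crossLog (gibbs ph q) ph :=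
    funext fun q => (hasDerivAt_tau hphI q).deriv
  refine ⟨b, B, Real.logb 2 (1 - ph), Real.logb 2 ph,
    fun q => bSep_blockMeasure hpI hphI htmono ht q,
    fun q => BSep_blockMeasure hpI hphI htmono ht q, ?_, ?_, ?_, ?_⟩
  · rintro q (rfl | rfl)
    · exact ⟨hb0r.differentiableWithinAt, hb0l.differentiableWithinAt,
        hB0r.differentiableWithinAt, hB0l.differentiableWithinAt⟩
    · exact ⟨hb1r.differentiableWithinAt, hb1l.differentiableWithinAt,
        hB1r.differentiableWithinAt, hB1l.differentiableWithinAt⟩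
  · rw [hderiv]
    exact tendsto_crossLog_gibbs_atTop hphI.1 hph
  · rw [hderiv]
    exact tendsto_crossLog_gibbs_atBot hphI.1 hph
  rintro α ⟨hα1, hα2⟩
  -- For `ph = 1 / 2` the two limits of the derivative coincide and no `α` lies strictly between
  -- their opposites.
  have hph2 : ph < 1 / 2 := by
    refine lt_of_le_of_ne hph fun h => ?_
    have : 1 - ph = ph := by linarith
    rw [this] at hα1
    linarith
  have hl1 : Real.logb 2 p < Real.logb 2 ph := Real.logb_lt_logb (by norm_num) hp hpph
  have hl2 : Real.logb 2 (1 - ph) < Real.logb 2 (1 - p) :=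
    Real.logb_lt_logb (by norm_num) (by linarith) (by linarith)
  -- The range of the derivative of `tau p` contains that of `tau ph`, because `p < ph ≤ 1 / 2`; so
  -- `-α` is attained by both.
  obtain ⟨q₁, hq₁⟩ := exists_crossLog_gibbs_eq (y := -α) hp (by linarith) (by linarith)
    (by linarith)
  obtain ⟨q₂, hq₂⟩ := exists_crossLog_gibbs_eq (y := -α) hphI.1 hph (by linarith) (by linarith)
  have hg₁ := gibbs_mem_Ioo hpI q₁
  have hg₂ := gibbs_mem_Ioo hphI q₂
  have hH₁ : -crossLog (gibbs p q₁) (gibbs p q₁) = α * q₁ + tau p q₁ := by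
    rw [crossLog_gibbs hpI, hq₁]; ring
  have hH₂ : -crossLog (gibbs ph q₂) (gibbs ph q₂) = α * q₂ + tau ph q₂ := by
    rw [crossLog_gibbs hphI, hq₂]; ring
  have hpos₁ := mul_add_tau_nonneg hpI hg₁ hq₁
  have hpos₂ := mul_add_tau_nonneg hphI hg₂ hq₂
  constructor
  · intro _
    refine eq_legendre_of_le (f := b) (fun q => bSep_blockMeasure hpI hphI htmono ht q)
      (le_dimH_levelSet hg₁ hg₂ hpI hphI hq₁ hq₂) (dimH_le_lowerDim _)
      (fun q => lowerDim_levelSet_le hpI hphI htmono ht q α) (fun q => ?_) ?_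
    · rcases min_choice (tau p q) (tau ph q) with h | h
      · simpa only [hb, h] using hpos₁ q
      · simpa only [hb, h] using hpos₂ q
    -- The smaller entropy is attained at its own minimiser, and `b` is below both functions there.
    · rw [hH₁, hH₂]
      rcases min_choice (α * q₁ + tau p q₁) (α * q₂ + tau ph q₂) with h | h
      · exact ⟨q₁, by rw [h]; linarith [min_le_left (tau p q₁) (tau ph q₁)]⟩
      · exact ⟨q₂, by rw [h]; linarith [min_le_right (tau p q₂) (tau ph q₂)]⟩
  · intro hα
    rw [hB0r.derivWithin (uniqueDiffWithinAt_Ici 0), hB0l.derivWithin (uniqueDiffWithinAt_Iic 0),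
      hB1r.derivWithin (uniqueDiffWithinAt_Ici 1), hB1l.derivWithin (uniqueDiffWithinAt_Iic 1)] at hα
    have key := eq_legendre_of_le (f := B) (fun q => BSep_blockMeasure hpI hphI htmono ht q)
      (le_upperDim_levelSet hg₁ hg₂ hpI hphI htmono ht hq₁ hq₂) (upperDim_le_packingDim _)
      (fun q => packingDim_levelSet_le hpI hphI q α) (fun q => ?_) ?_
    · exact ⟨key.1.symm, key.1 ▸ key.2⟩
    · exact (hpos₁ q).trans (by linarith [le_max_left (tau p q) (tau ph q)])
    · rw [hH₁, hH₂]
      -- Outside `(0, 1)` the maximum `B` is `tau p`, so `q₁` is a witness there; within `[0, 1]` it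
      -- is `tau ph`, so `q₂` is a witness.
      by_cases h1 : q₁ ≤ 0 ∨ 1 ≤ q₁
      · refine ⟨q₁, le_trans (le_of_eq ?_) (le_max_left _ _)⟩
        rw [hB]
        simp only
        rw [max_eq_left (hout q₁ h1)]
      by_cases h2 : q₂ ∈ Icc (0 : ℝ) 1
      · refine ⟨q₂, le_trans (le_of_eq ?_) (le_max_right _ _)⟩
        rw [hB]
        simp only
        rw [max_eq_right (hin q₂ h2)]
      -- There remains `0 < q₁ < 1` with `q₂ < 0` or `q₂ > 1`. As both derivatives increase
      -- strictly, `α` then lies between the one-sided slopes of `-B` at `0` in the first case and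
      -- at `1` in the second.
      exfalso
      apply hα
      push Not at h1
      have hmono := crossLog_gibbs_strictMono hp (by linarith : p < 1 / 2)
      have hmono' := crossLog_gibbs_strictMono hphI.1 hph2
      have m1 := hmono h1.1
      have m2 := hmono h1.2
      rw [mem_Icc, not_and_or, not_le, not_le] at h2
      simp only [hq₁] at m1 m2
      rcases h2 with h2 | h2
      · have m3 := hmono' h2
        simp only [hq₂] at m3
        exact Or.inl ⟨by linarith, by linarith⟩
      · have m3 := hmono' h2
        simp only [hq₂] at m3
        exact Or.inr ⟨by linarith, by linarith⟩
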